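/- Let $\mathbb{K}$ be a field of characteristic zero, and let $X$ be a topological space with a sheaf $\mathcal{O}_X$ of commutative $\mathbb{K}$-algebras (for instance a smooth or complex manifold, an analytic space or an algebraic variety with its structure sheaf). Write $\mathbb{K}_X$ for the constant sheaf. **Lie algebroids.** A Lie algebroid over $(X,\mathcal{O}_X)$ is a sheaf $\mathcal{L}$ of $(\mathbb{K}_X,\mathcal{O}_X)$-Lie–Rinehart algebras: a sheaf of $\mathcal{O}_X$-modules and of $\mathbb{K}$-Lie algebras with an $\mathcal{O}_X$-linear morphism of Lie algebras $\mathfrak{a}:\mathcal{L}\to\mathcal{D}er_{\mathbb{K}_X}(\mathcal{O}_X)$ (the anchor) such that $[D,fD']=f[D,D']+\mathfrak{a}(D)(f)D'$. Morphisms are the morphisms of sheaves that are $\mathcal{O}_X$-linear and compatible with brackets and anchors. **Bialgebras.** An $\mathcal{O}_X/\mathbb{K}_X$-bialgebra is a sheaf $\mathcal{A}$ of unital associative $\mathbb{K}$-algebras extending $\mathcal{O}_X$, together with morphisms of left $\mathcal{O}_X$-modules $\Delta:\mathcal{A}\to\mathcal{A}\otimes_{\mathcal{O}_X}\mathcal{A}$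 and $\epsilon:\mathcal{A}\to\mathcal{O}_X$ (the tensor product is that of left $\mathcal{O}_X$-modules), such that $(\mathcal{A},\Delta,\epsilon)$ is a coassociative, counital, cocommutative coalgebra in left $\mathcal{O}_X$-modules; $\Delta(\mathcal{A})\subset\mathcal{A}\,\bar\otimes_{\mathcal{O}_X}\mathcal{A}$, the subsheaf of those $\sum a_i\otimes b_i$ with $\sum a_if\otimes b_i=\sum a_i\otimes b_if$ for all local sections $f$ of $\mathcal{O}_X$, on which the product $(a\otimes b)(c\otimes d)=ac\otimes bd$ is well defined; and $\Delta(1)=1\otimes1$, $\epsilon(1)=1$, $\Delta(ab)=\Delta(a)\Delta(b)$, $\epsilon(ab)=\epsilon(a\,\epsilon(b))$. Morphisms are the morphisms of sheaves of unital algebras that are also morphisms of coalgebras in left $\mathcal{O}_X$-modules. **The functor $\mathscr{U}$.** For a $(\mathbb{K},R)$-Lie–Rinehart algebra $L$, $\mathcal{U}(R,L)$ is the unital $\mathbb{K}$-algebra generated by the algebra $R$ and the additive group $L$ with the relations $f\cdot D=fD$, $D\cdot D'-D'\cdot D=[D,D']$, $D\cdot f-f\cdot D=\mathfrak{a}(D)(f)$.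 The universal enveloping algebroid $\mathscr{U}(\mathcal{L})=\mathscr{U}(\mathcal{O}_X,\mathcal{L})$ is the sheaf associated with $U\mapsto\mathcal{U}(\mathcal{O}_X(U),\mathcal{L}(U))$; it is an $\mathcal{O}_X/\mathbb{K}_X$-bialgebra with $\Delta(D)=D\otimes1+1\otimes D$ and $\epsilon(D)=0$ for sections $D$ of $\mathcal{L}$. **The functor $\mathscr{P}$ and the primitive filtration.** For an $\mathcal{O}_X/\mathbb{K}_X$-bialgebra $\mathcal{A}$ let $\bar{\mathcal{A}}=\ker\epsilon$, $\bar\Delta(s)=\Delta(s)-(s\otimes1+1\otimes s)$ on $\bar{\mathcal{A}}$, $\bar\Delta^{(0)}=\mathrm{id}$, $\bar\Delta^{(n)}=(\bar\Delta\otimes\mathrm{id})\circ\bar\Delta^{(n-1)}$, $\bar{\mathcal{A}}_n=\ker\bar\Delta^{(n)}$ and $\mathcal{A}_n=\mathcal{O}_X\oplus\bar{\mathcal{A}}_n$. The sheaf $\mathscr{P}(\mathcal{A})=\bar{\mathcal{A}}_1$ of primitive elements is a Lie algebroid with the commutator bracket and the anchor $\mathfrak{a}(D)(f)=\epsilon(D\cdot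 f)$. The bialgebra $\mathcal{A}$ is *cocomplete* if $\mathcal{A}=\bigcup_n\mathcal{A}_n$ (union of subsheaves), *locally graded free* if every $\mathcal{A}_{n+1}/\mathcal{A}_n$, $n\ge 0$, is a locally free $\mathcal{O}_X$-module, and *of finite type* if $\mathscr{P}(\mathcal{A})$ is a locally free $\mathcal{O}_X$-module of finite rank. (The rank of a locally free module of finite rank may vary from point to point.) **Statement.** If the Lie algebroid $\mathcal{L}$ is a locally free $\mathcal{O}_X$-module of finite rank, then $\mathscr{U}(\mathcal{L})$ is cocomplete, locally graded free and of finite type; if the $\mathcal{O}_X/\mathbb{K}_X$-bialgebra $\mathcal{A}$ is cocomplete, locally graded free and of finite type, then $\mathscr{P}(\mathcal{A})$ is locally free of finite rank; and the functors so restricted, $\mathscr{U}$ and $\mathscr{P}$, are mutually quasi-inverse equivalences between the full subcategory of locally free Lie algebroids of finite rank over $(X,\mathcal{O}_X)$ and the full subcategory of cocomplete, locally graded free $\mathcal{O}_X/\mathbb{K}_X$-bialgebras of finite type. -/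

import Mathlib

universe u

open scoped TensorProduct

noncomputable section

set_option linter.unusedSectionVars false

/-! ### `R/K`-bialgebras

A unital ring `A` with a ring homomorphism `R → A` (not nec. central) is encoded by
`[Ring A] [Module R A] [IsScalarTower R A A]`: the homomorphism is `r ↦ r • 1` and the module
structure is left multiplication.  `A ⊗[R] A` is the tensor product of *left* `R`-modules. -/

namespace RBialgebra

section Takeuchi

variable (R : Type u) {A : Type u} [CommRing R] [Ring A] [Module R A] [IsScalarTower R A A]

/-- Right multiplication `s ⊗ t ↦ s a ⊗ t b` on `A ⊗[R] A`. -/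
def rmul (a b : A) : A ⊗[R] A →ₗ[R] A ⊗[R] A :=
  TensorProduct.map (LinearMap.mulRight R a) (LinearMap.mulRight R b)

@[simp] theorem rmul_tmul (a b s t : A) :
    rmul R a b (s ⊗ₜ t) = (s * a) ⊗ₜ (t * b) := rfl

theorem rmul_rmul (a b c d : A) (t : A ⊗[R] A) :
    rmul R c d (rmul R a b t) = rmul R (a * c) (b * d) t := by
  induction t using TensorProduct.induction_on with
  | zero => simp
  | tmul s t => simp [mul_assoc]
  | add s t hs ht => simp only [map_add, hs, ht]

theorem rmul_add_left (a a' b : A) (t : A ⊗[R] A) :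
    rmul R (a + a') b t = rmul R a b t + rmul R a' b t := by
  induction t using TensorProduct.induction_on with
  | zero => simp
  | tmul s t => simp [mul_add, TensorProduct.add_tmul]
  | add s t hs ht => simp only [map_add, hs, ht]; abel

theorem rmul_add_right (a b b' : A) (t : A ⊗[R] A) :
    rmul R a (b + b') t = rmul R a b t + rmul R a b' t := by
  induction t using TensorProduct.induction_on with
  | zero => simp
  | tmul s t => simp [mul_add, TensorProduct.tmul_add]
  | add s t hs ht => simp only [map_add, hs, ht]; abel

variable (A) in
/-- The submodule `A ⊗̄ A` of those `∑ aᵢ ⊗ bᵢ` with `∑ aᵢ r ⊗ bᵢ = ∑ aᵢ ⊗ bᵢ r` for all `r : R`. -/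
def takeuchi : Submodule R (A ⊗[R] A) where
  carrier := {t | ∀ r : R, rmul R (r • 1) 1 t = rmul R 1 (r • 1) t}
  add_mem' hs ht r := by rw [map_add, map_add, hs r, ht r]
  zero_mem' r := by simp
  smul_mem' c t ht r := by rw [map_smul, map_smul, ht r]

/-- The product `(∑ aᵢ ⊗ bᵢ) (∑ cⱼ ⊗ dⱼ) = ∑ aᵢ cⱼ ⊗ bᵢ dⱼ`, which is well defined because the
left factor is in `A ⊗̄ A`. -/
def takeuchiMul (s : takeuchi R A) : A ⊗[R] A →+ A ⊗[R] A :=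
  TensorProduct.liftAddHom
    (AddMonoidHom.mk' (fun c => AddMonoidHom.mk' (fun d => rmul R c d s.1)
      (fun d d' => rmul_add_right R c d d' s.1))
      (fun c c' => by ext d; exact rmul_add_left R c c' d s.1))
    (fun r c d => by
      change rmul R (r • c) d s.1 = rmul R c (r • d) s.1
      have h := congrArg (rmul R c d) (s.2 r)
      rw [rmul_rmul, rmul_rmul] at h
      simpa using h)

@[simp] theorem takeuchiMul_tmul (s : takeuchi R A) (c d : A) :
    takeuchiMul R s (c ⊗ₜ d) = rmul R c d s.1 := rfl

end Takeuchi

/-- The compatibility conditions making a `K`-algebra `A` extending `R`, which is also a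
cocommutative coalgebra in left `R`-modules, into an `R/K`-bialgebra. -/
class IsBialgebra (R A : Type u) [CommRing R] [Ring A] [Module R A] [IsScalarTower R A A]
    [Coalgebra R A] : Prop where
  comul_mem : ∀ a : A, Coalgebra.comul (R := R) a ∈ takeuchi R A
  counit_one : Coalgebra.counit (R := R) (1 : A) = 1
  comul_one : Coalgebra.comul (R := R) (1 : A) = 1 ⊗ₜ 1
  counit_mul : ∀ a b : A, Coalgebra.counit (R := R) (a * b)
    = Coalgebra.counit (R := R) (a * (Coalgebra.counit (R := R) b • (1 : A)))
  comul_mul : ∀ a b : A, Coalgebra.comul (R := R) (a * b)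
    = takeuchiMul R ⟨Coalgebra.comul a, comul_mem a⟩ (Coalgebra.comul b)

section Primitive

variable (R A : Type u) [CommRing R] [Ring A] [Module R A] [Coalgebra R A]

/-- `Δ̄(s) = Δ(s) - (s ⊗ 1 + 1 ⊗ s)`. -/
def redComul : A →ₗ[R] A ⊗[R] A :=
  Coalgebra.comul - ((TensorProduct.mk R A A).flip 1 + TensorProduct.mk R A A 1)

/-- The iterated reduced coproduct `Δ̄⁽ⁿ⁾ : A → A ⊗ ⋯ ⊗ A` (with `n + 1` factors): `Δ̄⁽⁰⁾ = id` and
`Δ̄⁽ⁿ⁺¹⁾ = (Δ̄ ⊗ id ⊗ ⋯ ⊗ id) ∘ ⋯ ∘ (Δ̄ ⊗ id) ∘ Δ̄ = (Δ̄⁽ⁿ⁾ ⊗ id) ∘ Δ̄`. -/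
def iterRedComul : ℕ → Σ M : ModuleCat.{u} R, A →ₗ[R] M
  | 0 => ⟨ModuleCat.of R A, LinearMap.id⟩
  | n + 1 => ⟨ModuleCat.of R ((iterRedComul n).1 ⊗[R] A),
      TensorProduct.map (iterRedComul n).2 LinearMap.id ∘ₗ redComul R A⟩

/-- The primitive filtration `Āₙ = {s ∈ ker ε | Δ̄⁽ⁿ⁾ s = 0}`. -/
def primFilt (n : ℕ) : Submodule R A :=
  LinearMap.ker (Coalgebra.counit (R := R) (A := A)) ⊓ LinearMap.ker (iterRedComul R A n).2

variable {R A}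

theorem mem_primFilt_one {a : A} : a ∈ primFilt R A 1 ↔
    Coalgebra.counit (R := R) a = 0 ∧ Coalgebra.comul (R := R) a = a ⊗ₜ 1 + 1 ⊗ₜ a := by
  simp only [primFilt, Submodule.mem_inf, LinearMap.mem_ker]
  refine and_congr_right fun _ => ?_
  change TensorProduct.map LinearMap.id LinearMap.id (redComul R A a) = 0 ↔ _
  rw [TensorProduct.map_id]
  simp [redComul, sub_eq_zero]

end Primitive

section PrimLie

variable {R A : Type u} [CommRing R] [Ring A] [Module R A] [IsScalarTower R A A]
  [Coalgebra R A] [IsBialgebra R A]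

theorem takeuchiMul_primitive {a : A} (ha : a ∈ primFilt R A 1) (c d : A) :
    takeuchiMul R ⟨Coalgebra.comul a, IsBialgebra.comul_mem a⟩ (c ⊗ₜ d)
      = (a * c) ⊗ₜ d + c ⊗ₜ (a * d) := by
  simp [(mem_primFilt_one.1 ha).2]

/-- In an `R/K`-bialgebra a primitive element `a` satisfies `a r - r a = ε(a r)`. -/
theorem primitive_comm {a : A} (ha : a ∈ primFilt R A 1) (r : R) :
    a * (r • (1 : A)) = r • a + Coalgebra.counit (R := R) (a * (r • (1 : A))) • (1 : A) := by
  obtain ⟨h0, h1⟩ := mem_primFilt_one.1 ha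
  have h := IsBialgebra.comul_mem (R := R) a r
  rw [h1] at h
  simp only [map_add, rmul_tmul, mul_one, one_mul] at h
  have h2 := congrArg (fun t => TensorProduct.lid R A
    (LinearMap.rTensor A (Coalgebra.counit (R := R)) t)) h
  simp only [map_add, LinearMap.rTensor_tmul, TensorProduct.lid_tmul, map_smul, smul_eq_mul,
    IsBialgebra.counit_one, h0, mul_one, one_smul, zero_smul, zero_add] at h2
  exact h2.symm.trans (add_comm _ _)

theorem lie_mem_primFilt {a b : A} (ha : a ∈ primFilt R A 1) (hb : b ∈ primFilt R A 1) :
    a * b - b * a ∈ primFilt R A 1 := by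
  have key : ∀ {a b : A}, a ∈ primFilt R A 1 → b ∈ primFilt R A 1 →
      Coalgebra.counit (R := R) (a * b) = 0 ∧ Coalgebra.comul (R := R) (a * b)
        = (a * b) ⊗ₜ 1 + b ⊗ₜ a + (a ⊗ₜ b + 1 ⊗ₜ (a * b)) := by
    intro a b ha hb
    refine ⟨?_, ?_⟩
    · rw [IsBialgebra.counit_mul, (mem_primFilt_one.1 hb).1]; simp
    · rw [IsBialgebra.comul_mul, (mem_primFilt_one.1 hb).2, map_add, takeuchiMul_primitive ha,
        takeuchiMul_primitive ha]
      simp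
  obtain ⟨e1, d1⟩ := key ha hb
  obtain ⟨e2, d2⟩ := key hb ha
  refine mem_primFilt_one.2 ⟨by simp [e1, e2], ?_⟩
  rw [map_sub, d1, d2, TensorProduct.sub_tmul, TensorProduct.tmul_sub]
  abel

variable (R A) in
/-- The primitive elements of an `R/K`-bialgebra. -/
def Prim : Type u := primFilt R A 1

namespace Prim

instance : AddCommGroup (Prim R A) := inferInstanceAs (AddCommGroup (primFilt R A 1))
instance : Module R (Prim R A) := inferInstanceAs (Module R (primFilt R A 1))

/-- The inclusion of the primitive elements. -/
def val : Prim R A →ₗ[R] A := (primFilt R A 1).subtype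

theorem val_injective : Function.Injective (val (R := R) (A := A)) := Subtype.val_injective

@[ext] theorem ext {a b : Prim R A} (h : val a = val b) : a = b := val_injective h

theorem val_mem (a : Prim R A) : val a ∈ primFilt R A 1 := a.2

/-- The commutator bracket. -/
instance : Bracket (Prim R A) (Prim R A) :=
  ⟨fun a b => ⟨val a * val b - val b * val a, lie_mem_primFilt a.2 b.2⟩⟩

theorem val_lie (a b : Prim R A) : val ⁅a, b⁆ = val a * val b - val b * val a := rfl

instance : LieRing (Prim R A) where
  add_lie a b c := by ext; simp only [val_lie, map_add]; noncomm_ring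
  lie_add a b c := by ext; simp only [val_lie, map_add]; noncomm_ring
  lie_self a := by ext; simp only [val_lie, map_zero]; noncomm_ring
  leibniz_lie a b c := by ext; simp only [val_lie, map_add]; noncomm_ring

/-- The anchor `f ↦ ε(a f)`. -/
instance : Bracket (Prim R A) R := ⟨fun a f => Coalgebra.counit (R := R) (val a * (f • (1 : A)))⟩

theorem lie_def (a : Prim R A) (f : R) :
    ⁅a, f⁆ = Coalgebra.counit (R := R) (val a * (f • (1 : A))) := rfl

theorem val_mul_smul_one (a : Prim R A) (f : R) :
    val a * (f • (1 : A)) = f • val a + ⁅a, f⁆ • (1 : A) := primitive_comm a.2 f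

theorem val_mul_smul (a : Prim R A) (f : R) (b : A) :
    val a * (f • b) = f • (val a * b) + ⁅a, f⁆ • b := by
  have h := congrArg (· * b) (val_mul_smul_one a f)
  simpa [mul_assoc, add_mul, smul_mul_assoc] using h

theorem smul_one_injective {f g : R} (h : f • (1 : A) = g • (1 : A)) : f = g := by
  have := congrArg (Coalgebra.counit (R := R)) h
  simpa [IsBialgebra.counit_one] using this

theorem lie_mul' (a : Prim R A) (f g : R) : ⁅a, f * g⁆ = f * ⁅a, g⁆ + ⁅a, f⁆ * g := by
  rw [lie_def, mul_smul, val_mul_smul, map_add, map_smul, map_smul, map_smul,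
    IsBialgebra.counit_one]
  simp [lie_def]

instance : LieRingModule (Prim R A) R where
  add_lie a b f := by simp [lie_def, add_mul]
  lie_add a f g := by simp [lie_def, add_smul, mul_add]
  leibniz_lie a b f := by
    apply smul_one_injective (A := A)
    have e : ∀ (c : Prim R A) (g : R),
        ⁅c, g⁆ • (1 : A) = val c * (g • (1 : A)) - g • val c := fun c g => by
      rw [val_mul_smul_one]; abel
    have h1 := val_mul_smul a f (val b)
    have h2 := val_mul_smul b f (val a)
    have h5 : val b * (⁅a, f⁆ • (1 : A)) = val b * (val a * (f • 1)) - val b * (f • val a) := by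
      rw [e a f, mul_sub]
    have h6 : val a * (⁅b, f⁆ • (1 : A)) = val a * (val b * (f • 1)) - val a * (f • val b) := by
      rw [e b f, mul_sub]
    rw [add_smul, e a ⁅b, f⁆, e ⁅a, b⁆ f, e b ⁅a, f⁆, val_lie, h5, h6, h1, h2, sub_mul, smul_sub,
      mul_assoc, mul_assoc]
    abel

instance : LieRinehartRing R (Prim R A) where
  lie_smul_eq_mul' f g a := by simp [lie_def, smul_mul_assoc]
  leibniz_mul_right' a f g := lie_mul' a f g
  leibniz_smul_right' a b f := by
    ext
    simp only [val_lie, map_add, map_smul, val_mul_smul, smul_mul_assoc, smul_sub]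
    abel

variable {K : Type u} [Field K] [Algebra K R] [Algebra K A] [IsScalarTower K R A]

instance : Module K (Prim R A) := inferInstanceAs (Module K (primFilt R A 1))

theorem val_ksmul (k : K) (a : Prim R A) : val (k • a) = k • val a := rfl

instance : LieAlgebra K (Prim R A) where
  lie_smul k a b := by
    ext; simp only [val_lie, val_ksmul, smul_sub, mul_smul_comm, smul_mul_assoc]

instance : IsScalarTower K R (Prim R A) where
  smul_assoc k f a := by ext; simp only [val_ksmul, map_smul, smul_assoc]

instance : LieRinehartAlgebra K R (Prim R A) where
  smul_lie k a f := by
    simp only [lie_def, val_ksmul, smul_mul_assoc]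
    exact LinearMap.map_smul_of_tower _ _ _
  lie_smul k a f := by
    simp only [lie_def, smul_assoc, mul_smul_comm]
    exact LinearMap.map_smul_of_tower _ _ _

end Prim

end PrimLie

end RBialgebra

/-! ### The universal enveloping algebra of a Lie-Rinehart algebra -/

/-- The defining relations of the universal enveloping algebra, on the free `K`-algebra generated
by the set `R ⊔ L`. -/
inductive EnvRel (K R L : Type u) [Field K] [CommRing R] [Algebra K R] [LieRing L] [Module R L]
    [LieRingModule L R] : FreeAlgebra K (R ⊕ L) → FreeAlgebra K (R ⊕ L) → Prop
  | algebraMap (k : K) : EnvRel K R L (FreeAlgebra.ι K (Sum.inl (algebraMap K R k)))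
      (algebraMap K (FreeAlgebra K (R ⊕ L)) k)
  | fun_add (f g : R) : EnvRel K R L (FreeAlgebra.ι K (Sum.inl (f + g)))
      (FreeAlgebra.ι K (Sum.inl f) + FreeAlgebra.ι K (Sum.inl g))
  | fun_mul (f g : R) : EnvRel K R L (FreeAlgebra.ι K (Sum.inl (f * g)))
      (FreeAlgebra.ι K (Sum.inl f) * FreeAlgebra.ι K (Sum.inl g))
  | lie_add (x y : L) : EnvRel K R L (FreeAlgebra.ι K (Sum.inr (x + y)))
      (FreeAlgebra.ι K (Sum.inr x) + FreeAlgebra.ι K (Sum.inr y))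
  | fun_smul (f : R) (x : L) : EnvRel K R L (FreeAlgebra.ι K (Sum.inr (f • x)))
      (FreeAlgebra.ι K (Sum.inl f) * FreeAlgebra.ι K (Sum.inr x))
  | lie_lie (x y : L) : EnvRel K R L (FreeAlgebra.ι K (Sum.inr ⁅x, y⁆))
      (FreeAlgebra.ι K (Sum.inr x) * FreeAlgebra.ι K (Sum.inr y)
        - FreeAlgebra.ι K (Sum.inr y) * FreeAlgebra.ι K (Sum.inr x))
  | lie_fun (x : L) (f : R) : EnvRel K R L
      (FreeAlgebra.ι K (Sum.inr x) * FreeAlgebra.ι K (Sum.inl f))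
      (FreeAlgebra.ι K (Sum.inl f) * FreeAlgebra.ι K (Sum.inr x)
        + FreeAlgebra.ι K (Sum.inl ⁅x, f⁆))

/-- The universal enveloping algebra `𝒰(R, L)` of a `(K, R)`-Lie-Rinehart algebra `L`. -/
def UEnv (K R L : Type u) [Field K] [CommRing R] [Algebra K R] [LieRing L] [Module R L]
    [LieRingModule L R] : Type u := RingQuot (EnvRel K R L)

namespace UEnv

section Basic

variable (K R L : Type u) [Field K] [CommRing R] [Algebra K R] [LieRing L] [Module R L]
  [LieRingModule L R]

instance : Ring (UEnv K R L) := inferInstanceAs (Ring (RingQuot (EnvRel K R L)))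
instance : Algebra K (UEnv K R L) := inferInstanceAs (Algebra K (RingQuot (EnvRel K R L)))

/-- The quotient map from the free algebra. -/
def mk : FreeAlgebra K (R ⊕ L) →ₐ[K] UEnv K R L := RingQuot.mkAlgHom K (EnvRel K R L)

variable {R L}

theorem mk_rel {a b : FreeAlgebra K (R ⊕ L)} (h : EnvRel K R L a b) : mk K R L a = mk K R L b :=
  RingQuot.mkAlgHom_rel K h

variable (R L) in
/-- The canonical map `R → 𝒰(R, L)`. -/
def ofFun : R →ₐ[K] UEnv K R L where
  toFun f := mk K R L (FreeAlgebra.ι K (Sum.inl f))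
  map_one' := by
    have h := mk_rel K (EnvRel.algebraMap (K := K) (R := R) (L := L) 1)
    simpa using h
  map_mul' f g := by rw [mk_rel K (EnvRel.fun_mul f g), map_mul]
  map_zero' := by
    have h := mk_rel K (EnvRel.algebraMap (K := K) (R := R) (L := L) 0)
    simpa using h
  map_add' f g := by rw [mk_rel K (EnvRel.fun_add f g), map_add]
  commutes' k := by rw [mk_rel K (EnvRel.algebraMap k), AlgHom.commutes]

variable (R L) in
/-- The canonical map `L → 𝒰(R, L)`. -/
def ofLie : L →+ UEnv K R L :=
  AddMonoidHom.mk' (fun x => mk K R L (FreeAlgebra.ι K (Sum.inr x)))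
    (fun x y => by rw [mk_rel K (EnvRel.lie_add x y), map_add])

theorem ofLie_smul (f : R) (x : L) : ofLie K R L (f • x) = ofFun K R L f * ofLie K R L x := by
  change mk K R L _ = mk K R L _ * mk K R L _
  rw [mk_rel K (EnvRel.fun_smul f x), map_mul]

theorem ofLie_lie (x y : L) : ofLie K R L ⁅x, y⁆
    = ofLie K R L x * ofLie K R L y - ofLie K R L y * ofLie K R L x := by
  change mk K R L _ = mk K R L _ * mk K R L _ - mk K R L _ * mk K R L _
  rw [mk_rel K (EnvRel.lie_lie x y), map_sub, map_mul, map_mul]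

theorem ofLie_mul_ofFun (x : L) (f : R) : ofLie K R L x * ofFun K R L f
    = ofFun K R L f * ofLie K R L x + ofFun K R L ⁅x, f⁆ := by
  change mk K R L _ * mk K R L _ = mk K R L _ * mk K R L _ + mk K R L _
  rw [← map_mul, mk_rel K (EnvRel.lie_fun x f), map_add, map_mul]

/-- `𝒰(R, L)` as a left `R`-module. -/
instance : Module R (UEnv K R L) := Module.compHom _ (ofFun K R L).toRingHom

theorem smul_def (f : R) (u : UEnv K R L) : f • u = ofFun K R L f * u := rfl

theorem ofFun_eq (f : R) : ofFun K R L f = f • (1 : UEnv K R L) := by rw [smul_def, mul_one]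

instance : IsScalarTower R (UEnv K R L) (UEnv K R L) where
  smul_assoc f u v := by simp only [smul_def, smul_eq_mul, mul_assoc]

instance : IsScalarTower K R (UEnv K R L) where
  smul_assoc k f u := by simp only [smul_def, map_smul, smul_mul_assoc]

/-- Left multiplication form of the generation of `𝒰(R, L)` by `R` and `L`. -/
theorem induction {p : UEnv K R L → Prop} (h1 : p 1) (hadd : ∀ u v, p u → p v → p (u + v))
    (hfun : ∀ (f : R) u, p u → p (f • u)) (hlie : ∀ (x : L) u, p u → p (ofLie K R L x * u))
    (u : UEnv K R L) : p u := by
  obtain ⟨a, rfl⟩ := RingQuot.mkAlgHom_surjective K (EnvRel K R L) u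
  change p (mk K R L a)
  suffices H : ∀ v, p v → p (mk K R L a * v) by simpa using H 1 h1
  induction a using FreeAlgebra.induction with
  | grade0 k =>
    intro v hv
    have : mk K R L (algebraMap K _ k) * v = algebraMap K R k • v := by
      rw [smul_def, AlgHom.commutes, AlgHom.commutes]
    rw [this]; exact hfun _ _ hv
  | grade1 z =>
    rcases z with f | x
    · exact fun v hv => hfun f v hv
    · exact fun v hv => hlie x v hv
  | mul a b ha hb =>
    intro v hv
    rw [map_mul, mul_assoc]; exact ha _ (hb _ hv)
  | add a b ha hb =>
    intro v hv
    rw [map_add, add_mul]; exact hadd _ _ (ha _ hv) (hb _ hv)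

variable {B : Type*} [Ring B] [Algebra K B]

/-- The universal property of `𝒰(R, L)`. -/
def lift (φ : R →ₐ[K] B) (ψ : L →+ B) (h1 : ∀ f x, ψ (f • x) = φ f * ψ x)
    (h2 : ∀ x y, ψ ⁅x, y⁆ = ψ x * ψ y - ψ y * ψ x)
    (h3 : ∀ x f, ψ x * φ f = φ f * ψ x + φ ⁅x, f⁆) : UEnv K R L →ₐ[K] B :=
  RingQuot.liftAlgHom K ⟨FreeAlgebra.lift K (Sum.elim φ ψ), by
    intro a b h
    induction h with
    | algebraMap k => simp
    | fun_add f g => simp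
    | fun_mul f g => simp
    | lie_add x y => simp
    | fun_smul f x => simp [h1]
    | lie_lie x y => simp [h2]
    | lie_fun x f => simp [h3]⟩

variable {K}
variable (φ : R →ₐ[K] B) (ψ : L →+ B) (h1 : ∀ f x, ψ (f • x) = φ f * ψ x)
    (h2 : ∀ x y, ψ ⁅x, y⁆ = ψ x * ψ y - ψ y * ψ x)
    (h3 : ∀ x f, ψ x * φ f = φ f * ψ x + φ ⁅x, f⁆)

@[simp] theorem lift_ofFun (f : R) : lift K φ ψ h1 h2 h3 (ofFun K R L f) = φ f := by
  change RingQuot.liftAlgHom K _ (RingQuot.mkAlgHom K _ _) = _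
  rw [RingQuot.liftAlgHom_mkAlgHom_apply]; simp

@[simp] theorem lift_ofLie (x : L) : lift K φ ψ h1 h2 h3 (ofLie K R L x) = ψ x := by
  change RingQuot.liftAlgHom K _ (RingQuot.mkAlgHom K _ _) = _
  rw [RingQuot.liftAlgHom_mkAlgHom_apply]; simp

theorem lift_smul (f : R) (u : UEnv K R L) :
    lift K φ ψ h1 h2 h3 (f • u) = φ f * lift K φ ψ h1 h2 h3 u := by
  rw [smul_def, map_mul, lift_ofFun]

end Basic

section Coalgebra

variable {K R L : Type u} [Field K] [CommRing R] [Algebra K R] [LieRing L] [Module R L]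
  [LieRingModule L R] [LieRinehartRing R L] [LieAlgebra K L] [LieRinehartAlgebra K R L]

theorem ofLie_mul_smul (x : L) (f : R) (u : UEnv K R L) :
    ofLie K R L x * (f • u) = f • (ofLie K R L x * u) + ⁅x, f⁆ • u := by
  simp only [smul_def, ← mul_assoc, ofLie_mul_ofFun, add_mul]

/-- The action of `L` on `R` by derivations extends to `𝒰(R, L)`. -/
def actR : UEnv K R L →ₐ[K] Module.End K R :=
  lift K (Algebra.lmul K R) (LieModule.toEnd K L R : L →ₗ[K] Module.End K R).toAddMonoidHom
    (fun f x => by ext g; simp)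
    (fun x y => by ext g; simp)
    (fun x f => by ext g; simp)

/-- The counit `ε(u) = u · 1`. -/
def counit : UEnv K R L →ₗ[R] R where
  toFun u := actR u 1
  map_add' u v := by simp
  map_smul' f u := by simp [actR, lift_smul]

theorem counit_apply (u : UEnv K R L) : counit u = actR u 1 := rfl

theorem counit_one : counit (1 : UEnv K R L) = 1 := by simp [counit_apply]

theorem counit_ofLie_mul (x : L) (u : UEnv K R L) :
    counit (ofLie K R L x * u) = ⁅x, counit u⁆ := by
  simp [counit_apply, actR]

theorem counit_mul (u v : UEnv K R L) :
    counit (u * v) = counit (u * (counit v • (1 : UEnv K R L))) := by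
  have h : actR (counit v • (1 : UEnv K R L)) (1 : R) = counit v := by
    rw [← counit_apply, map_smul, counit_one]; simp
  rw [counit_apply, counit_apply, map_mul, map_mul, Module.End.mul_apply, Module.End.mul_apply, h,
    counit_apply]

section TensorOp

variable {M N P : Type u} [AddCommGroup M] [Module R M] [Module K M] [IsScalarTower K R M]
  [AddCommGroup N] [Module R N] [Module K N] [IsScalarTower K R N]

/-- `f` is an operator on `M` over the derivation `x` of `R`. -/
def IsOver (x : L) (f : Module.End K M) : Prop := ∀ (r : R) (m : M), f (r • m) = r • f m + ⁅x, r⁆ • m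

/-- The operator `f ⊗ 1 + 1 ⊗ g` on `M ⊗[R] N`. -/
def tensorOp (x : L) (f : Module.End K M) (hf : IsOver (R := R) x f) (g : Module.End K N)
    (hg : IsOver (R := R) x g) : Module.End K (M ⊗[R] N) :=
  let F : M ⊗[R] N →+ M ⊗[R] N := TensorProduct.liftAddHom
    (AddMonoidHom.mk' (fun m => AddMonoidHom.mk' (fun n => f m ⊗ₜ[R] n + m ⊗ₜ[R] g n)
      (fun n n' => by simp only [map_add, TensorProduct.tmul_add]; abel))
      (fun m m' => by
        ext n; simp only [map_add, TensorProduct.add_tmul, AddMonoidHom.mk'_apply,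
          AddMonoidHom.add_apply]; abel))
    (fun r m n => by
      simp only [AddMonoidHom.mk'_apply, hf r m, hg r n, TensorProduct.add_tmul,
        TensorProduct.tmul_add, TensorProduct.smul_tmul]
      abel)
  { toFun := F
    map_add' := F.map_add
    map_smul' := fun k t => by
      induction t using TensorProduct.induction_on with
      | zero => simp
      | tmul m n =>
        change F ((k • m) ⊗ₜ n) = k • F (m ⊗ₜ n)
        change f (k • m) ⊗ₜ[R] n + (k • m) ⊗ₜ[R] g n = k • (f m ⊗ₜ[R] n + m ⊗ₜ[R] g n)
        rw [map_smul, smul_add, TensorProduct.smul_tmul', TensorProduct.smul_tmul']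
      | add s t hs ht =>
        simp only [RingHom.id_apply] at hs ht ⊢
        rw [smul_add, map_add, map_add, smul_add, hs, ht] }

@[simp] theorem tensorOp_tmul (x : L) (f : Module.End K M) (hf : IsOver (R := R) x f)
    (g : Module.End K N) (hg : IsOver (R := R) x g) (m : M) (n : N) :
    tensorOp x f hf g hg (m ⊗ₜ n) = f m ⊗ₜ n + m ⊗ₜ g n := rfl

theorem tensorOp_isOver (x : L) (f : Module.End K M) (hf : IsOver (R := R) x f)
    (g : Module.End K N) (hg : IsOver (R := R) x g) :
    IsOver (R := R) x (tensorOp x f hf g hg) := by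
  intro r t
  induction t using TensorProduct.induction_on with
  | zero => simp
  | tmul m n =>
    rw [TensorProduct.smul_tmul', tensorOp_tmul, tensorOp_tmul, hf, TensorProduct.add_tmul,
      smul_add, TensorProduct.smul_tmul', TensorProduct.smul_tmul', TensorProduct.smul_tmul']
    abel
  | add s t hs ht => rw [smul_add, map_add, hs, ht, map_add, smul_add, smul_add]; abel

end TensorOp

/-- Left multiplication by `x : L` on `𝒰(R, L)`. -/
def lmulLie (x : L) : Module.End K (UEnv K R L) := Algebra.lmul K _ (ofLie K R L x)

@[simp] theorem lmulLie_apply (x : L) (u : UEnv K R L) : lmulLie x u = ofLie K R L x * u := rfl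

theorem lmulLie_isOver (x : L) : IsOver (R := R) x (lmulLie (K := K) (R := R) x) :=
  fun r u => ofLie_mul_smul x r u

/-- The operator `x ⊗ 1 + 1 ⊗ x` on `𝒰 ⊗ 𝒰`. -/
def op2 (x : L) : Module.End K (UEnv K R L ⊗[R] UEnv K R L) :=
  tensorOp x (lmulLie x) (lmulLie_isOver x) (lmulLie x) (lmulLie_isOver x)

@[simp] theorem op2_tmul (x : L) (u v : UEnv K R L) :
    op2 x (u ⊗ₜ[R] v) = (ofLie K R L x * u) ⊗ₜ v + u ⊗ₜ (ofLie K R L x * v) := rfl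

theorem op2_isOver (x : L) : IsOver (R := R) x (op2 (K := K) (R := R) x) := tensorOp_isOver _ _ _ _ _

/-- The operator `x ⊗ 1 ⊗ 1 + 1 ⊗ x ⊗ 1 + 1 ⊗ 1 ⊗ x` on `𝒰 ⊗ (𝒰 ⊗ 𝒰)`. -/
def op3 (x : L) : Module.End K (UEnv K R L ⊗[R] (UEnv K R L ⊗[R] UEnv K R L)) :=
  tensorOp x (lmulLie x) (lmulLie_isOver x) (op2 x) (op2_isOver x)

theorem op3_tmul (x : L) (u : UEnv K R L) (t : UEnv K R L ⊗[R] UEnv K R L) :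
    op3 x (u ⊗ₜ[R] t) = (ofLie K R L x * u) ⊗ₜ t + u ⊗ₜ op2 x t := rfl

/-- The action of `𝒰(R, L)` on `𝒰 ⊗ 𝒰` for which `x : L` acts as `x ⊗ 1 + 1 ⊗ x`. -/
def act2 : UEnv K R L →ₐ[K] Module.End K (UEnv K R L ⊗[R] UEnv K R L) :=
  lift K (Algebra.lsmul K K (UEnv K R L ⊗[R] UEnv K R L))
    (AddMonoidHom.mk' op2 (fun x y => by
      ext t
      induction t using TensorProduct.induction_on with
      | zero => simp
      | tmul u v => simp [add_mul, TensorProduct.add_tmul, TensorProduct.tmul_add]; abel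
      | add s t hs ht => rw [map_add, hs, ht, map_add]))
    (fun f x => by
      ext t
      induction t using TensorProduct.induction_on with
      | zero => simp
      | tmul u v =>
        simp [ofLie_smul, ← smul_def, TensorProduct.smul_tmul', smul_mul_assoc]
      | add s t hs ht => rw [map_add, hs, ht, map_add])
    (fun x y => by
      ext t
      induction t using TensorProduct.induction_on with
      | zero => simp
      | tmul u v =>
        simp [ofLie_lie, sub_mul, mul_assoc, TensorProduct.sub_tmul, TensorProduct.tmul_sub]
        abel
      | add s t hs ht => rw [map_add, hs, ht, map_add])
    (fun x f => by
      ext t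
      simpa using op2_isOver x f t)

theorem act2_ofLie (x : L) : act2 (ofLie K R L x) = op2 x := by
  rw [act2, lift_ofLie]; rfl

theorem act2_smul (f : R) (u : UEnv K R L) (t : UEnv K R L ⊗[R] UEnv K R L) :
    act2 (f • u) t = f • act2 u t := by
  rw [act2, lift_smul]; rfl

/-- The comultiplication `Δ(u) = u · (1 ⊗ 1)`; it is multiplicative, with
`Δ(x) = x ⊗ 1 + 1 ⊗ x` for `x : L`. -/
def comul : UEnv K R L →ₗ[R] UEnv K R L ⊗[R] UEnv K R L where
  toFun u := act2 u (1 ⊗ₜ 1)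
  map_add' u v := by simp
  map_smul' f u := act2_smul f u _

theorem comul_apply (u : UEnv K R L) : comul u = act2 u (1 ⊗ₜ 1) := rfl

theorem comul_one : comul (1 : UEnv K R L) = 1 ⊗ₜ[R] 1 := by simp [comul_apply]

theorem comul_ofLie_mul (x : L) (u : UEnv K R L) :
    comul (ofLie K R L x * u) = op2 x (comul u) := by
  rw [comul_apply, map_mul, act2_ofLie]; rfl

theorem op2_rmul (x : L) (a b : UEnv K R L) (t : UEnv K R L ⊗[R] UEnv K R L) :
    op2 x (RBialgebra.rmul R a b t) = RBialgebra.rmul R a b (op2 x t) := by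
  induction t using TensorProduct.induction_on with
  | zero => simp
  | tmul u v => simp [mul_assoc]
  | add s t hs ht => simp only [map_add, hs, ht]

theorem act2_rmul (u a b : UEnv K R L) (t : UEnv K R L ⊗[R] UEnv K R L) :
    act2 u (RBialgebra.rmul R a b t) = RBialgebra.rmul R a b (act2 u t) := by
  induction u using UEnv.induction with
  | h1 => simp
  | hadd u v hu hv => simp [hu, hv]
  | hfun f u hu => rw [act2_smul, act2_smul, map_smul, hu]
  | hlie x u hu =>
    rw [map_mul, Module.End.mul_apply, Module.End.mul_apply, hu, act2_ofLie, op2_rmul]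

theorem act2_tmul (u a b : UEnv K R L) :
    act2 u (a ⊗ₜ[R] b) = RBialgebra.rmul R a b (comul u) := by
  rw [comul_apply, ← act2_rmul]; simp

theorem comul_mem (u : UEnv K R L) : comul u ∈ RBialgebra.takeuchi R (UEnv K R L) := by
  intro r
  rw [← act2_tmul, ← act2_tmul, TensorProduct.smul_tmul]

theorem comul_mul (u v : UEnv K R L) :
    comul (u * v) = RBialgebra.takeuchiMul R ⟨comul u, comul_mem u⟩ (comul v) := by
  rw [comul_apply, map_mul, Module.End.mul_apply, ← comul_apply]
  generalize comul v = t
  induction t using TensorProduct.induction_on with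
  | zero => simp
  | tmul a b => rw [act2_tmul, RBialgebra.takeuchiMul_tmul]
  | add s t hs ht => rw [map_add, map_add, hs, ht]

theorem comul_mul_sum {n m : ℕ} (u v : UEnv K R L) (a b : Fin n → UEnv K R L)
    (c d : Fin m → UEnv K R L) (hu : comul u = ∑ i, a i ⊗ₜ[R] b i)
    (hv : comul v = ∑ j, c j ⊗ₜ[R] d j) :
    comul (u * v) = ∑ k : Fin (n * m),
      (a (finProdFinEquiv.symm k).1 * c (finProdFinEquiv.symm k).2) ⊗ₜ[R]
        (b (finProdFinEquiv.symm k).1 * d (finProdFinEquiv.symm k).2) := by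
  rw [comul_mul, hv, map_sum, ← finProdFinEquiv.sum_comp, Fintype.sum_prod_type, Finset.sum_comm]
  refine Finset.sum_congr rfl fun l _ => ?_
  rw [RBialgebra.takeuchiMul_tmul]
  change RBialgebra.rmul R (c l) (d l) (comul u) = _
  rw [hu, map_sum]
  simp

theorem counit_left (t : UEnv K R L ⊗[R] UEnv K R L) (x : L) :
    TensorProduct.lid R _ (LinearMap.rTensor _ counit (op2 x t))
      = ofLie K R L x * TensorProduct.lid R _ (LinearMap.rTensor _ counit t) := by
  induction t using TensorProduct.induction_on with
  | zero => simp
  | tmul a b => simp [counit_ofLie_mul, ofLie_mul_smul]; abel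
  | add s t hs ht => simp only [map_add, hs, ht, mul_add]

theorem lid_rTensor_comul (u : UEnv K R L) :
    TensorProduct.lid R _ (LinearMap.rTensor _ counit (comul u)) = u := by
  induction u using UEnv.induction with
  | h1 => simp [comul_one, counit_one]
  | hadd u v hu hv => simp only [map_add, hu, hv]
  | hfun f u hu => simp only [map_smul, hu]
  | hlie x u hu => rw [comul_ofLie_mul, counit_left, hu]

theorem comm_comul (u : UEnv K R L) : TensorProduct.comm R _ _ (comul u) = comul u := by
  have h : ∀ (x : L) (t : UEnv K R L ⊗[R] UEnv K R L),
      TensorProduct.comm R _ _ (op2 x t) = op2 x (TensorProduct.comm R _ _ t) := by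
    intro x t
    induction t using TensorProduct.induction_on with
    | zero => simp
    | tmul a b => simp [add_comm]
    | add s t hs ht => simp only [map_add, hs, ht]
  induction u using UEnv.induction with
  | h1 => simp [comul_one]
  | hadd u v hu hv => simp only [map_add, hu, hv]
  | hfun f u hu => simp only [map_smul, hu]
  | hlie x u hu => rw [comul_ofLie_mul, h, hu]

theorem coassoc' (u : UEnv K R L) :
    TensorProduct.assoc R _ _ _ (LinearMap.rTensor _ comul (comul u))
      = LinearMap.lTensor _ comul (comul u) := by
  have h0 : ∀ (x : L) (t : UEnv K R L ⊗[R] UEnv K R L) (b : UEnv K R L),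
      TensorProduct.assoc R _ _ _ (op2 x t ⊗ₜ[R] b + t ⊗ₜ (ofLie K R L x * b))
        = op3 x (TensorProduct.assoc R _ _ _ (t ⊗ₜ[R] b)) := by
    intro x t b
    induction t using TensorProduct.induction_on with
    | zero => simp
    | tmul a c => simp [op3_tmul, TensorProduct.add_tmul, TensorProduct.tmul_add, add_assoc]
    | add s t hs ht =>
      simp only [map_add, TensorProduct.add_tmul] at hs ht ⊢
      rw [← hs, ← ht]; abel
  have h1 : ∀ (x : L) (t : UEnv K R L ⊗[R] UEnv K R L),
      TensorProduct.assoc R _ _ _ (LinearMap.rTensor _ comul (op2 x t))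
        = op3 x (TensorProduct.assoc R _ _ _ (LinearMap.rTensor _ comul t)) := by
    intro x t
    induction t using TensorProduct.induction_on with
    | zero => simp
    | tmul a b =>
      rw [op2_tmul, map_add, LinearMap.rTensor_tmul, LinearMap.rTensor_tmul, comul_ofLie_mul, h0,
        LinearMap.rTensor_tmul]
    | add s t hs ht => simp only [map_add, hs, ht]
  have h2 : ∀ (x : L) (t : UEnv K R L ⊗[R] UEnv K R L),
      LinearMap.lTensor _ comul (op2 x t) = op3 x (LinearMap.lTensor _ comul t) := by
    intro x t
    induction t using TensorProduct.induction_on with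
    | zero => simp
    | tmul a b => simp [op3_tmul, comul_ofLie_mul]
    | add s t hs ht => simp only [map_add, hs, ht]
  induction u using UEnv.induction with
  | h1 => simp [comul_one]
  | hadd u v hu hv => simp only [map_add, hu, hv]
  | hfun f u hu => simp only [map_smul, hu]
  | hlie x u hu => rw [comul_ofLie_mul, h1, hu, h2]

instance : Coalgebra R (UEnv K R L) where
  comul := comul
  counit := counit
  coassoc := LinearMap.ext coassoc'
  rTensor_counit_comp_comul := LinearMap.ext fun u => by
    apply (TensorProduct.lid R (UEnv K R L)).injective
    simpa using lid_rTensor_comul u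
  lTensor_counit_comp_comul := LinearMap.ext fun u => by
    apply (TensorProduct.comm R (UEnv K R L) R).injective
    apply (TensorProduct.lid R (UEnv K R L)).injective
    have h : ∀ t : UEnv K R L ⊗[R] UEnv K R L,
        TensorProduct.comm R _ _ (LinearMap.lTensor (UEnv K R L) counit t)
          = LinearMap.rTensor _ counit (TensorProduct.comm R _ _ t) := by
      intro t
      induction t using TensorProduct.induction_on with
      | zero => simp
      | tmul a b => simp
      | add s t hs ht => simp only [map_add, hs, ht]
    rw [LinearMap.comp_apply, h, comm_comul, lid_rTensor_comul]
    simp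

theorem comul_eq (u : UEnv K R L) : Coalgebra.comul (R := R) u = comul u := rfl
theorem counit_eq (u : UEnv K R L) : Coalgebra.counit (R := R) u = counit u := rfl

instance : Coalgebra.IsCocomm R (UEnv K R L) where
  comm_comp_comul := LinearMap.ext comm_comul

instance : RBialgebra.IsBialgebra R (UEnv K R L) where
  comul_mem := comul_mem
  counit_one := counit_one
  comul_one := comul_one
  counit_mul := counit_mul
  comul_mul := comul_mul

section Map

variable {L' : Type u} [LieRing L'] [Module R L'] [LieRingModule L' R] [LieRinehartRing R L']
  [LieAlgebra K L'] [LieRinehartAlgebra K R L']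

/-- The algebra homomorphism `𝒰(R, L) → 𝒰(R, L')` induced by a Lie-Rinehart homomorphism. -/
def mapAlg (φ : LieRinehartAlgebra.Hom (AlgHom.id K R) L L') : UEnv K R L →ₐ[K] UEnv K R L' :=
  lift K (ofFun K R L') ((ofLie K R L').comp (φ.toLieHom : L →+ L'))
    (fun f x => by
      have := φ.map_smul_apply f x
      simp only [AlgHom.id_apply] at this
      change ofLie K R L' (φ.toLieHom (f • x)) = _
      rw [this, ofLie_smul]; rfl)
    (fun x y => by
      change ofLie K R L' (φ.toLieHom ⁅x, y⁆) = _
      rw [LieHom.map_lie, ofLie_lie]; rfl)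
    (fun x f => by
      have := φ.apply_lie f x
      simp only [AlgHom.id_apply] at this
      rw [this]
      exact ofLie_mul_ofFun K _ f)

theorem mapAlg_ofFun (φ : LieRinehartAlgebra.Hom (AlgHom.id K R) L L') (f : R) :
    mapAlg φ (ofFun K R L f) = ofFun K R L' f := by simp [mapAlg]

theorem mapAlg_ofLie (φ : LieRinehartAlgebra.Hom (AlgHom.id K R) L L') (x : L) :
    mapAlg φ (ofLie K R L x) = ofLie K R L' (φ x) := by simp [mapAlg]

theorem mapAlg_smul (φ : LieRinehartAlgebra.Hom (AlgHom.id K R) L L') (f : R) (u : UEnv K R L) :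
    mapAlg φ (f • u) = f • mapAlg φ u := by
  rw [smul_def, map_mul, mapAlg_ofFun, smul_def]

/-- `mapAlg` as a homomorphism of coalgebras. -/
def map (φ : LieRinehartAlgebra.Hom (AlgHom.id K R) L L') : UEnv K R L →ₗc[R] UEnv K R L' where
  toFun := mapAlg φ
  map_add' := map_add _
  map_smul' := mapAlg_smul φ
  counit_comp := LinearMap.ext fun u => by
    change counit (mapAlg φ u) = counit u
    induction u using UEnv.induction with
    | h1 => simp [counit_one]
    | hadd u v hu hv => simp only [map_add, hu, hv]
    | hfun f u hu => rw [mapAlg_smul, map_smul, hu, map_smul]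
    | hlie x u hu =>
      have := φ.apply_lie (counit u) x
      simp only [AlgHom.id_apply] at this
      rw [map_mul, mapAlg_ofLie, counit_ofLie_mul, hu, counit_ofLie_mul, this]
  map_comp_comul := LinearMap.ext fun u => by
    let F : UEnv K R L →ₗ[R] UEnv K R L' :=
      { toFun := mapAlg φ, map_add' := map_add _, map_smul' := mapAlg_smul φ }
    change TensorProduct.map F F (comul u) = comul (mapAlg φ u)
    have h : ∀ (x : L) (t : UEnv K R L ⊗[R] UEnv K R L),
        TensorProduct.map F F (op2 x t) = op2 (φ x) (TensorProduct.map F F t) := by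
      intro x t
      induction t using TensorProduct.induction_on with
      | zero => simp
      | tmul a b => simp [F, mapAlg_ofLie]
      | add s t hs ht => simp only [map_add, hs, ht]
    induction u using UEnv.induction with
    | h1 => simp [comul_one, F]
    | hadd u v hu hv => simp only [map_add, hu, hv]
    | hfun f u hu => rw [mapAlg_smul, map_smul, map_smul, hu, map_smul]
    | hlie x u hu => rw [comul_ofLie_mul, h, hu, map_mul, mapAlg_ofLie, comul_ofLie_mul]

theorem map_apply (φ : LieRinehartAlgebra.Hom (AlgHom.id K R) L L') (u : UEnv K R L) :
    map φ u = mapAlg φ u := rfl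

end Map

end Coalgebra

end UEnv

/-! ### Sheaves

A sheaf on `X` with stalks `T x` is given by its étalé space: the family of stalks together with
the local predicate that singles out the sections over an open `U` among the families
`(s y)_{y ∈ U}`, `s y ∈ T y`. -/

open CategoryTheory TopologicalSpace Opposite TopCat Topology

/-- The families singled out by `P` form a sheaf whose stalk at `x` is `T x`: every element of `T x`
is the germ of a section, and sections with the same germ at `x` agree near `x`. -/
structure IsEtale {X : TopCat.{u}} {T : X → Type u} (P : LocalPredicate T) : Prop where
  exists_sec : ∀ (x : X) (t : T x), ∃ (U : Opens X) (hx : x ∈ U) (s : ∀ y : U, T y),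
    P.pred s ∧ s ⟨x, hx⟩ = t
  eq_nhds : ∀ (x : X) (U : Opens X) (hx : x ∈ U) (s t : ∀ y : U, T y), P.pred s → P.pred t →
    s ⟨x, hx⟩ = t ⟨x, hx⟩ → ∀ᶠ y in 𝓝 x, ∀ hy : y ∈ U, s ⟨y, hy⟩ = t ⟨y, hy⟩

/-- `T x` is indeed the stalk at `x` of the sheaf of sections. -/
theorem IsEtale.stalkToFiber_bijective {X : TopCat.{u}} {T : X → Type u} {P : LocalPredicate T}
    (h : IsEtale P) (x : X) : Function.Bijective (stalkToFiber P x) := by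
  refine ⟨stalkToFiber_injective P x ?_, stalkToFiber_surjective P x ?_⟩
  · intro U V s hs t ht hst
    have hev := h.eq_nhds x (U.1 ⊓ V.1) ⟨U.2, V.2⟩ _ _ (P.res (Opens.infLELeft U.1 V.1) s hs)
      (P.res (Opens.infLERight U.1 V.1) t ht) hst
    obtain ⟨W, hW, hWo, hxW⟩ := _root_.eventually_nhds_iff.1 hev
    refine ⟨⟨⟨W, hWo⟩ ⊓ (U.1 ⊓ V.1), ⟨hxW, U.2, V.2⟩⟩, homOfLE fun y hy => hy.2.1,
      homOfLE fun y hy => hy.2.2, fun w => hW w.1 w.2.1 w.2.2⟩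
  · intro t
    obtain ⟨U, hx, s, hs, e⟩ := h.exists_sec x t
    exact ⟨⟨U, hx⟩, s, hs, e⟩

section Rep

variable {X : TopCat.{u}} {T T' T'' : X → Type u}

/-- `g` represents the germ `a` at `x`: near `x`, it is a section with value `a` at `x`. -/
def IsRep (P : LocalPredicate T) (x : X) (a : T x) (g : ∀ y : X, T y) : Prop :=
  ∃ (U : Opens X) (hx : x ∈ U) (s : ∀ y : U, T y), P.pred s ∧ s ⟨x, hx⟩ = a ∧
    ∀ y (hy : y ∈ U), g y = s ⟨y, hy⟩

theorem IsRep.eventually_eq {P : LocalPredicate T} (h : IsEtale P) {x : X} {a : T x}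
    {g g' : ∀ y : X, T y} (hg : IsRep P x a g) (hg' : IsRep P x a g') :
    ∀ᶠ y in 𝓝 x, g y = g' y := by
  obtain ⟨U, hU, s, hs, es, gs⟩ := hg
  obtain ⟨V, hV, t, ht, et, gt⟩ := hg'
  have hev := h.eq_nhds x (U ⊓ V) ⟨hU, hV⟩ _ _ (P.res (Opens.infLELeft U V) s hs)
    (P.res (Opens.infLERight U V) t ht) (es.trans et.symm)
  filter_upwards [hev, U.isOpen.mem_nhds hU, V.isOpen.mem_nhds hV] with y h1 h2 h3
  rw [gs y h2, gt y h3]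
  exact h1 ⟨h2, h3⟩

theorem IsRep.op₂ {P : LocalPredicate T} {P' : LocalPredicate T'} {P'' : LocalPredicate T''}
    (op : ∀ {y : X}, T y → T' y → T'' y)
    (hop : ∀ {U : Opens X} (s : ∀ y : U, T y) (t : ∀ y : U, T' y), P.pred s → P'.pred t →
      P''.pred fun y : U => op (s y) (t y))
    {x : X} {a : T x} {b : T' x} {g : ∀ y : X, T y} {g' : ∀ y : X, T' y}
    (hg : IsRep P x a g) (hg' : IsRep P' x b g') :
    IsRep P'' x (op a b) (fun y => op (g y) (g' y)) := by
  obtain ⟨U, hU, s, hs, es, gs⟩ := hg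
  obtain ⟨V, hV, t, ht, et, gt⟩ := hg'
  refine ⟨U ⊓ V, ⟨hU, hV⟩, _, hop _ _ (P.res (Opens.infLELeft U V) s hs)
    (P'.res (Opens.infLERight U V) t ht), ?_, ?_⟩
  · rw [← es, ← et]; rfl
  · intro y hy
    change op (g y) (g' y) = op (s ⟨y, hy.1⟩) (t ⟨y, hy.2⟩)
    rw [gs y hy.1, gt y hy.2]

/-- Extension of a family by zero. -/
def extZero [∀ y, Zero (T y)] (U : Opens X) (s : ∀ y : U, T y) (y : X) : T y :=
  open Classical in if h : y ∈ U then s ⟨y, h⟩ else 0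

theorem extZero_apply [∀ y, Zero (T y)] {U : Opens X} (s : ∀ y : U, T y) {y : X} (hy : y ∈ U) :
    extZero U s y = s ⟨y, hy⟩ := by simp [extZero, hy]

theorem isRep_extZero [∀ y, Zero (T y)] {P : LocalPredicate T} {U : Opens X} {s : ∀ y : U, T y}
    (hs : P.pred s) {x : X} (hx : x ∈ U) : IsRep P x (s ⟨x, hx⟩) (extZero U s) :=
  ⟨U, hx, s, hs, rfl, fun _ hy => extZero_apply s hy⟩

theorem IsEtale.exists_rep [∀ y, Zero (T y)] {P : LocalPredicate T} (h : IsEtale P) {x : X}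
    (a : T x) : ∃ g, IsRep P x a g := by
  obtain ⟨U, hx, s, hs, rfl⟩ := h.exists_sec x a
  exact ⟨_, isRep_extZero hs hx⟩

/-- A chosen representative of a germ. -/
def IsEtale.rep [∀ y, Zero (T y)] {P : LocalPredicate T} (h : IsEtale P) {x : X} (a : T x) :
    ∀ y : X, T y := (h.exists_rep a).choose

theorem IsEtale.isRep_rep [∀ y, Zero (T y)] {P : LocalPredicate T} (h : IsEtale P) {x : X}
    (a : T x) : IsRep P x a (h.rep a) := (h.exists_rep a).choose_spec

end Rep

/-- A topological space with a sheaf of commutative `K`-algebras, i.e. a sheaf of commutative rings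
`O` with a homomorphism from `K` to the ring of global sections. -/
structure KSpace (K : Type u) [Field K] where
  /-- the space -/
  X : TopCat.{u}
  /-- the structure sheaf -/
  O : TopCat.Sheaf CommRingCat.{u} X
  /-- the `K`-algebra structure -/
  ofK : K →+* O.presheaf.obj (op ⊤)

namespace KSpace

variable {K : Type u} [Field K] (S : KSpace K)

/-- The stalk `O_x`. -/
def stalk (x : S.X) : Type u := S.O.presheaf.stalk x

instance (x : S.X) : CommRing (S.stalk x) :=
  inferInstanceAs (CommRing (S.O.presheaf.stalk x))

/-- The germ at `x` of a section of the structure sheaf. -/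
def germ (U : Opens S.X) (x : S.X) (hx : x ∈ U) : S.O.presheaf.obj (op U) →+* S.stalk x :=
  (S.O.presheaf.germ U x hx).hom

theorem germ_res {U V : Opens S.X} (i : U ⟶ V) (x : S.X) (hx : x ∈ U)
    (f : S.O.presheaf.obj (op V)) :
    S.germ U x hx (S.O.presheaf.map i.op f) = S.germ V x (i.le hx) f :=
  TopCat.Presheaf.germ_res_apply S.O.presheaf i x hx f

instance (x : S.X) : Algebra K (S.stalk x) := ((S.germ ⊤ x trivial).comp S.ofK).toAlgebra

/-- The families `(f y)_{y ∈ U}`, `f y ∈ O_y`, that are families of germs of a section of `O`. -/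
def regularPre : PrelocalPredicate S.stalk where
  pred {U} f := ∃ g : S.O.presheaf.obj (op U), ∀ y : U, S.germ U y.1 y.2 g = f y
  res := by
    rintro U V i f ⟨g, hg⟩
    exact ⟨S.O.presheaf.map i.op g, fun y => (S.germ_res i y.1 y.2 g).trans (hg (i y))⟩

/-- The structure sheaf, in étalé form. -/
def regular : LocalPredicate S.stalk := S.regularPre.sheafify

theorem regular_germ {U : Opens S.X} (g : S.O.presheaf.obj (op U)) :
    S.regular.pred fun y : U => S.germ U y.1 y.2 g :=
  PrelocalPredicate.sheafifyOf ⟨g, fun _ => rfl⟩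

theorem regular_isEtale : IsEtale S.regular where
  exists_sec x t := by
    obtain ⟨U, hx, g, e⟩ := TopCat.Presheaf.exists_germ_eq S.O.presheaf t
    exact ⟨U, hx, _, S.regular_germ g, e⟩
  eq_nhds x U hx s t hs ht hst := by
    obtain ⟨V, hV, i, f, hf⟩ := hs ⟨x, hx⟩
    obtain ⟨W, hW, j, g, hg⟩ := ht ⟨x, hx⟩
    have e : S.germ V x hV f = S.germ W x hW g := by
      rw [hf ⟨x, hV⟩, hg ⟨x, hW⟩]; exact hst
    obtain ⟨Z, hZ, k, l, hkl⟩ := TopCat.Presheaf.germ_eq S.O.presheaf x hV hW f g e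
    filter_upwards [Z.isOpen.mem_nhds hZ] with y hyZ hyU
    have h1 := hf ⟨y, k.le hyZ⟩
    have h2 := hg ⟨y, l.le hyZ⟩
    rw [← S.germ_res k y hyZ] at h1
    rw [← S.germ_res l y hyZ] at h2
    exact h1.symm.trans ((congrArg (S.germ Z y hyZ) hkl).trans h2)

theorem regular_add {U : Opens S.X} (f g : ∀ y : U, S.stalk y) (hf : S.regular.pred f)
    (hg : S.regular.pred g) : S.regular.pred fun y => f y + g y := by
  refine PrelocalPredicate.sheafify_inductionOn₂' S.regularPre S.regularPre S.regularPre
    (fun {_} a b => a + b) ?_ hf hg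
  rintro U V a b ⟨a', ha⟩ ⟨b', hb⟩
  refine ⟨S.O.presheaf.map (Opens.infLELeft U V).op a' + S.O.presheaf.map (Opens.infLERight U V).op b',
    fun y => ?_⟩
  rw [map_add, S.germ_res, S.germ_res]
  exact congrArg₂ (· + ·) (ha ⟨y, y.2.1⟩) (hb ⟨y, y.2.2⟩)

theorem regular_mul {U : Opens S.X} (f g : ∀ y : U, S.stalk y) (hf : S.regular.pred f)
    (hg : S.regular.pred g) : S.regular.pred fun y => f y * g y := by
  refine PrelocalPredicate.sheafify_inductionOn₂' S.regularPre S.regularPre S.regularPre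
    (fun {_} a b => a * b) ?_ hf hg
  rintro U V a b ⟨a', ha⟩ ⟨b', hb⟩
  refine ⟨S.O.presheaf.map (Opens.infLELeft U V).op a' * S.O.presheaf.map (Opens.infLERight U V).op b',
    fun y => ?_⟩
  rw [map_mul, S.germ_res, S.germ_res]
  exact congrArg₂ (· * ·) (ha ⟨y, y.2.1⟩) (hb ⟨y, y.2.2⟩)

theorem regular_const (U : Opens S.X) (k : K) :
    S.regular.pred fun y : U => algebraMap K (S.stalk y) k :=
  PrelocalPredicate.sheafifyOf ⟨S.O.presheaf.map (homOfLE le_top : U ⟶ ⊤).op (S.ofK k),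
    fun _ => S.germ_res _ _ _ _⟩

end KSpace

section ModuleSheaf

variable {K : Type u} [Field K] (S : KSpace K) {M N : S.X → Type u}
  [∀ x, AddCommGroup (M x)] [∀ x, Module (S.stalk x) (M x)]
  [∀ x, AddCommGroup (N x)] [∀ x, Module (S.stalk x) (N x)]

/-- The étalé sheaf `P` is a sheaf of `O`-modules: the operations on the stalks preserve sections. -/
structure IsModuleSheaf (P : LocalPredicate M) : Prop extends IsEtale P where
  zero : ∀ U : Opens S.X, P.pred fun y : U => (0 : M y)
  add : ∀ {U : Opens S.X} (s t : ∀ y : U, M y), P.pred s → P.pred t → P.pred fun y => s y + t y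
  smul : ∀ {U : Opens S.X} (f : ∀ y : U, S.stalk y) (s : ∀ y : U, M y), S.regular.pred f →
    P.pred s → P.pred fun y => f y • s y

/-- The families in `∏ M_y ⊗ N_y` induced by elements of `M(U) ⊗ N(U)`. -/
def tensorPre (P : LocalPredicate M) (Q : LocalPredicate N) :
    PrelocalPredicate fun x : S.X => M x ⊗[S.stalk x] N x where
  pred {U} t := ∃ (n : ℕ) (a : Fin n → ∀ y : U, M y) (b : Fin n → ∀ y : U, N y),
    (∀ i, P.pred (a i)) ∧ (∀ i, Q.pred (b i)) ∧
      ∀ y : U, t y = ∑ i, a i y ⊗ₜ[S.stalk y] b i y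
  res := by
    rintro U V i t ⟨n, a, b, ha, hb, e⟩
    exact ⟨n, fun j y => a j (i y), fun j y => b j (i y), fun j => P.res i _ (ha j),
      fun j => Q.res i _ (hb j), fun y => e (i y)⟩

/-- The tensor product sheaf `M ⊗_O N`, with stalks `M_x ⊗ N_x`: the sheaf associated with the
presheaf `U ↦ M(U) ⊗ N(U)`. -/
def tensorSec (P : LocalPredicate M) (Q : LocalPredicate N) :
    LocalPredicate fun x : S.X => M x ⊗[S.stalk x] N x := (tensorPre S P Q).sheafify

/-- Families of tensors modulo equality near `x`. -/
def nearZero (T : S.X → Type u) [∀ x, AddCommGroup (T x)] (x : S.X) : AddSubgroup (∀ y, T y) where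
  carrier := {t | ∀ᶠ y in 𝓝 x, t y = 0}
  add_mem' hs ht := by
    filter_upwards [hs, ht] with y h1 h2
    simp [h1, h2]
  zero_mem' := by simp
  neg_mem' hs := by
    filter_upwards [hs] with y h
    simp [h]

theorem nearZero_mk_eq {T : S.X → Type u} [∀ x, AddCommGroup (T x)] {x : S.X} {s t : ∀ y, T y} :
    (QuotientAddGroup.mk s : (∀ y, T y) ⧸ nearZero S T x) = QuotientAddGroup.mk t ↔
      ∀ᶠ y in 𝓝 x, s y = t y := by
  rw [QuotientAddGroup.eq_iff_sub_mem]
  exact Filter.eventually_congr (.of_forall fun y => sub_eq_zero)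

/-- Sections of the tensor product sheaf with the same germ at `x` agree near `x`. -/
theorem tensorSec_eq_nhds {P : LocalPredicate M} {Q : LocalPredicate N} (hP : IsModuleSheaf S P)
    (hQ : IsModuleSheaf S Q) (x : S.X) (U : Opens S.X) (hx : x ∈ U)
    (s t : ∀ y : U, M y ⊗[S.stalk y] N y) (hs : (tensorSec S P Q).pred s)
    (ht : (tensorSec S P Q).pred t) (hst : s ⟨x, hx⟩ = t ⟨x, hx⟩) :
    ∀ᶠ y in 𝓝 x, ∀ hy : y ∈ U, s ⟨y, hy⟩ = t ⟨y, hy⟩ := by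
  let T : S.X → Type u := fun x => M x ⊗[S.stalk x] N x
  let F : M x → N x → (∀ y, T y) ⧸ nearZero S T x := fun a b =>
    QuotientAddGroup.mk fun y => hP.rep a y ⊗ₜ hQ.rep b y
  have hF : ∀ {a b g h}, IsRep P x a g → IsRep Q x b h →
      F a b = QuotientAddGroup.mk fun y => g y ⊗ₜ h y := by
    intro a b g h hg hh
    refine (nearZero_mk_eq S).2 ?_
    filter_upwards [(hP.isRep_rep a).eventually_eq hP.toIsEtale hg,
      (hQ.isRep_rep b).eventually_eq hQ.toIsEtale hh] with y h1 h2
    rw [h1, h2]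
  have addP : ∀ a a', IsRep P x (a + a') (fun y => hP.rep a y + hP.rep a' y) := fun a a' =>
    IsRep.op₂ (fun {_} a b => a + b) hP.add (hP.isRep_rep a) (hP.isRep_rep a')
  have addQ : ∀ a a', IsRep Q x (a + a') (fun y => hQ.rep a y + hQ.rep a' y) := fun a a' =>
    IsRep.op₂ (fun {_} a b => a + b) hQ.add (hQ.isRep_rep a) (hQ.isRep_rep a')
  let Φ : T x →+ (∀ y, T y) ⧸ nearZero S T x := TensorProduct.liftAddHom
    (AddMonoidHom.mk' (fun a => AddMonoidHom.mk' (fun b => F a b) (fun b b' => by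
        rw [hF (hP.isRep_rep a) (addQ b b')]
        simp only [TensorProduct.tmul_add]; rfl))
      (fun a a' => by
        ext b
        change F (a + a') b = F a b + F a' b
        rw [hF (addP a a') (hQ.isRep_rep b)]
        simp only [TensorProduct.add_tmul]; rfl))
    (fun r a b => by
      change F (r • a) b = F a (r • b)
      have hr := S.regular_isEtale.isRep_rep r
      rw [hF (IsRep.op₂ (fun {_} a b => a • b) hP.smul hr (hP.isRep_rep a)) (hQ.isRep_rep b),
        hF (hP.isRep_rep a) (IsRep.op₂ (fun {_} a b => a • b) hQ.smul hr (hQ.isRep_rep b))]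
      simp only [TensorProduct.smul_tmul])
  have key : ∀ (V : Opens S.X) (hV : x ∈ V) (t : ∀ y : V, T y), (tensorPre S P Q).pred t →
      Φ (t ⟨x, hV⟩) = QuotientAddGroup.mk (extZero V t) := by
    rintro V hV t ⟨n, a, b, ha, hb, e⟩
    have h1 : Φ (t ⟨x, hV⟩) = ∑ i, F (a i ⟨x, hV⟩) (b i ⟨x, hV⟩) := by
      rw [e, map_sum]; rfl
    rw [h1, Finset.sum_congr rfl fun i _ =>
      hF (isRep_extZero (ha i) hV) (isRep_extZero (hb i) hV)]
    have h2 : ∀ i, (QuotientAddGroup.mk fun y => extZero V (a i) y ⊗ₜ extZero V (b i) y :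
        (∀ y, T y) ⧸ nearZero S T x) = QuotientAddGroup.mk' (nearZero S T x)
          fun y => extZero V (a i) y ⊗ₜ extZero V (b i) y := fun _ => rfl
    simp only [h2]
    rw [← map_sum]
    refine (nearZero_mk_eq S).2 ?_
    filter_upwards [V.isOpen.mem_nhds hV] with y hy
    rw [extZero_apply t hy, e, Finset.sum_apply]
    exact Finset.sum_congr rfl fun i _ => by rw [extZero_apply _ hy, extZero_apply _ hy]
  obtain ⟨V, hV, i, hs⟩ := hs ⟨x, hx⟩
  obtain ⟨W, hW, j, ht⟩ := ht ⟨x, hx⟩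
  have h1 := key V hV _ hs
  have h2 := key W hW _ ht
  have h3 := (nearZero_mk_eq S).1 (h1.symm.trans ((congrArg Φ hst).trans h2))
  filter_upwards [h3, V.isOpen.mem_nhds hV, W.isOpen.mem_nhds hW] with y e hyV hyW hyU
  rw [extZero_apply _ hyV, extZero_apply _ hyW] at e
  exact e

/-- The sheaf of `O`-modules with stalks `M x` and sections `sec` is locally free: near every point
there is a family of sections that is a basis of every stalk, i.e. that defines an isomorphism
`O|_U ^ (ι) ≅ M|_U`. -/
def IsLocallyFree (sec : ∀ {U : Opens S.X}, (∀ y : U, M y) → Prop) : Prop :=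
  ∀ x : S.X, ∃ (U : Opens S.X) (_ : x ∈ U) (ι : Type u) (e : ι → ∀ y : U, M y),
    (∀ i, sec (e i)) ∧ ∀ y : U, LinearIndependent (S.stalk y) (fun i => e i y) ∧
      Submodule.span (S.stalk y) (Set.range fun i => e i y) = ⊤

/-- Locally free of finite rank: the local bases are finite. -/
def IsLocallyFreeOfFiniteRank (sec : ∀ {U : Opens S.X}, (∀ y : U, M y) → Prop) : Prop :=
  ∀ x : S.X, ∃ (U : Opens S.X) (_ : x ∈ U) (n : ℕ) (e : Fin n → ∀ y : U, M y),
    (∀ i, sec (e i)) ∧ ∀ y : U, LinearIndependent (S.stalk y) (fun i => e i y) ∧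
      Submodule.span (S.stalk y) (Set.range fun i => e i y) = ⊤

end ModuleSheaf

/-! ### Lie algebroids -/

/-- A Lie algebroid over `(X, O)`: a sheaf of `(K, O)`-Lie-Rinehart algebras.  The bracket
`⁅D, f⁆` of an element of `L_x` with an element of `O_x` is the anchor. -/
structure LieAlgebroid {K : Type u} [Field K] (S : KSpace K) where
  /-- the stalks -/
  stalk : S.X → Type u
  [lieRing : ∀ x, LieRing (stalk x)]
  [lieAlgebra : ∀ x, LieAlgebra K (stalk x)]
  [module : ∀ x, Module (S.stalk x) (stalk x)]
  [lieRingModule : ∀ x, LieRingModule (stalk x) (S.stalk x)]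
  [lieRinehartRing : ∀ x, LieRinehartRing (S.stalk x) (stalk x)]
  [lieRinehartAlgebra : ∀ x, LieRinehartAlgebra K (S.stalk x) (stalk x)]
  /-- the sections -/
  sec : LocalPredicate stalk
  isModuleSheaf : IsModuleSheaf S sec
  sec_lie : ∀ {U : Opens S.X} (s t : ∀ y : U, stalk y), sec.pred s → sec.pred t →
    sec.pred fun y => ⁅s y, t y⁆
  sec_anchor : ∀ {U : Opens S.X} (s : ∀ y : U, stalk y) (f : ∀ y : U, S.stalk y), sec.pred s →
    S.regular.pred f → S.regular.pred fun y => ⁅s y, f y⁆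

namespace LieAlgebroid

variable {K : Type u} [Field K] {S : KSpace K}

attribute [instance] lieRing lieAlgebra module lieRingModule lieRinehartRing lieRinehartAlgebra

/-- A morphism of Lie algebroids: a morphism of sheaves that is a homomorphism of Lie-Rinehart
algebras. -/
structure Hom (L L' : LieAlgebroid S) where
  /-- the maps on stalks -/
  toFun : ∀ x, LieRinehartAlgebra.Hom (AlgHom.id K (S.stalk x)) (L.stalk x) (L'.stalk x)
  map_sec : ∀ {U : Opens S.X} (s : ∀ y : U, L.stalk y), L.sec.pred s →
    L'.sec.pred fun y : U => toFun y (s y)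

theorem Hom.ext' {L L' : LieAlgebroid S} {φ ψ : Hom L L'}
    (h : ∀ x (a : L.stalk x), φ.toFun x a = ψ.toFun x a) : φ = ψ := by
  obtain ⟨φ, _⟩ := φ
  obtain ⟨ψ, _⟩ := ψ
  have : φ = ψ := by
    funext x
    have h1 : (φ x).toLieHom = (ψ x).toLieHom := LieHom.ext fun a => h x a
    rcases hφ : φ x with ⟨a, _, _⟩
    rcases hψ : ψ x with ⟨b, _, _⟩
    rw [hφ, hψ] at h1
    subst h1
    rfl
  subst this
  rfl

instance : Category (LieAlgebroid S) where
  Hom := Hom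
  id _ := ⟨fun _ => LieRinehartAlgebra.Hom.id, fun _ hs => hs⟩
  comp φ ψ := ⟨fun x => (φ.toFun x).comp (ψ.toFun x), fun _ hs => ψ.map_sec _ (φ.map_sec _ hs)⟩
  id_comp _ := Hom.ext' fun _ _ => rfl
  comp_id _ := Hom.ext' fun _ _ => rfl
  assoc _ _ _ := Hom.ext' fun _ _ => rfl

/-- The Lie algebroid is a locally free `O`-module of finite rank. -/
def locallyFreeOfFiniteRank (S : KSpace K) : ObjectProperty (LieAlgebroid S) :=
  fun L => IsLocallyFreeOfFiniteRank S (M := L.stalk) L.sec.pred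

end LieAlgebroid

/-! ### Bialgebras over `O/K` -/

/-- An `O/K`-bialgebra: a sheaf of unital `K`-algebras extending `O`, with morphisms of sheaves of
`O`-modules `Δ : A → A ⊗ A` and `ε : A → O` that make the stalks `O_x/K`-bialgebras. -/
structure BialgebraSheaf {K : Type u} [Field K] (S : KSpace K) where
  /-- the stalks -/
  stalk : S.X → Type u
  [ring : ∀ x, Ring (stalk x)]
  [algebra : ∀ x, Algebra K (stalk x)]
  [module : ∀ x, Module (S.stalk x) (stalk x)]
  [tower : ∀ x, IsScalarTower (S.stalk x) (stalk x) (stalk x)]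
  [tower' : ∀ x, IsScalarTower K (S.stalk x) (stalk x)]
  [coalgebra : ∀ x, Coalgebra (S.stalk x) (stalk x)]
  [isCocomm : ∀ x, Coalgebra.IsCocomm (S.stalk x) (stalk x)]
  [isBialgebra : ∀ x, RBialgebra.IsBialgebra (S.stalk x) (stalk x)]
  /-- the sections -/
  sec : LocalPredicate stalk
  isModuleSheaf : IsModuleSheaf S sec
  sec_one : ∀ U : Opens S.X, sec.pred fun y : U => (1 : stalk y)
  sec_mul : ∀ {U : Opens S.X} (s t : ∀ y : U, stalk y), sec.pred s → sec.pred t →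
    sec.pred fun y => s y * t y
  sec_counit : ∀ {U : Opens S.X} (s : ∀ y : U, stalk y), sec.pred s →
    S.regular.pred fun y => Coalgebra.counit (R := S.stalk y) (s y)
  sec_comul : ∀ {U : Opens S.X} (s : ∀ y : U, stalk y), sec.pred s →
    (tensorSec S sec sec).pred fun y => Coalgebra.comul (R := S.stalk y) (s y)

namespace BialgebraSheaf

variable {K : Type u} [Field K] {S : KSpace K}

attribute [instance] ring algebra module tower tower' coalgebra isCocomm isBialgebra

/-- A morphism of `O/K`-bialgebras: a morphism of sheaves that is a homomorphism of unital algebras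
and of coalgebras in left `O`-modules. -/
structure Hom (A B : BialgebraSheaf S) where
  /-- the maps on stalks -/
  toFun : ∀ x, A.stalk x →ₗc[S.stalk x] B.stalk x
  map_one : ∀ x, toFun x 1 = 1
  map_mul : ∀ x (a b : A.stalk x), toFun x (a * b) = toFun x a * toFun x b
  map_sec : ∀ {U : Opens S.X} (s : ∀ y : U, A.stalk y), A.sec.pred s →
    B.sec.pred fun y : U => toFun y (s y)

theorem Hom.ext' {A B : BialgebraSheaf S} {φ ψ : Hom A B}
    (h : ∀ x (a : A.stalk x), φ.toFun x a = ψ.toFun x a) : φ = ψ := by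
  obtain ⟨φ, _, _, _⟩ := φ
  obtain ⟨ψ, _, _, _⟩ := ψ
  have : φ = ψ := funext fun x => DFunLike.ext _ _ (h x)
  subst this
  rfl

instance : Category (BialgebraSheaf S) where
  Hom := Hom
  id _ := ⟨fun _ => CoalgHom.id _ _, fun _ => rfl, fun _ _ _ => rfl, fun _ hs => hs⟩
  comp φ ψ := ⟨fun x => (ψ.toFun x).comp (φ.toFun x),
    fun x => (congrArg (ψ.toFun x) (φ.map_one x)).trans (ψ.map_one x),
    fun x a b => (congrArg (ψ.toFun x) (φ.map_mul x a b)).trans (ψ.map_mul x _ _),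
    fun _ hs => ψ.map_sec _ (φ.map_sec _ hs)⟩
  id_comp _ := Hom.ext' fun _ _ => rfl
  comp_id _ := Hom.ext' fun _ _ => rfl
  assoc _ _ _ := Hom.ext' fun _ _ => rfl

variable (A : BialgebraSheaf S)

/-- The stalk at `x` of the sheaf `Āₙ` of the primitive filtration. -/
abbrev filt (n : ℕ) (x : S.X) : Submodule (S.stalk x) (A.stalk x) :=
  RBialgebra.primFilt (S.stalk x) (A.stalk x) n

/-- The stalks of the quotient sheaf `Āₙ₊₁ / Āₙ` (which is `Aₙ₊₁ / Aₙ` for `Aₙ = O ⊕ Āₙ`). -/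
abbrev gr (n : ℕ) (x : S.X) : Type u :=
  A.filt (n + 1) x ⧸ (A.filt n x).submoduleOf (A.filt (n + 1) x)

/-- The sections of the quotient sheaf `Āₙ₊₁ / Āₙ`: the families locally induced by sections
of `Āₙ₊₁`. -/
def grSec (n : ℕ) {U : Opens S.X} (q : ∀ y : U, A.gr n y) : Prop :=
  ∀ x : U, ∃ (V : Opens S.X) (_ : x.1 ∈ V) (i : V ⟶ U) (s : ∀ y : V, A.filt (n + 1) y),
    A.sec.pred (fun y : V => (s y : A.stalk y)) ∧ ∀ y : V, q (i y) = Submodule.Quotient.mk (s y)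

/-- `A` is cocomplete: it is the union of the subsheaves `Aₙ = O ⊕ Āₙ`. -/
def IsCocomplete : Prop :=
  ∀ (x : S.X) (a : A.stalk x), ∃ n : ℕ,
    a ∈ Submodule.span (S.stalk x) {(1 : A.stalk x)} ⊔ A.filt n x

/-- `A` is locally graded free: all the `O`-modules `Aₙ₊₁ / Aₙ` are locally free. -/
def IsLocallyGradedFree : Prop :=
  ∀ n : ℕ, IsLocallyFree S (M := A.gr n) (A.grSec n)

end BialgebraSheaf

/-! ### The Lie algebroid of primitive elements -/

namespace BialgebraSheaf

open RBialgebra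

variable {K : Type u} [Field K] {S : KSpace K} (A : BialgebraSheaf S)

/-- The sections of the sheaf of primitive elements: the primitive sections of `A`. -/
def primSec : LocalPredicate fun x : S.X => Prim (S.stalk x) (A.stalk x) where
  pred {U} s := A.sec.pred fun y : U => Prim.val (s y)
  res i _ hs := A.sec.res i _ hs
  locality _ hs := A.sec.locality _ hs

theorem sec_neg {U : Opens S.X} (s : ∀ y : U, A.stalk y) (hs : A.sec.pred s) :
    A.sec.pred fun y => -s y := by
  have h := A.isModuleSheaf.smul _ s (S.regular_const U (-1)) hs
  simpa using h

theorem primSec_isModuleSheaf : IsModuleSheaf S A.primSec where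
  exists_sec x t := by
    obtain ⟨U, hx, s, hs, e⟩ := A.isModuleSheaf.exists_sec x (Prim.val t)
    have ht := mem_primFilt_one.1 t.val_mem
    rw [← e] at ht
    have h0 := S.regular_isEtale.eq_nhds x U hx _ _ (A.sec_counit s hs) (S.regular_const U 0)
      (by simpa using ht.1)
    have h1 : (tensorSec S A.sec A.sec).pred
        fun y : U => s y ⊗ₜ[S.stalk y] (1 : A.stalk y) + (1 : A.stalk y) ⊗ₜ[S.stalk y] s y :=
      PrelocalPredicate.sheafifyOf ⟨2, ![s, fun y => 1], ![fun y => 1, s],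
        fun i => by fin_cases i; exacts [hs, A.sec_one U],
        fun i => by fin_cases i; exacts [A.sec_one U, hs],
        fun y => by simp [Fin.sum_univ_two]⟩
    have h2 := tensorSec_eq_nhds S A.isModuleSheaf A.isModuleSheaf x U hx _ _ (A.sec_comul s hs) h1
      ht.2
    obtain ⟨W, hW, hWo, hxW⟩ := _root_.eventually_nhds_iff.1 (h0.and h2)
    let V : Opens S.X := U ⊓ ⟨W, hWo⟩
    refine ⟨V, ⟨hx, hxW⟩, fun y => ⟨s ⟨y.1, y.2.1⟩, mem_primFilt_one.2
      ⟨by simpa using (hW y.1 y.2.2).1 y.2.1, (hW y.1 y.2.2).2 y.2.1⟩⟩, ?_, ?_⟩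
    · exact A.sec.res (Opens.infLELeft U ⟨W, hWo⟩) s hs
    · exact Prim.ext e
  eq_nhds x U hx s t hs ht hst := by
    filter_upwards [A.isModuleSheaf.eq_nhds x U hx _ _ hs ht (congrArg Prim.val hst)] with y h hy
    exact Prim.ext (h hy)
  zero U := A.isModuleSheaf.zero U
  add s t hs ht := A.isModuleSheaf.add _ _ hs ht
  smul f s hf hs := A.isModuleSheaf.smul f _ hf hs

/-- The Lie algebroid `𝒫(A)` of primitive elements, with the commutator bracket and the anchor
`⁅D, f⁆ = ε(D f)`. -/
def prim : LieAlgebroid S where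
  stalk x := Prim (S.stalk x) (A.stalk x)
  sec := A.primSec
  isModuleSheaf := A.primSec_isModuleSheaf
  sec_lie s t hs ht := by
    have h := A.isModuleSheaf.add _ _ (A.sec_mul _ _ hs ht)
      (A.sec_neg _ (A.sec_mul _ _ ht hs))
    simp only [← sub_eq_add_neg] at h
    exact h
  sec_anchor s f hs hf :=
    A.sec_counit _ (A.sec_mul _ _ hs (A.isModuleSheaf.smul f _ hf (A.sec_one _)))

/-- `A` is of finite type: `𝒫(A)` is a locally free `O`-module of finite rank. -/
def IsOfFiniteType : Prop := IsLocallyFreeOfFiniteRank S (M := A.prim.stalk) A.prim.sec.pred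

/-- The cocomplete, locally graded free `O/K`-bialgebras of finite type. -/
def cocompleteLocallyGradedFreeOfFiniteType (S : KSpace K) : ObjectProperty (BialgebraSheaf S) :=
  fun A => A.IsCocomplete ∧ A.IsLocallyGradedFree ∧ A.IsOfFiniteType

variable {A} {B : BialgebraSheaf S}

theorem Hom.map_mem (φ : Hom A B) (x : S.X) {a : A.stalk x}
    (ha : a ∈ primFilt (S.stalk x) (A.stalk x) 1) :
    φ.toFun x a ∈ primFilt (S.stalk x) (B.stalk x) 1 := by
  obtain ⟨h0, h1⟩ := mem_primFilt_one.1 ha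
  refine mem_primFilt_one.2 ⟨?_, ?_⟩
  · rw [CoalgHomClass.counit_comp_apply, h0]
  · rw [← CoalgHomClass.map_comp_comul_apply, h1]
    simp [φ.map_one]

/-- The restriction of a morphism of bialgebras to primitive elements. -/
def Hom.prim (φ : Hom A B) : LieAlgebroid.Hom A.prim B.prim where
  toFun x :=
    { toFun := fun a => ⟨φ.toFun x (Prim.val a), φ.map_mem x a.val_mem⟩
      map_add' := fun a b => Prim.ext (map_add (φ.toFun x) _ _)
      map_smul' := fun k a => Prim.ext (by
        change φ.toFun x (k • Prim.val a) = k • φ.toFun x (Prim.val a)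
        rw [← algebraMap_smul (S.stalk x) k, map_smul, algebraMap_smul])
      map_lie' := fun {a b} => Prim.ext (by
        change φ.toFun x (_ * _ - _ * _) = _ * _ - _ * _
        rw [map_sub, φ.map_mul, φ.map_mul]; rfl)
      map_smul_apply' := fun f a => Prim.ext (map_smul (φ.toFun x) f _)
      apply_lie' := fun f a => by
        change Coalgebra.counit (R := S.stalk x) (Prim.val a * (f • (1 : A.stalk x)))
          = Coalgebra.counit (R := S.stalk x) (φ.toFun x (Prim.val a) * (f • (1 : B.stalk x)))
        rw [← φ.map_one, ← map_smul, ← φ.map_mul, CoalgHomClass.counit_comp_apply] }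
  map_sec s hs := φ.map_sec _ hs

end BialgebraSheaf

/-- The functor `𝒫` from `O/K`-bialgebras to Lie algebroids. -/
def primFunctor {K : Type u} [Field K] (S : KSpace K) : BialgebraSheaf S ⥤ LieAlgebroid S where
  obj A := A.prim
  map φ := BialgebraSheaf.Hom.prim φ
  map_id _ := LieAlgebroid.Hom.ext' fun _ _ => rfl
  map_comp _ _ := LieAlgebroid.Hom.ext' fun _ _ => rfl

/-! ### The universal enveloping algebroid -/

namespace LieAlgebroid

variable {K : Type u} [Field K] {S : KSpace K} (L : LieAlgebroid S)

/-- The stalk `𝒰(O_x, L_x)` of the universal enveloping algebroid. -/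
abbrev envStalk (x : S.X) : Type u := UEnv K (S.stalk x) (L.stalk x)

/-- The image in `∏ 𝒰(O_y, L_y)` of the generators of `𝒰(O(U), L(U))`. -/
def envGen (U : Opens S.X) : Set (∀ y : U, L.envStalk y) :=
  {t | ∃ f : ∀ y : U, S.stalk y, S.regular.pred f ∧
      t = fun y : U => UEnv.ofFun K (S.stalk y) (L.stalk y) (f y)} ∪
  {t | ∃ s : ∀ y : U, L.stalk y, L.sec.pred s ∧
      t = fun y : U => UEnv.ofLie K (S.stalk y) (L.stalk y) (s y)}

/-- The image of `𝒰(O(U), L(U))` in `∏ 𝒰(O_y, L_y)`: the subalgebra generated by `O(U)` and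
`L(U)`. -/
def envAlg (U : Opens S.X) : Subalgebra K (∀ y : U, L.envStalk y) := Algebra.adjoin K (L.envGen U)

theorem envAlg_res {U V : Opens S.X} (i : U ⟶ V) (t : ∀ y : V, L.envStalk y) (ht : t ∈ L.envAlg V) :
    (fun y : U => t (i y)) ∈ L.envAlg U := by
  induction ht using Algebra.adjoin_induction with
  | mem t ht =>
    refine Algebra.subset_adjoin ?_
    rcases ht with ⟨f, hf, rfl⟩ | ⟨s, hs, rfl⟩
    · exact Or.inl ⟨_, S.regular.res i f hf, rfl⟩
    · exact Or.inr ⟨_, L.sec.res i s hs, rfl⟩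
  | algebraMap k => exact Subalgebra.algebraMap_mem _ k
  | add s t _ _ hs ht => exact Subalgebra.add_mem _ hs ht
  | mul s t _ _ hs ht => exact Subalgebra.mul_mem _ hs ht

/-- The presheaf `U ↦ 𝒰(O(U), L(U))`, through its families of germs. -/
def envPre : PrelocalPredicate L.envStalk where
  pred {U} t := t ∈ L.envAlg U
  res i t ht := L.envAlg_res i t ht

/-- The sheaf associated with the presheaf `U ↦ 𝒰(O(U), L(U))`. -/
def envSec : LocalPredicate L.envStalk := L.envPre.sheafify

theorem envSec_ofFun {U : Opens S.X} (f : ∀ y : U, S.stalk y) (hf : S.regular.pred f) :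
    L.envSec.pred fun y : U => UEnv.ofFun K (S.stalk y) (L.stalk y) (f y) :=
  PrelocalPredicate.sheafifyOf (P := L.envPre) (Algebra.subset_adjoin (Or.inl ⟨f, hf, rfl⟩))

theorem envSec_ofLie {U : Opens S.X} (s : ∀ y : U, L.stalk y) (hs : L.sec.pred s) :
    L.envSec.pred fun y : U => UEnv.ofLie K (S.stalk y) (L.stalk y) (s y) :=
  PrelocalPredicate.sheafifyOf (P := L.envPre) (Algebra.subset_adjoin (Or.inr ⟨s, hs, rfl⟩))

theorem envSec_add {U : Opens S.X} (s t : ∀ y : U, L.envStalk y) (hs : L.envSec.pred s)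
    (ht : L.envSec.pred t) : L.envSec.pred fun y => s y + t y := by
  refine PrelocalPredicate.sheafify_inductionOn₂' L.envPre L.envPre L.envPre
    (fun {_} a b => a + b) ?_ hs ht
  intro U V a b ha hb
  exact Subalgebra.add_mem _ (L.envAlg_res (Opens.infLELeft U V) a ha)
    (L.envAlg_res (Opens.infLERight U V) b hb)

theorem envSec_mul {U : Opens S.X} (s t : ∀ y : U, L.envStalk y) (hs : L.envSec.pred s)
    (ht : L.envSec.pred t) : L.envSec.pred fun y => s y * t y := by
  refine PrelocalPredicate.sheafify_inductionOn₂' L.envPre L.envPre L.envPre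
    (fun {_} a b => a * b) ?_ hs ht
  intro U V a b ha hb
  exact Subalgebra.mul_mem _ (L.envAlg_res (Opens.infLELeft U V) a ha)
    (L.envAlg_res (Opens.infLERight U V) b hb)

theorem envSec_const (U : Opens S.X) (k : K) :
    L.envSec.pred fun y : U => algebraMap K (L.envStalk y) k :=
  PrelocalPredicate.sheafifyOf (P := L.envPre) (Subalgebra.algebraMap_mem (L.envAlg U) k)

/-- Induction over the sections of the enveloping algebroid, for a property that is local. -/
theorem envSec_induction {p : ∀ {U : Opens S.X}, (∀ y : U, L.envStalk y) → Prop}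
    (hloc : ∀ {U : Opens S.X} (t : ∀ y : U, L.envStalk y),
      (∀ x : U, ∃ (V : Opens S.X) (_ : x.1 ∈ V) (i : V ⟶ U), p fun y : V => t (i y)) → p t)
    (hfun : ∀ {U : Opens S.X} (f : ∀ y : U, S.stalk y), S.regular.pred f →
      p fun y : U => UEnv.ofFun K (S.stalk y) (L.stalk y) (f y))
    (hlie : ∀ {U : Opens S.X} (s : ∀ y : U, L.stalk y), L.sec.pred s →
      p fun y : U => UEnv.ofLie K (S.stalk y) (L.stalk y) (s y))
    (hadd : ∀ {U : Opens S.X} (s t : ∀ y : U, L.envStalk y), p s → p t → p fun y => s y + t y)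
    (hmul : ∀ {U : Opens S.X} (s t : ∀ y : U, L.envStalk y), L.envSec.pred s → L.envSec.pred t →
      p s → p t → p fun y => s y * t y)
    {U : Opens S.X} (t : ∀ y : U, L.envStalk y) (ht : L.envSec.pred t) : p t := by
  refine hloc t fun x => ?_
  obtain ⟨V, hV, i, h⟩ := ht x
  refine ⟨V, hV, i, ?_⟩
  change (fun y : V => t (i y)) ∈ L.envAlg V at h
  generalize (fun y : V => t (i y)) = t' at h ⊢
  induction h using Algebra.adjoin_induction with
  | mem t ht =>
    rcases ht with ⟨f, hf, rfl⟩ | ⟨s, hs, rfl⟩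
    · exact hfun f hf
    · exact hlie s hs
  | algebraMap k =>
    have h := hfun _ (S.regular_const V k)
    simp only [AlgHom.commutes] at h
    exact h
  | add s t _ _ hs ht => exact hadd s t hs ht
  | mul s t hs' ht' hs ht =>
    exact hmul s t (PrelocalPredicate.sheafifyOf (P := L.envPre) hs')
      (PrelocalPredicate.sheafifyOf (P := L.envPre) ht') hs ht

/-- Equality of families near `x`. -/
def nearCon (x : S.X) : RingCon (∀ y : S.X, L.envStalk y) where
  r s t := ∀ᶠ y in 𝓝 x, s y = t y
  iseqv := ⟨fun _ => .of_forall fun _ => rfl, fun h => h.mono fun _ e => e.symm,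
    fun h h' => (h.and h').mono fun _ e => e.1.trans e.2⟩
  add' h h' := (h.and h').mono fun _ e => congrArg₂ (· + ·) e.1 e.2
  mul' h h' := (h.and h').mono fun _ e => congrArg₂ (· * ·) e.1 e.2

theorem nearCon_eq {x : S.X} {s t : ∀ y : S.X, L.envStalk y} :
    (RingCon.toQuotient s : (L.nearCon x).Quotient) = RingCon.toQuotient t ↔
      ∀ᶠ y in 𝓝 x, s y = t y := RingCon.eq _

/-- A germ of a regular function, as a family of elements of the `𝒰(O_y, L_y)` near `x`. -/
def spreadFun₀ (x : S.X) (f : S.stalk x) : (L.nearCon x).Quotient :=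
  RingCon.toQuotient fun y => UEnv.ofFun K _ (L.stalk y) (S.regular_isEtale.rep f y)

/-- A germ of a section of `L`, as a family of elements of the `𝒰(O_y, L_y)` near `x`. -/
def spreadLie₀ (x : S.X) (a : L.stalk x) : (L.nearCon x).Quotient :=
  RingCon.toQuotient fun y => UEnv.ofLie K (S.stalk y) (L.stalk y) (L.isModuleSheaf.rep a y)

theorem spreadFun₀_eq {x : S.X} {f : S.stalk x} {g : ∀ y, S.stalk y} (hg : IsRep S.regular x f g) :
    L.spreadFun₀ x f = RingCon.toQuotient fun y => UEnv.ofFun K _ (L.stalk y) (g y) :=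
  L.nearCon_eq.2 (((S.regular_isEtale.isRep_rep _).eventually_eq
    S.regular_isEtale hg).mono fun _ e => by rw [e])

theorem spreadLie₀_eq {x : S.X} {a : L.stalk x} {g : ∀ y, L.stalk y} (hg : IsRep L.sec x a g) :
    L.spreadLie₀ x a = RingCon.toQuotient fun y => UEnv.ofLie K (S.stalk y) (L.stalk y) (g y) :=
  L.nearCon_eq.2 (((L.isModuleSheaf.isRep_rep _).eventually_eq
    L.isModuleSheaf.toIsEtale hg).mono fun _ e => by rw [e])

theorem spreadFun₀_const (x : S.X) (k : K) :
    L.spreadFun₀ x (algebraMap K (S.stalk x) k) = algebraMap K _ k := by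
  have hk : IsRep S.regular x (algebraMap K (S.stalk x) k) (fun y => algebraMap K (S.stalk y) k) :=
    ⟨⊤, trivial, _, S.regular_const ⊤ k, rfl, fun _ _ => rfl⟩
  rw [L.spreadFun₀_eq hk]
  simp only [AlgHom.commutes]; rfl

def spreadFun (x : S.X) : S.stalk x →ₐ[K] (L.nearCon x).Quotient where
  toFun := L.spreadFun₀ x
  map_one' := by simpa using L.spreadFun₀_const x 1
  map_zero' := by simpa using L.spreadFun₀_const x 0
  map_mul' f g := by
    rw [L.spreadFun₀_eq (IsRep.op₂ (fun {_} a b => a * b) S.regular_mul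
      (S.regular_isEtale.isRep_rep f) (S.regular_isEtale.isRep_rep g))]
    simp only [map_mul]; rfl
  map_add' f g := by
    rw [L.spreadFun₀_eq (IsRep.op₂ (fun {_} a b => a + b) S.regular_add
      (S.regular_isEtale.isRep_rep f) (S.regular_isEtale.isRep_rep g))]
    simp only [map_add]; rfl
  commutes' := L.spreadFun₀_const x

def spreadLie (x : S.X) : L.stalk x →+ (L.nearCon x).Quotient :=
  AddMonoidHom.mk' (L.spreadLie₀ x) fun a b => by
    rw [L.spreadLie₀_eq (IsRep.op₂ (fun {_} a b => a + b) L.isModuleSheaf.add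
      (L.isModuleSheaf.isRep_rep a) (L.isModuleSheaf.isRep_rep b))]
    simp only [map_add]; rfl

theorem spreadLie_smul (x : S.X) (f : S.stalk x) (a : L.stalk x) :
    L.spreadLie x (f • a) = L.spreadFun x f * L.spreadLie x a := by
  refine (L.spreadLie₀_eq (IsRep.op₂ (fun {_} a b => a • b) L.isModuleSheaf.smul
    (S.regular_isEtale.isRep_rep f) (L.isModuleSheaf.isRep_rep a))).trans ?_
  simp only [UEnv.ofLie_smul]; rfl

theorem spreadLie_lie (x : S.X) (a b : L.stalk x) :
    L.spreadLie x ⁅a, b⁆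
      = L.spreadLie x a * L.spreadLie x b - L.spreadLie x b * L.spreadLie x a := by
  refine (L.spreadLie₀_eq (IsRep.op₂ (fun {_} a b => ⁅a, b⁆) L.sec_lie
    (L.isModuleSheaf.isRep_rep a) (L.isModuleSheaf.isRep_rep b))).trans ?_
  simp only [UEnv.ofLie_lie]; rfl

theorem spreadLie_mul_spreadFun (x : S.X) (a : L.stalk x) (f : S.stalk x) :
    L.spreadLie x a * L.spreadFun x f
      = L.spreadFun x f * L.spreadLie x a + L.spreadFun x ⁅a, f⁆ := by
  have h := L.spreadFun₀_eq (IsRep.op₂ (fun {_} a b => ⁅a, b⁆) L.sec_anchor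
    (L.isModuleSheaf.isRep_rep a) (S.regular_isEtale.isRep_rep f))
  refine Eq.trans ?_ (congrArg (_ + ·) h.symm)
  change (RingCon.toQuotient fun y => UEnv.ofLie K (S.stalk y) (L.stalk y)
    (L.isModuleSheaf.rep a y) * UEnv.ofFun K _ (L.stalk y) (S.regular_isEtale.rep f y) :
      (L.nearCon x).Quotient) = _
  simp only [UEnv.ofLie_mul_ofFun]; rfl

/-- An element of `𝒰(O_x, L_x)` determines a family near `x`. -/
def spread (x : S.X) : L.envStalk x →ₐ[K] (L.nearCon x).Quotient :=
  UEnv.lift K (L.spreadFun x) (L.spreadLie x) (L.spreadLie_smul x) (L.spreadLie_lie x)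
    (L.spreadLie_mul_spreadFun x)

theorem spread_ofFun (x : S.X) (f : S.stalk x) {g : ∀ y, S.stalk y} (hg : IsRep S.regular x f g) :
    L.spread x (UEnv.ofFun K _ _ f)
      = RingCon.toQuotient fun y => UEnv.ofFun K (S.stalk y) (L.stalk y) (g y) := by
  rw [spread, UEnv.lift_ofFun]
  exact L.spreadFun₀_eq hg

theorem spread_ofLie (x : S.X) (a : L.stalk x) {g : ∀ y, L.stalk y} (hg : IsRep L.sec x a g) :
    L.spread x (UEnv.ofLie K _ _ a)
      = RingCon.toQuotient fun y => UEnv.ofLie K (S.stalk y) (L.stalk y) (g y) := by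
  rw [spread, UEnv.lift_ofLie]
  exact L.spreadLie₀_eq hg

theorem spread_sec {x : S.X} {U : Opens S.X} (hx : x ∈ U) (t : ∀ y : U, L.envStalk y)
    (ht : L.envSec.pred t) :
    L.spread x (t ⟨x, hx⟩) = RingCon.toQuotient (extZero U t) := by
  have ext_eq : ∀ {U : Opens S.X} (_ : x ∈ U) (s : ∀ y : U, L.envStalk y)
      (g : ∀ y, L.envStalk y), (∀ y (hy : y ∈ U), g y = s ⟨y, hy⟩) →
      (RingCon.toQuotient g : (L.nearCon x).Quotient) = RingCon.toQuotient (extZero U s) := by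
    intro U hx s g h
    refine L.nearCon_eq.2 ?_
    filter_upwards [U.isOpen.mem_nhds hx] with y hy
    rw [extZero_apply s hy, h y hy]
  refine L.envSec_induction (p := fun {U} t => ∀ hx : x ∈ U,
    L.spread x (t ⟨x, hx⟩) = RingCon.toQuotient (extZero U t)) ?_ ?_ ?_ ?_ ?_ t ht hx
  · intro U t h hx
    obtain ⟨V, hV, i, e⟩ := h ⟨x, hx⟩
    refine (e hV).trans (ext_eq hV _ _ fun y hy => ?_).symm
    rw [extZero_apply t (i.le hy)]; rfl
  · intro U f hf hx
    rw [L.spread_ofFun x _ (isRep_extZero hf hx)]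
    exact ext_eq hx _ _ fun y hy => by rw [extZero_apply f hy]
  · intro U s hs hx
    rw [L.spread_ofLie x _ (isRep_extZero hs hx)]
    exact ext_eq hx _ _ fun y hy => by rw [extZero_apply s hy]
  · intro U s t hs ht hx
    rw [map_add, hs hx, ht hx, ← RingCon.coe_add]
    exact ext_eq hx _ _ fun y hy => by rw [Pi.add_apply, extZero_apply s hy, extZero_apply t hy]
  · intro U s t _ _ hs ht hx
    rw [map_mul, hs hx, ht hx, ← RingCon.coe_mul]
    exact ext_eq hx _ _ fun y hy => by rw [Pi.mul_apply, extZero_apply s hy, extZero_apply t hy]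

theorem envSec_smul {U : Opens S.X} (f : ∀ y : U, S.stalk y) (s : ∀ y : U, L.envStalk y)
    (hf : S.regular.pred f) (hs : L.envSec.pred s) : L.envSec.pred fun y => f y • s y :=
  L.envSec_mul _ _ (L.envSec_ofFun f hf) hs

theorem envSec_isModuleSheaf : IsModuleSheaf S L.envSec where
  exists_sec x u := by
    suffices h : ∃ g, IsRep L.envSec x u g by
      obtain ⟨g, U, hx, s, hs, e, _⟩ := h
      exact ⟨U, hx, s, hs, e⟩
    induction u using UEnv.induction with
    | h1 => exact ⟨fun y => algebraMap K _ 1, ⊤, trivial, _, L.envSec_const ⊤ 1, by simp,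
        fun _ _ => rfl⟩
    | hadd u v hu hv =>
      obtain ⟨g, hg⟩ := hu
      obtain ⟨h, hh⟩ := hv
      exact ⟨_, IsRep.op₂ (fun {_} a b => a + b) L.envSec_add hg hh⟩
    | hfun f u hu =>
      obtain ⟨g, hg⟩ := hu
      exact ⟨_, IsRep.op₂ (fun {_} a b => a • b) L.envSec_smul
        (S.regular_isEtale.isRep_rep f) hg⟩
    | hlie a u hu =>
      obtain ⟨g, hg⟩ := hu
      exact ⟨_, IsRep.op₂ (fun {y} a b => UEnv.ofLie K (S.stalk y) (L.stalk y) a * b)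
        (fun s t hs ht => L.envSec_mul _ _ (L.envSec_ofLie s hs) ht)
        (L.isModuleSheaf.isRep_rep a) hg⟩
  eq_nhds x U hx s t hs ht hst := by
    have h := L.spread_sec hx s hs
    rw [hst, L.spread_sec hx t ht] at h
    filter_upwards [L.nearCon_eq.1 h] with y e hy
    rw [extZero_apply s hy, extZero_apply t hy] at e
    exact e.symm
  zero U := by simpa using L.envSec_const U 0
  add := L.envSec_add
  smul := L.envSec_smul

theorem envSec_counit {U : Opens S.X} (t : ∀ y : U, L.envStalk y) (ht : L.envSec.pred t) :
    S.regular.pred fun y => UEnv.counit (t y) := by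
  -- stronger: the action of a section on a regular function is regular
  have h : ∀ f : ∀ y : U, S.stalk y, S.regular.pred f →
      S.regular.pred fun y => UEnv.actR (t y) (f y) := by
    refine L.envSec_induction (p := fun {U} t => ∀ f : ∀ y : U, S.stalk y, S.regular.pred f →
      S.regular.pred fun y => UEnv.actR (t y) (f y)) ?_ ?_ ?_ ?_ ?_ t ht
    · intro U t h f hf
      refine S.regular.locality _ fun x => ?_
      obtain ⟨V, hV, i, e⟩ := h x
      exact ⟨V, hV, i, e _ (S.regular.res i f hf)⟩
    · intro U g hg f hf
      simpa [UEnv.actR] using S.regular_mul g f hg hf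
    · intro U s hs f hf
      simpa [UEnv.actR] using L.sec_anchor s f hs hf
    · intro U s t hs ht f hf
      simpa using S.regular_add _ _ (hs f hf) (ht f hf)
    · intro U s t _ _ hs ht f hf
      simpa using hs _ (ht f hf)
  have h1 := h _ (S.regular_const U 1)
  simp only [map_one] at h1
  exact h1

theorem envSec_comul {U : Opens S.X} (t : ∀ y : U, L.envStalk y) (ht : L.envSec.pred t) :
    (tensorSec S L.envSec L.envSec).pred fun y => UEnv.comul (t y) := by
  refine L.envSec_induction (p := fun {U} t =>
    (tensorSec S L.envSec L.envSec).pred fun y : U => UEnv.comul (t y)) ?_ ?_ ?_ ?_ ?_ t ht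
  · intro U t h
    exact (tensorSec S L.envSec L.envSec).locality _ h
  · intro U f hf
    refine PrelocalPredicate.sheafifyOf ⟨1, ![fun y => UEnv.ofFun K _ _ (f y)],
      ![fun y => algebraMap K _ 1], fun i => ?_, fun i => ?_, fun y => ?_⟩
    · fin_cases i; exact L.envSec_ofFun f hf
    · fin_cases i; exact L.envSec_const U 1
    · simp [UEnv.ofFun_eq, UEnv.comul_one, TensorProduct.smul_tmul']
  · intro U s hs
    refine PrelocalPredicate.sheafifyOf
      ⟨2, ![fun y => UEnv.ofLie K _ _ (s y), fun y => algebraMap K _ 1],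
        ![fun y => algebraMap K _ 1, fun y => UEnv.ofLie K _ _ (s y)],
        fun i => ?_, fun i => ?_, fun y => ?_⟩
    · fin_cases i; exacts [L.envSec_ofLie s hs, L.envSec_const U 1]
    · fin_cases i; exacts [L.envSec_const U 1, L.envSec_ofLie s hs]
    · have h := UEnv.comul_ofLie_mul (K := K) (R := S.stalk y) (s y) 1
      rw [mul_one, UEnv.comul_one, UEnv.op2_tmul] at h
      simp [h, Fin.sum_univ_two]
  · intro U s t hs ht x
    obtain ⟨V, hV, i, n, a, b, ha, hb, e⟩ := hs x
    obtain ⟨W, hW, j, m, c, d, hc, hd, e'⟩ := ht x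
    refine ⟨V ⊓ W, ⟨hV, hW⟩, Opens.infLELeft V W ≫ i, n + m,
      Fin.append (fun k y => a k ⟨y.1, y.2.1⟩) (fun k y => c k ⟨y.1, y.2.2⟩),
      Fin.append (fun k y => b k ⟨y.1, y.2.1⟩) (fun k y => d k ⟨y.1, y.2.2⟩), ?_, ?_, ?_⟩
    · intro k
      refine Fin.addCases (fun k => ?_) (fun k => ?_) k
      · rw [Fin.append_left]; exact L.envSec.res (Opens.infLELeft V W) _ (ha k)
      · rw [Fin.append_right]; exact L.envSec.res (Opens.infLERight V W) _ (hc k)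
    · intro k
      refine Fin.addCases (fun k => ?_) (fun k => ?_) k
      · rw [Fin.append_left]; exact L.envSec.res (Opens.infLELeft V W) _ (hb k)
      · rw [Fin.append_right]; exact L.envSec.res (Opens.infLERight V W) _ (hd k)
    · intro y
      simp only [Fin.sum_univ_add, Fin.append_left, Fin.append_right]
      rw [← e ⟨y.1, y.2.1⟩, ← e' ⟨y.1, y.2.2⟩]
      exact map_add _ _ _
  · intro U s t _ _ hs ht x
    obtain ⟨V, hV, i, n, a, b, ha, hb, e⟩ := hs x
    obtain ⟨W, hW, j, m, c, d, hc, hd, e'⟩ := ht x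
    refine ⟨V ⊓ W, ⟨hV, hW⟩, Opens.infLELeft V W ≫ i, n * m,
      fun k y => a (finProdFinEquiv.symm k).1 ⟨y.1, y.2.1⟩ *
        c (finProdFinEquiv.symm k).2 ⟨y.1, y.2.2⟩,
      fun k y => b (finProdFinEquiv.symm k).1 ⟨y.1, y.2.1⟩ *
        d (finProdFinEquiv.symm k).2 ⟨y.1, y.2.2⟩, ?_, ?_, ?_⟩
    · exact fun k => L.envSec_mul _ _ (L.envSec.res (Opens.infLELeft V W) _ (ha _))
        (L.envSec.res (Opens.infLERight V W) _ (hc _))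
    · exact fun k => L.envSec_mul _ _ (L.envSec.res (Opens.infLELeft V W) _ (hb _))
        (L.envSec.res (Opens.infLERight V W) _ (hd _))
    · intro y
      exact UEnv.comul_mul_sum _ _ _ _ _ _ (e ⟨y.1, y.2.1⟩) (e' ⟨y.1, y.2.2⟩)

/-- The universal enveloping algebroid `𝒰(O, L)`. -/
def env : BialgebraSheaf S where
  stalk := L.envStalk
  sec := L.envSec
  isModuleSheaf := L.envSec_isModuleSheaf
  sec_one U := by simpa using L.envSec_const U 1
  sec_mul := L.envSec_mul
  sec_counit := L.envSec_counit
  sec_comul := L.envSec_comul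

variable {L} {L' : LieAlgebroid S}

/-- The morphism of bialgebras induced by a morphism of Lie algebroids. -/
def Hom.env (φ : Hom L L') : BialgebraSheaf.Hom L.env L'.env where
  toFun x := UEnv.map (φ.toFun x)
  map_one x := map_one (UEnv.mapAlg (φ.toFun x))
  map_mul x := map_mul (UEnv.mapAlg (φ.toFun x))
  map_sec t ht := by
    refine L.envSec_induction (p := fun {U} t =>
      L'.envSec.pred fun y : U => UEnv.mapAlg (φ.toFun y) (t y)) ?_ ?_ ?_ ?_ ?_ t ht
    · intro U t h
      exact L'.envSec.locality _ h
    · intro U f hf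
      simpa only [UEnv.mapAlg_ofFun] using L'.envSec_ofFun f hf
    · intro U s hs
      simpa only [UEnv.mapAlg_ofLie] using L'.envSec_ofLie _ (φ.map_sec s hs)
    · intro U s t hs ht
      simpa only [map_add] using L'.envSec_add _ _ hs ht
    · intro U s t _ _ hs ht
      simpa only [map_mul] using L'.envSec_mul _ _ hs ht

end LieAlgebroid

/-- The functor `𝒰` from Lie algebroids to `O/K`-bialgebras. -/
def envFunctor {K : Type u} [Field K] (S : KSpace K) : LieAlgebroid S ⥤ BialgebraSheaf S where
  obj L := L.env
  map φ := LieAlgebroid.Hom.env φ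
  map_id L := BialgebraSheaf.Hom.ext' fun x u => by
    change UEnv.mapAlg _ u = u
    induction u using UEnv.induction with
    | h1 => simp
    | hadd u v hu hv => simp only [map_add, hu, hv]
    | hfun f u hu => rw [UEnv.mapAlg_smul, hu]
    | hlie a u hu => rw [map_mul, hu, UEnv.mapAlg_ofLie]; rfl
  map_comp {L L' L''} φ ψ := BialgebraSheaf.Hom.ext' fun x u => by
    change UEnv.mapAlg _ u = UEnv.mapAlg (ψ.toFun x) (UEnv.mapAlg (φ.toFun x) u)
    induction u using UEnv.induction with
    | h1 => simp
    | hadd u v hu hv => simp only [map_add, hu, hv]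
    | hfun f u hu => rw [UEnv.mapAlg_smul, UEnv.mapAlg_smul, UEnv.mapAlg_smul, hu]
    | hlie a u hu =>
      rw [map_mul, map_mul, map_mul, hu, UEnv.mapAlg_ofLie, UEnv.mapAlg_ofLie, UEnv.mapAlg_ofLie]
      rfl

end

open CategoryTheory

/-! A morphism of sheaves that is bijective on stalks is invertible, because its stalkwise inverse
again preserves sections. A local basis restricts to a basis of each stalk. So the two canonical
morphisms `L → 𝒫(𝒰(L))` and `𝒰(𝒫(A)) → A` need only be studied for a Lie-Rinehart algebra, resp. a
bialgebra, over one ring `R ⊇ K`-algebra, given a finite basis of `L`, resp. of the primitive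
elements.

Enveloping side. The ordered monomials in a basis of `L` form an `R`-basis of `𝒰(R, L)`
(`UEnv.pbwSum_bijective`). Independence comes from a representation on the free module on
multi-indices. The recursion defining it is forced, and the failure of the bracket relation is
`R`-linear in every argument and vanishes by induction on the degree and the Jacobi identity
(`PBW.defect_single`). In characteristic zero the monomials can be divided by factorials, and the
divided monomials satisfy `Δ(b α) = ∑ b β ⊗ b γ` over `β + γ = α`. For a basis of this kind the
reduced coproduct is explicit, and `Āₙ` is spanned by the `b α` with `0 < |α| ≤ n` (`mem_primFilt`,
`coeff_eq_zero`). The case `n = 1` gives `𝒫(𝒰(L)) = L`; the general case gives cocompleteness and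
free graded pieces.

Bialgebra side. Cocompleteness and free graded pieces make the stalk of `A` flat
(`flat_of_free_gr`), so tensoring preserves injections and kernels. The divided monomials in a basis
of the primitive elements again form a divided family. They are independent, since the reduced
coproduct pushes a relation to lower degree until only primitive elements remain
(`linearCombination_injective`). They generate, by induction on `n` (`primFilt_le_range`): if `a` is
in `Āₙ₊₁`, flatness and cocommutativity put `Δ̄ a` in the tensor square of the span already
obtained. Coassociativity and cocommutativity then make its coefficient at `(β, γ)` a function of `β
+ γ`, so `Δ̄ a` is also the reduced coproduct of a combination of divided monomials, from which `a`
differs by a primitive element (`exists_redDiv_eq`). Hence `𝒰(𝒫(A)) → A` carries a basis to a basis.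
-/

noncomputable section

set_option linter.unusedSectionVars false

/-! ### Multi-indices -/

namespace MultiIndex

variable {I : Type*}

theorem add_single_ne_zero (j : I) (β : I →₀ ℕ) : β + Finsupp.single j 1 ≠ 0 := by
  intro h
  simpa using DFunLike.congr_fun h j

theorem exists_eq_add_single {α : I →₀ ℕ} {i : I} (h : α i ≠ 0) :
    ∃ β, α = β + Finsupp.single i 1 := by
  refine ⟨α - Finsupp.single i 1, (tsub_add_cancel_of_le ?_).symm⟩
  rw [Finsupp.single_le_iff]
  exact Nat.one_le_iff_ne_zero.2 h

theorem exists_eq_add_single_of_ne_zero {α : I →₀ ℕ} (h : α ≠ 0) :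
    ∃ i β, α = β + Finsupp.single i 1 := by
  obtain ⟨i, hi⟩ := Finsupp.ne_iff.1 h
  exact ⟨i, exists_eq_add_single hi⟩

variable [LinearOrder I]

/-- The variable `i` is at most every variable that occurs in `α`. -/
def Below (i : I) (α : I →₀ ℕ) : Prop := ∀ k ∈ α.support, i ≤ k

theorem below_zero (i : I) : Below i 0 := by simp [Below]

theorem Below.add_single {i j : I} {α : I →₀ ℕ} (h : Below i α) (hij : i ≤ j) :
    Below i (α + Finsupp.single j 1) := by
  intro k hk
  by_cases hkj : k = j
  · exact hkj ▸ hij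
  · refine h k ?_
    simpa [Finsupp.single_apply, Ne.symm hkj] using hk

/-- The smallest variable that occurs in `α`. -/
def minVar (α : I →₀ ℕ) (h : α ≠ 0) : I := α.support.min' (by simpa using h)

theorem minVar_ne_zero (α : I →₀ ℕ) (h : α ≠ 0) : α (minVar α h) ≠ 0 := by
  exact Finsupp.mem_support_iff.1 (α.support.min'_mem (by simpa using h))

theorem minVar_below (α : I →₀ ℕ) (h : α ≠ 0) : Below (minVar α h) α :=
  fun k hk => Finset.min'_le _ k hk

theorem sub_add_minVar (α : I →₀ ℕ) (h : α ≠ 0) :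
    α - Finsupp.single (minVar α h) 1 + Finsupp.single (minVar α h) 1 = α := by
  refine tsub_add_cancel_of_le ?_
  rw [Finsupp.single_le_iff]
  exact Nat.one_le_iff_ne_zero.2 (minVar_ne_zero α h)

theorem Below.sub {i : I} {α : I →₀ ℕ} (h : Below i α) (β : I →₀ ℕ) : Below i (α - β) := by
  intro k hk
  refine h k ?_
  simp only [Finsupp.mem_support_iff, Finsupp.coe_tsub, Pi.sub_apply] at hk ⊢
  omega

theorem degree_sub_minVar (α : I →₀ ℕ) (h : α ≠ 0) :
    (α - Finsupp.single (minVar α h) 1).degree + 1 = α.degree := by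
  conv_rhs => rw [← sub_add_minVar α h]
  simp

theorem minVar_add_single {j : I} {β : I →₀ ℕ} (h : Below j β) :
    minVar (β + Finsupp.single j 1) (add_single_ne_zero j β) = j := by
  refine le_antisymm (minVar_below _ _ j (by simp)) ?_
  exact h.add_single le_rfl _ (by simpa using minVar_ne_zero _ (add_single_ne_zero j β))

/-- Induction on multi-indices that adds a new smallest variable. -/
theorem below_induction {p : (I →₀ ℕ) → Prop} (h0 : p 0)
    (hs : ∀ j β, Below j β → p β → p (β + Finsupp.single j 1)) (α : I →₀ ℕ) : p α := by
  induction hd : α.degree using Nat.strong_induction_on generalizing α with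
  | _ d ih =>
    by_cases h : α = 0
    · exact h ▸ h0
    · rw [← sub_add_minVar α h]
      refine hs _ _ ((minVar_below α h).sub _) (ih _ ?_ _ rfl)
      have := degree_sub_minVar α h
      omega

theorem ne_zero_of_not_below {i : I} {α : I →₀ ℕ} (h : ¬ Below i α) : α ≠ 0 := by
  rintro rfl
  exact h (below_zero i)

theorem minVar_lt {i : I} {α : I →₀ ℕ} (h : ¬ Below i α) :
    minVar α (ne_zero_of_not_below h) < i := by
  by_contra hc
  exact h fun k hk => (not_lt.1 hc).trans (minVar_below α _ k hk)

variable {A : Type*} [Monoid A]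

/-- The ordered monomial `∏ eᵢ ^ αᵢ`. -/
def mon (e : I → A) (α : I →₀ ℕ) : A :=
  open Classical in
  if h : α = 0 then 1 else e (minVar α h) * mon e (α - Finsupp.single (minVar α h) 1)
termination_by α.degree
decreasing_by
  have := degree_sub_minVar α h
  omega

theorem mon_zero (e : I → A) : mon e 0 = 1 := by rw [mon]; simp

theorem mon_add_single (e : I → A) {j : I} {β : I →₀ ℕ} (h : Below j β) :
    mon e (β + Finsupp.single j 1) = e j * mon e β := by
  rw [mon, dif_neg (add_single_ne_zero j β), minVar_add_single h, add_tsub_cancel_right]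

theorem mon_single (e : I → A) (j : I) : mon e (Finsupp.single j 1) = e j := by
  have := mon_add_single e (below_zero j)
  rwa [zero_add, mon_zero, mul_one] at this

theorem map_mon {B : Type*} [Monoid B] (f : A →* B) (e : I → A) (α : I →₀ ℕ) :
    f (mon e α) = mon (fun i => f (e i)) α := by
  induction α using below_induction with
  | h0 => simp [mon_zero]
  | hs j β h ih => rw [mon_add_single e h, map_mul, ih, mon_add_single _ h]

end MultiIndex

/-! ### The Poincaré-Birkhoff-Witt theorem for Lie-Rinehart algebras -/

namespace PBW

open MultiIndex Finsupp

variable {R L I : Type*} [CommRing R] [LieRing L] [Module R L] [LieRingModule L R]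

section DerivOp

variable {J : Type*}

/-- The operator over the derivation `x` of `R` with prescribed values on the basis. -/
def derivOp (x : L) (a : J → J →₀ R) : (J →₀ R) →+ (J →₀ R) :=
  (Finsupp.linearCombination R a).toAddMonoidHom +
    Finsupp.mapRange.addMonoidHom (AddMonoidHom.mk' (fun f : R => ⁅x, f⁆) (lie_add x))

theorem derivOp_single (x : L) (a : J → J →₀ R) (α : J) (f : R) :
    derivOp x a (single α f) = f • a α + single α ⁅x, f⁆ := by
  simp [derivOp]

theorem derivOp_smul [LieRinehartRing R L] (x : L) (a : J → J →₀ R) (f : R) (s : J →₀ R) :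
    derivOp x a (f • s) = f • derivOp x a s + ⁅x, f⁆ • s := by
  induction s using Finsupp.induction_linear with
  | zero => simp
  | add s t hs ht => rw [smul_add, map_add, hs, ht, map_add, smul_add, smul_add]; abel
  | single α g =>
    rw [smul_single, derivOp_single, derivOp_single, smul_add, smul_smul, smul_eq_mul,
      LieRinehartRing.leibniz_mul_right, single_add, smul_single, smul_single, smul_eq_mul,
      smul_eq_mul, add_assoc]

/-- Allows the degree guard in the recursion for `act` to be removed: only the values on the support
of the argument matter. -/
theorem derivOp_congr (x : L) {a a' : J → J →₀ R} {s : J →₀ R}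
    (h : ∀ α ∈ s.support, a α = a' α) : derivOp x a s = derivOp x a' s := by
  simp only [derivOp, AddMonoidHom.add_apply, LinearMap.toAddMonoidHom_coe,
    Finsupp.linearCombination_apply]
  congr 1
  exact Finset.sum_congr rfl fun α hα => by simp only [h α hα]

end DerivOp

variable [LinearOrder I] [Fintype I] (e : Module.Basis I R L)

/-- The action of the basis vector `e i` on the monomial with exponent `α`. -/
def act (i : I) (α : I →₀ ℕ) : (I →₀ ℕ) →₀ R :=
  open Classical in
  -- The value is forced. Write `z α` for the monomial. If `α = γ + j` with `j` minimal and `j < i`,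
  -- then `e i • z α = e i • e j • z γ` must equal `e j • e i • z γ + ⁅e i, e j⁆ • z γ`. The leading
  -- part `z (γ + i)` of `e i • z γ` gives `e j • z (γ + i) = z (α + i)`, since `j` is minimal there
  -- too.
  if h : Below i α then single (α + single i 1) 1 else
    let j := minVar α (ne_zero_of_not_below h)
    single (α + single i 1) 1
      -- The guard serves termination only. The argument, `e i • z γ` without its leading term, has
      -- degree at most `|γ| < |α|`, so the default `0` is never used.
      + derivOp (e j) (fun γ => if _ : γ.degree < α.degree then act j γ else 0)
        (act i (α - single j 1) - single (α - single j 1 + single i 1) 1)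
      + ∑ k, e.repr ⁅e i, e j⁆ k • act k (α - single j 1)
termination_by α.degree
decreasing_by
  all_goals
    have := degree_sub_minVar α (ne_zero_of_not_below h)
    omega

theorem act_of_below {i : I} {α : I →₀ ℕ} (h : Below i α) :
    act e i α = single (α + single i 1) 1 := by
  rw [act, dif_pos h]

variable (R I) in
/-- The elements of degree at most `m`. -/
def degLE (m : ℕ) : Submodule R ((I →₀ ℕ) →₀ R) := Finsupp.supported R R {α | α.degree ≤ m}

theorem degLE_mono {m n : ℕ} (h : m ≤ n) : degLE R I m ≤ degLE R I n :=
  Finsupp.supported_mono fun α (hα : α.degree ≤ m) => hα.trans h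

theorem single_mem_degLE {m : ℕ} {α : I →₀ ℕ} (h : α.degree ≤ m) (f : R) :
    single α f ∈ degLE R I m := Finsupp.single_mem_supported R f h

theorem degLE_induction {m : ℕ} {p : ((I →₀ ℕ) →₀ R) → Prop} (h0 : p 0)
    (hadd : ∀ s t, p s → p t → p (s + t)) (hsingle : ∀ α f, α.degree ≤ m → p (single α f))
    {s : (I →₀ ℕ) →₀ R} (hs : s ∈ degLE R I m) : p s := by
  rw [← Finsupp.sum_single s]
  refine Finset.sum_induction _ p hadd h0 fun α hα => hsingle α _ ?_
  exact (Finsupp.mem_supported R s).1 hs hα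

theorem derivOp_mem_degLE {x : L} {a : (I →₀ ℕ) → (I →₀ ℕ) →₀ R} {m : ℕ}
    (ha : ∀ α, α.degree ≤ m → a α ∈ degLE R I (m + 1)) {s : (I →₀ ℕ) →₀ R}
    (hs : s ∈ degLE R I m) : derivOp x a s ∈ degLE R I (m + 1) := by
  refine degLE_induction (p := fun s => derivOp x a s ∈ degLE R I (m + 1)) (by simp) ?_ ?_ hs
  · intro s t hs ht
    rw [map_add]; exact add_mem hs ht
  · intro α f h
    rw [derivOp_single]
    exact add_mem (Submodule.smul_mem _ _ (ha α h)) (single_mem_degLE (h.trans (Nat.le_succ m)) _)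

/-- Each correction in the recursion is one basis vector applied to something of degree below `|α|`,
so it stays in degree at most `|α|`. This makes the guard in `act` harmless and lets later
inductions separate a leading monomial from terms already treated. -/
theorem act_sub_mem (i : I) (α : I →₀ ℕ) :
    act e i α - single (α + single i 1) 1 ∈ degLE R I α.degree := by
  induction hd : α.degree using Nat.strong_induction_on generalizing α i with
  | _ d ih =>
    subst hd
    by_cases h : Below i α
    · simp [act_of_below e h]
    · have h0 := ne_zero_of_not_below h
      have hdeg := degree_sub_minVar α h0
      have key : ∀ k γ, γ.degree < α.degree → act e k γ ∈ degLE R I (γ.degree + 1) := by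
        intro k γ hγ
        have h1 := ih _ hγ k γ rfl
        have h2 : single (γ + single k 1) (1 : R) ∈ degLE R I (γ.degree + 1) :=
          single_mem_degLE (by simp) 1
        simpa using add_mem (degLE_mono (Nat.le_succ _) h1) h2
      rw [act, dif_neg h]
      simp only [add_assoc, add_sub_cancel_left]
      refine add_mem ?_ (Submodule.sum_mem _ fun k _ => Submodule.smul_mem _ _ ?_)
      · rw [← hdeg]
        refine derivOp_mem_degLE ?_ (ih _ (by omega) i _ rfl)
        intro γ hγ
        split
        · exact degLE_mono (by omega) (key _ γ (by omega))
        · exact zero_mem _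
      · refine degLE_mono (by omega) (key k _ (by omega))

/-- The operator by which the basis vector `e i` acts. -/
def opBasis (i : I) : ((I →₀ ℕ) →₀ R) →+ ((I →₀ ℕ) →₀ R) := derivOp (e i) (act e i)

/-- The operator by which `x : L` acts. -/
def op (x : L) : ((I →₀ ℕ) →₀ R) →+ ((I →₀ ℕ) →₀ R) :=
  ∑ i, (DistribSMul.toAddMonoidHom _ (e.repr x i)).comp (opBasis e i)

theorem op_apply (x : L) (s : (I →₀ ℕ) →₀ R) : op e x s = ∑ i, e.repr x i • opBasis e i s := by
  simp [op]

theorem op_basis (i : I) (s : (I →₀ ℕ) →₀ R) : op e (e i) s = opBasis e i s := by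
  rw [op_apply, Finset.sum_eq_single i] <;> simp +contextual [eq_comm]

theorem op_add (x y : L) (s : (I →₀ ℕ) →₀ R) : op e (x + y) s = op e x s + op e y s := by
  simp [op_apply, add_smul, Finset.sum_add_distrib]

theorem op_smul (f : R) (x : L) (s : (I →₀ ℕ) →₀ R) : op e (f • x) s = f • op e x s := by
  simp [op_apply, Finset.smul_sum, mul_smul]

theorem op_sub (x y : L) (s : (I →₀ ℕ) →₀ R) : op e (x - y) s = op e x s - op e y s := by
  rw [eq_sub_iff_add_eq, ← op_add, sub_add_cancel]

variable [LieRinehartRing R L]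

/-- `R`-linearity of the anchor, used to carry the Leibniz rule from the basis operators to `op e
x`. -/
theorem lie_eq_sum (x : L) (f : R) : ⁅x, f⁆ = ∑ i, e.repr x i * ⁅e i, f⁆ := by
  let φ : L →ₗ[R] R :=
    { toFun := fun x => ⁅x, f⁆
      map_add' := fun x y => add_lie x y f
      map_smul' := fun g x => LieRinehartRing.lie_smul_eq_mul g f x }
  have := congrArg φ (e.sum_repr x)
  rw [map_sum] at this
  simpa [φ] using this.symm

theorem op_apply_smul (x : L) (f : R) (s : (I →₀ ℕ) →₀ R) :
    op e x (f • s) = f • op e x s + ⁅x, f⁆ • s := by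
  simp only [op_apply, opBasis, derivOp_smul, smul_add, Finset.sum_add_distrib, Finset.smul_sum]
  rw [lie_eq_sum e x f, Finset.sum_smul]
  simp only [smul_smul, mul_comm]

theorem op_basis_single (i : I) (α : I →₀ ℕ) : op e (e i) (single α 1) = act e i α := by
  have h0 : ⁅e i, (1 : R)⁆ = 0 := by
    simpa using LieRinehartRing.leibniz_mul_right (e i) (1 : R) 1
  rw [op_basis, opBasis, derivOp_single, h0]
  simp

theorem op_basis_single_of_below {i : I} {α : I →₀ ℕ} (h : Below i α) :
    op e (e i) (single α 1) = single (α + single i 1) 1 := by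
  rw [op_basis_single, act_of_below e h]

/-- The recursion for `act` read as a commutation rule: the first instance of the bracket relation,
true by construction. -/
theorem op_comm_of_below {i j : I} {β : I →₀ ℕ} (hji : j < i) (hj : Below j β) :
    op e (e i) (op e (e j) (single β 1))
      = op e (e j) (op e (e i) (single β 1)) + op e ⁅e i, e j⁆ (single β 1) := by
  have hnb : ¬ Below i (β + single j 1) := fun h => not_le.2 hji (h j (by simp))
  rw [op_basis_single_of_below e hj, op_basis_single, act, dif_neg hnb]
  simp only [minVar_add_single hj, add_tsub_cancel_right]
  have h1 : single (β + single j 1 + single i 1) (1 : R)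
      = op e (e j) (single (β + single i 1) 1) := by
    rw [op_basis_single_of_below e (hj.add_single hji.le), add_right_comm]
  -- By `act_sub_mem` the support has degree at most `|β|`, so the guard always holds.
  have h2 : derivOp (e j) (fun γ => if _ : γ.degree < (β + single j 1).degree then act e j γ else 0)
      (act e i β - single (β + single i 1) 1) = op e (e j) (act e i β - single (β + single i 1) 1) := by
    rw [op_basis]
    refine derivOp_congr _ fun γ hγ => dif_pos ?_
    have : γ.degree ≤ β.degree := (Finsupp.mem_supported R _).1 (act_sub_mem e i β) hγ
    simpa using Nat.lt_succ_of_le this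
  rw [h1, h2, ← map_add, add_sub_cancel, op_basis_single e i β, op_apply e ⁅e i, e j⁆]
  congr 1
  exact Finset.sum_congr rfl fun k _ => by rw [← op_basis, op_basis_single]

/-- The failure of `op` to preserve the bracket. -/
def defect (x y : L) (s : (I →₀ ℕ) →₀ R) : (I →₀ ℕ) →₀ R :=
  op e x (op e y s) - op e y (op e x s) - op e ⁅x, y⁆ s

theorem defect_add (x y : L) (s t : (I →₀ ℕ) →₀ R) :
    defect e x y (s + t) = defect e x y s + defect e x y t := by
  simp only [defect, map_add]; abel

/-- The second-order Leibniz terms cancel because the anchor respects brackets, so the defect is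
determined by its values on monomials. -/
theorem defect_smul (x y : L) (f : R) (s : (I →₀ ℕ) →₀ R) :
    defect e x y (f • s) = f • defect e x y s := by
  have h : ⁅⁅x, y⁆, f⁆ = ⁅x, ⁅y, f⁆⁆ - ⁅y, ⁅x, f⁆⁆ := lie_lie x y f
  simp only [defect, op_apply_smul, map_add, h, smul_sub, sub_smul]
  abel

theorem defect_swap (x y : L) (s : (I →₀ ℕ) →₀ R) : defect e y x s = -defect e x y s := by
  have : op e ⁅y, x⁆ s = -op e ⁅x, y⁆ s := by
    rw [← lie_skew, ← neg_one_smul R ⁅x, y⁆, op_smul, neg_one_smul]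
  rw [defect, defect, this]; abel

theorem defect_add_right (x y z : L) (s : (I →₀ ℕ) →₀ R) :
    defect e x (y + z) s = defect e x y s + defect e x z s := by
  simp only [defect, op_add, map_add, lie_add]; abel

/-- The derivative of `f` in `⁅x, f • y⁆` cancels the one from the Leibniz rule of `op e x`. With
antisymmetry this reduces the defect to pairs of basis vectors. -/
theorem defect_smul_right (x y : L) (f : R) (s : (I →₀ ℕ) →₀ R) :
    defect e x (f • y) s = f • defect e x y s := by
  simp only [defect, op_smul, op_add, op_apply_smul, LieRinehartRing.leibniz_smul_right, smul_sub]
  abel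

theorem defect_eq_zero_of_basis {s : (I →₀ ℕ) →₀ R} (h : ∀ i j, defect e (e i) (e j) s = 0)
    (x y : L) : defect e x y s = 0 := by
  have key : ∀ x, (∀ j, defect e x (e j) s = 0) → ∀ y, defect e x y s = 0 := by
    intro x hx y
    have hy : y ∈ Submodule.span R (Set.range e) := by rw [e.span_eq]; trivial
    induction hy using Submodule.span_induction with
    | mem y hy => obtain ⟨j, rfl⟩ := hy; exact hx j
    | zero => simpa using defect_smul_right e x 0 0 s
    | add y z _ _ hy hz => rw [defect_add_right, hy, hz, add_zero]
    | smul f y _ hy => rw [defect_smul_right, hy, smul_zero]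
  refine key x (fun j => ?_) y
  rw [defect_swap, key (e j) (fun i => h j i) x, neg_zero]

theorem defect_basis_single {i j : I} {β : I →₀ ℕ} (hji : j < i) (hj : Below j β) :
    defect e (e i) (e j) (single β 1) = 0 := by
  rw [defect, op_comm_of_below e hji hj]; abel

theorem defect_eq_zero_of_degLE {x y : L} {m : ℕ}
    (h : ∀ α : I →₀ ℕ, α.degree ≤ m → defect e x y (single α 1) = 0)
    {s : (I →₀ ℕ) →₀ R} (hs : s ∈ degLE R I m) : defect e x y s = 0 := by
  refine degLE_induction (p := fun s => defect e x y s = 0) (by simp [defect]) ?_ ?_ hs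
  · intro s t hs ht
    rw [defect_add, hs, ht, add_zero]
  · intro α f hα
    rw [← mul_one f, ← smul_eq_mul, ← smul_single, defect_smul, h α hα, smul_zero]

/-- Induction on the degree. For basis vectors `e i`, `e j` with `j < i`, the relation holds by
construction if `j` is below `α`. Otherwise `z α = e k • z γ` with `k < j < i`, and the Jacobi
identity for `i, j, k` reduces it to relations on lower degree and to relations whose smaller index
is `k`, which is below everything in sight. -/
theorem defect_single (α : I →₀ ℕ) (x y : L) : defect e x y (single α 1) = 0 := by
  induction hd : α.degree using Nat.strong_induction_on generalizing α x y with
  | _ d ih =>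
    subst hd
    refine defect_eq_zero_of_basis e (fun i j => ?_) x y
    wlog hij : j < i generalizing i j with H
    · rcases (not_lt.1 hij).eq_or_lt with rfl | h
      · simp [defect, op_apply]
      · rw [defect_swap, H _ _ h, neg_zero]
    by_cases hj : Below j α
    · exact defect_basis_single e hij hj
    have h0 := ne_zero_of_not_below hj
    have hkj := minVar_lt hj
    have hdeg := degree_sub_minVar α h0
    have hk := (minVar_below α h0).sub (single (minVar α h0) 1)
    have hα := sub_add_minVar α h0
    generalize minVar α h0 = k at hkj hdeg hk hα
    generalize α - single k 1 = γ at hdeg hk hα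
    have hlow : ∀ s ∈ degLE R I γ.degree, ∀ x y, defect e x y s = 0 := fun s hs x y =>
      defect_eq_zero_of_degLE e (fun β hβ => ih _ (by omega) β x y rfl) hs
    have hγ : ∀ x y, defect e x y (single γ 1) = 0 :=
      hlow _ (single_mem_degLE le_rfl 1)
    -- The vector `e j • z γ` has degree `|α|`, out of reach of the induction hypothesis. Its
    -- leading monomial `γ + j` has `k` below it, so the constructed case applies there, and the
    -- rest has degree at most `|γ|`.
    have hmid : ∀ i j, k < i → k < j → defect e (e i) (e k) (op e (e j) (single γ 1)) = 0 := by
      intro i j hi hj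
      have h2 : op e (e j) (single γ 1)
          = single (γ + single j 1) 1 + (act e j γ - single (γ + single j 1) 1) := by
        rw [op_basis_single]; abel
      rw [h2, defect_add, hlow _ (act_sub_mem e j γ),
        defect_basis_single e hi (hk.add_single hj.le), add_zero]
    have hz : single α (1 : R) = op e (e k) (single γ 1) := by
      rw [op_basis_single_of_below e hk, hα]
    have hcomm : ∀ x y s, defect e x y s = 0 → op e x (op e y s)
        = op e y (op e x s) + op e ⁅x, y⁆ s := fun x y s h => by
      rw [defect, sub_sub, sub_eq_zero] at h; exact h
    have hjac : ⁅⁅e i, e j⁆, e k⁆ = ⁅e i, ⁅e j, e k⁆⁆ - ⁅e j, ⁅e i, e k⁆⁆ := lie_lie _ _ _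
    -- Move `e k` to the left through both orders of `e i`, `e j`; the bracket terms that remain
    -- cancel by Jacobi.
    rw [defect, hz, hcomm _ _ _ (hγ (e j) (e k)), hcomm _ _ _ (hγ (e i) (e k)), map_add, map_add,
      hcomm _ _ _ (hmid i j (hkj.trans hij) hkj), hcomm _ _ _ (hmid j i hkj (hkj.trans hij)),
      hcomm _ _ _ (hγ ⁅e i, e j⁆ (e k)), hcomm _ _ _ (hγ (e i) (e j)),
      hcomm _ _ _ (hγ (e i) ⁅e j, e k⁆), hcomm _ _ _ (hγ (e j) ⁅e i, e k⁆), hjac, op_sub,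
      map_add]
    abel

theorem op_lie (x y : L) (s : (I →₀ ℕ) →₀ R) :
    op e ⁅x, y⁆ s = op e x (op e y s) - op e y (op e x s) := by
  have h : defect e x y s = 0 := by
    induction s using Finsupp.induction_linear with
    | zero => simp [defect]
    | add s t hs ht => rw [defect_add, hs, ht, add_zero]
    | single α f =>
      rw [← mul_one f, ← smul_eq_mul, ← smul_single, defect_smul, defect_single, smul_zero]
  rw [defect, sub_eq_zero] at h
  exact h.symm

end PBW

/-! ### The basis of ordered monomials in the enveloping algebra. -/

namespace UEnv

open MultiIndex Finsupp

variable {K R L : Type u} [Field K] [CommRing R] [Algebra K R] [LieRing L] [Module R L]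
  [LieRingModule L R] [LieRinehartRing R L] [LieAlgebra K L] [LieRinehartAlgebra K R L]
  {I : Type*} [LinearOrder I] [Fintype I] (e : Module.Basis I R L)

/-- `PBW.op` as a `K`-linear map. -/
def pbwOp (x : L) : Module.End K ((I →₀ ℕ) →₀ R) where
  toFun := PBW.op e x
  map_add' := map_add _
  map_smul' k s := by
    -- Derivations kill constants, so the Leibniz correction disappears for scalars in `K`.
    have h : ⁅x, algebraMap K R k⁆ = 0 := by
      have h0 : ⁅x, (1 : R)⁆ = 0 := by
        simpa using LieRinehartRing.leibniz_mul_right x (1 : R) 1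
      rw [Algebra.algebraMap_eq_smul_one]
      exact (LieModule.lie_smul k x (1 : R)).trans (by rw [h0, smul_zero])
    rw [← algebraMap_smul R k s, PBW.op_apply_smul, h, zero_smul, add_zero, algebraMap_smul]
    rfl

/-- The representation of `𝒰(R, L)` on the free module on the ordered monomials. -/
def pbwAct : UEnv K R L →ₐ[K] Module.End K ((I →₀ ℕ) →₀ R) :=
  lift K (Algebra.lsmul K K ((I →₀ ℕ) →₀ R))
    (AddMonoidHom.mk' (pbwOp e) (fun x y => LinearMap.ext fun s => PBW.op_add e x y s))
    (fun f x => by exact LinearMap.ext fun s => PBW.op_smul e f x s)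
    (fun x y => by exact LinearMap.ext fun s => PBW.op_lie e x y s)
    (fun x f => by exact LinearMap.ext fun s => PBW.op_apply_smul e x f s)

theorem pbwAct_ofLie (x : L) (s : (I →₀ ℕ) →₀ R) :
    pbwAct e (ofLie K R L x) s = PBW.op e x s := by
  rw [pbwAct, lift_ofLie]; rfl

theorem pbwAct_smul (f : R) (u : UEnv K R L) (s : (I →₀ ℕ) →₀ R) :
    pbwAct e (f • u) s = f • pbwAct e u s := by
  rw [pbwAct, lift_smul]; rfl

/-- The coordinates of `u` in the basis of ordered monomials. -/
def pbwCoord : UEnv K R L →ₗ[R] (I →₀ ℕ) →₀ R where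
  toFun u := pbwAct e u (single 0 1)
  map_add' u v := by simp
  map_smul' f u := pbwAct_smul e f u _

/-- The factors are applied from the largest variable to the smallest, so every step is the case of
the recursion without reordering. -/
theorem pbwCoord_mon (α : I →₀ ℕ) :
    pbwCoord e (mon (fun i => ofLie K R L (e i)) α) = single α 1 := by
  change pbwAct e _ _ = _
  induction α using below_induction with
  | h0 => simp [mon_zero]
  | hs j β h ih =>
    rw [mon_add_single _ h, map_mul, Module.End.mul_apply, ih, pbwAct_ofLie,
      PBW.op_basis_single_of_below e h]

variable (K) in
/-- The linear combination of ordered monomials with given coefficients. -/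
def pbwSum : ((I →₀ ℕ) →₀ R) →ₗ[R] UEnv K R L :=
  Finsupp.linearCombination R (mon fun i => ofLie K R L (e i))

theorem pbwSum_single (α : I →₀ ℕ) :
    pbwSum K e (single α 1) = mon (fun i => ofLie K R L (e i)) α := by simp [pbwSum]

/-- The reordering rule by which `act` was defined also holds in `𝒰(R, L)`, so the same induction on
the degree applies. It makes the span of the ordered monomials stable under left multiplication by
`L`. -/
theorem pbwSum_op_basis (i : I) (α : I →₀ ℕ) :
    pbwSum K e (PBW.op e (e i) (single α 1)) = ofLie K R L (e i) * pbwSum K e (single α 1) := by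
  induction hd : α.degree using Nat.strong_induction_on generalizing α i with
  | _ d ih =>
    subst hd
    by_cases h : Below i α
    · rw [PBW.op_basis_single_of_below e h, pbwSum_single, pbwSum_single, mon_add_single _ h]
    have h0 := ne_zero_of_not_below h
    have hji := minVar_lt h
    have hdeg := degree_sub_minVar α h0
    have hj := (minVar_below α h0).sub (single (minVar α h0) 1)
    have hα := sub_add_minVar α h0
    generalize minVar α h0 = j at hji hdeg hj hα
    generalize α - single j 1 = β at hdeg hj hα
    have hop : ∀ (x : L), pbwSum K e (PBW.op e x (single β 1))
        = ofLie K R L x * pbwSum K e (single β 1) := by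
      intro x
      have hx : x ∈ Submodule.span R (Set.range e) := by rw [e.span_eq]; trivial
      induction hx using Submodule.span_induction with
      | mem x hx => obtain ⟨k, rfl⟩ := hx; exact ih _ (by omega) k β rfl
      | zero => simp [PBW.op_apply]
      | add x y _ _ hx hy => rw [PBW.op_add, map_add, hx, hy, map_add, add_mul]
      | smul f x _ hx =>
        rw [PBW.op_smul, map_smul, hx, ofLie_smul, smul_def, mul_assoc]
    have hlow : ∀ s ∈ PBW.degLE R I β.degree, pbwSum K e (PBW.op e (e j) s)
        = ofLie K R L (e j) * pbwSum K e s := by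
      intro s hs
      refine PBW.degLE_induction (p := fun s => pbwSum K e (PBW.op e (e j) s)
        = ofLie K R L (e j) * pbwSum K e s) (by simp) ?_ ?_ hs
      · intro s t hs ht
        rw [map_add, map_add, hs, ht, map_add, mul_add]
      · intro γ f hγ
        rw [← mul_one f, ← smul_eq_mul, ← smul_single, PBW.op_apply_smul, map_add, map_smul,
          ih _ (by omega) j γ rfl, map_smul, map_smul, ofLie_mul_smul]
    -- Again split off the leading monomial `β + i`: `j` is below it, so no reordering occurs, and
    -- the remainder has degree at most `|β|`.
    have hstep : pbwSum K e (PBW.op e (e j) (PBW.op e (e i) (single β 1)))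
        = ofLie K R L (e j) * pbwSum K e (PBW.op e (e i) (single β 1)) := by
      have h2 : PBW.op e (e i) (single β 1)
          = single (β + single i 1) 1 + (PBW.act e i β - single (β + single i 1) 1) := by
        rw [PBW.op_basis_single]; abel
      have hb := hj.add_single hji.le
      rw [h2, map_add, map_add, hlow _ (PBW.act_sub_mem e i β),
        PBW.op_basis_single_of_below e hb, pbwSum_single, mon_add_single _ hb, map_add, mul_add,
        pbwSum_single]
    have hz : single α (1 : R) = PBW.op e (e j) (single β 1) := by
      rw [PBW.op_basis_single_of_below e hj, hα]
    rw [hz, PBW.op_comm_of_below e hji hj, map_add, hstep, hop, hop, hop, ofLie_lie]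
    simp only [sub_mul, mul_assoc]
    abel

theorem pbwSum_op (x : L) (s : (I →₀ ℕ) →₀ R) :
    pbwSum K e (PBW.op e x s) = ofLie K R L x * pbwSum K e s := by
  have hx : x ∈ Submodule.span R (Set.range e) := by rw [e.span_eq]; trivial
  induction hx using Submodule.span_induction with
  | mem x hx =>
    obtain ⟨i, rfl⟩ := hx
    induction s using Finsupp.induction_linear with
    | zero => simp
    | add s t hs ht => rw [map_add, map_add, hs, ht, map_add, mul_add]
    | single α f =>
      rw [← mul_one f, ← smul_eq_mul, ← smul_single, PBW.op_apply_smul, map_add, map_smul,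
        pbwSum_op_basis, map_smul, map_smul, ofLie_mul_smul]
  | zero => simp [PBW.op_apply]
  | add x y _ _ hx hy => rw [PBW.op_add, map_add, hx, hy, map_add, add_mul]
  | smul f x _ hx => rw [PBW.op_smul, map_smul, hx, ofLie_smul, smul_def, mul_assoc]

/-- The Poincaré-Birkhoff-Witt theorem: the ordered monomials in a basis of `L` are a basis
of `𝒰(R, L)`. -/
theorem pbwSum_bijective : Function.Bijective (pbwSum K e) := by
  constructor
  -- Independence: acting on the empty monomial recovers the coefficients.
  · have h : pbwCoord e ∘ₗ pbwSum K e = LinearMap.id :=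
      Finsupp.lhom_ext' fun α => LinearMap.ext_ring <| by
        simp [pbwSum, pbwCoord_mon]
    exact Function.LeftInverse.injective (g := pbwCoord e) (LinearMap.congr_fun h)
  -- Generation: the range contains `1` and is stable under `R` and under left multiplication by
  -- `L`.
  · intro u
    induction u using UEnv.induction with
    | h1 => exact ⟨single 0 1, by rw [pbwSum_single, mon_zero]⟩
    | hadd u v hu hv =>
      obtain ⟨s, rfl⟩ := hu
      obtain ⟨t, rfl⟩ := hv
      exact ⟨s + t, map_add _ _ _⟩
    | hfun f u hu =>
      obtain ⟨s, rfl⟩ := hu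
      exact ⟨f • s, map_smul _ _ _⟩
    | hlie x u hu =>
      obtain ⟨s, rfl⟩ := hu
      exact ⟨_, pbwSum_op e x s⟩

end UEnv

/-! ### Divided monomials in primitive elements -/

namespace RBialgebra

open MultiIndex Finsupp

/-- A family `b α` with `Δ(b α) = ∑ b β ⊗ b γ` over `β + γ = α`, like the divided monomials
`∏ eᵢ ^ αᵢ / αᵢ!` in primitive elements. -/
structure IsDividedFamily (R : Type u) {A : Type u} [CommRing R] [Ring A] [Module R A]
    [Coalgebra R A] {I : Type*} [DecidableEq I] (b : (I →₀ ℕ) → A) : Prop where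
  zero : b 0 = 1
  counit : ∀ α, Coalgebra.counit (R := R) (b α) = if α = 0 then 1 else 0
  comul : ∀ α, Coalgebra.comul (R := R) (b α)
    = ∑ p ∈ Finset.HasAntidiagonal.antidiagonal α, b p.1 ⊗ₜ[R] b p.2

variable {I : Type*} [LinearOrder I] [Fintype I]

/-- `α! = ∏ αᵢ!`. -/
def multiFactorial (α : I →₀ ℕ) : ℕ := ∏ i, (α i).factorial

theorem multiFactorial_ne_zero (α : I →₀ ℕ) : multiFactorial α ≠ 0 :=
  Finset.prod_ne_zero_iff.2 fun _ _ => Nat.factorial_ne_zero _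

theorem multiFactorial_add_single (β : I →₀ ℕ) (j : I) :
    multiFactorial (β + single j 1) = (β j + 1) * multiFactorial β := by
  simp only [multiFactorial]
  rw [← Finset.mul_prod_erase _ _ (Finset.mem_univ j),
    ← Finset.mul_prod_erase _ (fun i => (β i).factorial) (Finset.mem_univ j), ← mul_assoc]
  congr 1
  · simp [Nat.factorial_succ]
  · refine Finset.prod_congr rfl fun i hi => ?_
    simp [(Finset.ne_of_mem_erase hi).symm]

variable (K : Type u) [Field K] [CharZero K]

section

variable {A : Type*} [Ring A] [Algebra K A]

/-- The divided monomial `∏ eᵢ ^ αᵢ / αᵢ!`. -/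
def divMon (e : I → A) (α : I →₀ ℕ) : A := (multiFactorial α : K)⁻¹ • mon e α

theorem divMon_zero (e : I → A) : divMon K e 0 = 1 := by
  simp [divMon, mon_zero, multiFactorial]

theorem divMon_single (e : I → A) (j : I) : divMon K e (single j 1) = e j := by
  have h := multiFactorial_add_single 0 j
  simp only [zero_add, coe_zero, Pi.zero_apply, one_mul] at h
  rw [divMon, mon_single, h]
  simp [multiFactorial]

/-- The factor is `(β + j)! / β!`. Minimality of `j` spares any reordering in the noncommutative
ring `A`. -/
theorem mul_divMon (e : I → A) {j : I} {β : I →₀ ℕ} (h : Below j β) :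
    e j * divMon K e β = ((β j + 1 : ℕ) : K) • divMon K e (β + single j 1) := by
  have h1 : ((β j + 1 : ℕ) : K) ≠ 0 := Nat.cast_ne_zero.2 (Nat.succ_ne_zero _)
  rw [divMon, divMon, mon_add_single _ h, multiFactorial_add_single, smul_smul, mul_smul_comm,
    Nat.cast_mul, mul_inv, ← mul_assoc, mul_inv_cancel₀ h1, one_mul]

theorem map_divMon {B : Type*} [Ring B] [Algebra K B] (f : A →ₐ[K] B) (e : I → A) (α : I →₀ ℕ) :
    f (divMon K e α) = divMon K (fun i => f (e i)) α := by
  rw [divMon, map_smul, divMon]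
  exact congrArg _ (map_mon (f : A →* B) e α)

end

/-- Decompositions of `β + j` whose first part contains `j` come from those of `β` by adding `j` to
the first part; all others have weight zero. -/
theorem sum_antidiagonal_add_single {M : Type*} [AddCommGroup M] [Module K M] (β : I →₀ ℕ) (j : I)
    (f : (I →₀ ℕ) → (I →₀ ℕ) → M) :
    ∑ q ∈ Finset.HasAntidiagonal.antidiagonal (A := I →₀ ℕ) (β + single j 1), ((q.1 j : ℕ) : K) • f q.1 q.2
      = ∑ p ∈ Finset.HasAntidiagonal.antidiagonal β, ((p.1 j + 1 : ℕ) : K) • f (p.1 + single j 1) p.2 := by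
  symm
  refine Finset.sum_of_injOn (fun p => (p.1 + single j 1, p.2)) ?_ ?_ ?_ ?_
  · rintro ⟨a, b⟩ _ ⟨c, d⟩ _ h
    simpa using h
  · rintro ⟨a, b⟩ h
    simp only [Finset.mem_coe, Finset.HasAntidiagonal.mem_antidiagonal] at h ⊢
    rw [← h, add_right_comm]
  · rintro ⟨a, b⟩ h hn
    have : a j = 0 := by
      by_contra hc
      have hle : single j 1 ≤ a := by
        rw [Finsupp.single_le_iff]; exact Nat.one_le_iff_ne_zero.2 hc
      refine hn ⟨(a - single j 1, b), ?_, ?_⟩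
      · simp only [Finset.mem_coe, Finset.HasAntidiagonal.mem_antidiagonal] at h ⊢
        rw [← add_right_cancel_iff (a := single j 1), ← h, add_right_comm, tsub_add_cancel_of_le hle]
      · simp [tsub_add_cancel_of_le hle]
    simp [this]
  · rintro ⟨a, b⟩ _
    simp

theorem sum_antidiagonal_add_single' {M : Type*} [AddCommGroup M] [Module K M] (β : I →₀ ℕ) (j : I)
    (f : (I →₀ ℕ) → (I →₀ ℕ) → M) :
    ∑ q ∈ Finset.HasAntidiagonal.antidiagonal (A := I →₀ ℕ) (β + single j 1), ((q.2 j : ℕ) : K) • f q.1 q.2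
      = ∑ p ∈ Finset.HasAntidiagonal.antidiagonal β, ((p.2 j + 1 : ℕ) : K) • f p.1 (p.2 + single j 1) := by
  have h := sum_antidiagonal_add_single K β j fun a b => f b a
  refine (Finsupp.sum_antidiagonal_swap _ fun a b => ((b j : ℕ) : K) • f a b).trans (h.trans ?_)
  exact (Finsupp.sum_antidiagonal_swap β
    fun a b => ((b j + 1 : ℕ) : K) • f a (b + single j 1)).symm

variable {R A : Type u} [CommRing R] [Ring A] [Module R A] [IsScalarTower R A A]
  [Coalgebra R A] [IsBialgebra R A] [Algebra K R] [Algebra K A] [IsScalarTower K R A]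

theorem below_of_mem_antidiagonal {j : I} {β : I →₀ ℕ} (h : Below j β)
    {p : (I →₀ ℕ) × (I →₀ ℕ)} (hp : p ∈ Finset.HasAntidiagonal.antidiagonal β) : Below j p.1 ∧ Below j p.2 := by
  rw [Finset.HasAntidiagonal.mem_antidiagonal] at hp
  constructor <;> intro k hk <;> refine h k ?_ <;> rw [← hp] <;>
    simp only [Finsupp.mem_support_iff, Finsupp.add_apply] at hk ⊢ <;> omega

/-- A binomial formula, built up by multiplying on the left with the smallest variable: `Δ(e j) = e
j ⊗ 1 + 1 ⊗ e j`, and `j` is below both parts of any decomposition of `β`, so each tensor factor is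
again an ordered monomial. -/
theorem isDividedFamily_divMon {e : I → A} (he : ∀ i, e i ∈ primFilt R A 1) :
    IsDividedFamily R (divMon K e) where
  zero := divMon_zero K e
  counit α := by
    induction α using below_induction with
    | h0 => simp [divMon_zero, IsBialgebra.counit_one]
    | hs j β h ih =>
      have h1 : ((β j + 1 : ℕ) : K) ≠ 0 := Nat.cast_ne_zero.2 (Nat.succ_ne_zero _)
      have h2 := congrArg (fun a => ((β j + 1 : ℕ) : K)⁻¹ • Coalgebra.counit (R := R) a)
        (mul_divMon K e h)
      simp only [LinearMap.map_smul_of_tower, smul_smul, inv_mul_cancel₀ h1, one_smul] at h2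
      -- `ε(e j * u)` depends on `u` only through `ε(u)`, here `1` or `0`, and `ε(e j) = 0`.
      rw [← h2, IsBialgebra.counit_mul, ih, if_neg (add_single_ne_zero j β)]
      split
      · simp [(mem_primFilt_one.1 (he j)).1]
      · simp
  comul α := by
    induction α using below_induction with
    | h0 => simp [divMon_zero, IsBialgebra.comul_one]
    | hs j β h ih =>
      have h1 : ((β j + 1 : ℕ) : K) ≠ 0 := Nat.cast_ne_zero.2 (Nat.succ_ne_zero _)
      have h2 := congrArg (Coalgebra.comul (R := R)) (mul_divMon K e h)
      rw [LinearMap.map_smul_of_tower, IsBialgebra.comul_mul, ih, map_sum] at h2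
      rw [← inv_smul_smul₀ h1 (Coalgebra.comul _), ← h2, inv_smul_eq_iff₀ h1]
      have h3 := sum_antidiagonal_add_single K β j fun a b => divMon K e a ⊗ₜ[R] divMon K e b
      have h4 := sum_antidiagonal_add_single' K β j fun a b => divMon K e a ⊗ₜ[R] divMon K e b
      -- For a decomposition `q` of `β + j` the factor is `β j + 1 = q.1 j + q.2 j`. The two halves
      -- match the contributions of `e j ⊗ 1` and `1 ⊗ e j`.
      have h5 : ((β j + 1 : ℕ) : K) • ∑ p ∈ Finset.HasAntidiagonal.antidiagonal (β + single j 1),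
            divMon K e p.1 ⊗ₜ[R] divMon K e p.2
          = ∑ q ∈ Finset.HasAntidiagonal.antidiagonal (A := I →₀ ℕ) (β + single j 1),
              (((q.1 j : ℕ) : K) • (divMon K e q.1 ⊗ₜ[R] divMon K e q.2)
                + ((q.2 j : ℕ) : K) • (divMon K e q.1 ⊗ₜ[R] divMon K e q.2)) := by
        rw [Finset.smul_sum]
        refine Finset.sum_congr rfl fun q hq => ?_
        rw [← add_smul, ← Nat.cast_add, ← Finsupp.add_apply, Finset.HasAntidiagonal.mem_antidiagonal.1 hq]
        simp
      rw [h5, Finset.sum_add_distrib, h3, h4, ← Finset.sum_add_distrib]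
      refine Finset.sum_congr rfl fun p hp => ?_
      obtain ⟨b1, b2⟩ := below_of_mem_antidiagonal h hp
      rw [takeuchiMul_primitive (he j), mul_divMon K e b1, mul_divMon K e b2,
        ← TensorProduct.smul_tmul', TensorProduct.tmul_smul]

end RBialgebra

/-! ### The primitive filtration of a coalgebra with divided monomials -/

namespace RBialgebra

open MultiIndex Finsupp

/-! ### Coefficients of tensors over free modules. -/

section Coefficients

variable {R : Type*} [CommRing R] {J J' : Type*}

/-- The coefficient at `(β, γ)` of a tensor of finitely supported functions. -/
def coef (β : J) (γ : J') : (J →₀ R) ⊗[R] (J' →₀ R) →ₗ[R] R :=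
  TensorProduct.lid R R ∘ₗ TensorProduct.map (lapply β) (lapply γ)

@[simp] theorem coef_tmul (β : J) (γ : J') (f : J →₀ R) (g : J' →₀ R) :
    coef β γ (f ⊗ₜ[R] g) = f β * g γ := by simp [coef]

theorem finsuppTensorFinsupp'_eq_coef (t : (J →₀ R) ⊗[R] (J' →₀ R)) (β : J) (γ : J') :
    finsuppTensorFinsupp' R J J' t (β, γ) = coef β γ t := by
  induction t using TensorProduct.induction_on with
  | zero => simp
  | tmul f g => simp
  | add s t hs ht => simp only [map_add, Finsupp.add_apply, hs, ht]

theorem coef_ext {s t : (J →₀ R) ⊗[R] (J' →₀ R)} (h : ∀ β γ, coef β γ s = coef β γ t) :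
    s = t := by
  apply (finsuppTensorFinsupp' R J J').injective
  ext ⟨β, γ⟩
  rw [finsuppTensorFinsupp'_eq_coef, finsuppTensorFinsupp'_eq_coef, h]

theorem coef_comm (β : J) (γ : J') (t : (J →₀ R) ⊗[R] (J' →₀ R)) :
    coef γ β (TensorProduct.comm R _ _ t) = coef β γ t := by
  induction t using TensorProduct.induction_on with
  | zero => simp
  | tmul f g => simp [mul_comm]
  | add s t hs ht => simp only [map_add, hs, ht]

theorem coef_map_truncate {P : J → Prop} [DecidablePred P] {f : (J →₀ R) →ₗ[R] (J →₀ R)}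
    (hf : ∀ x α, f x α = if P α then x α else 0) (t : (J →₀ R) ⊗[R] (J →₀ R)) (β γ : J) :
    coef β γ (TensorProduct.map f f t) = if P β ∧ P γ then coef β γ t else 0 := by
  induction t using TensorProduct.induction_on with
  | zero => simp
  | tmul x y =>
    rw [TensorProduct.map_tmul, coef_tmul, hf, hf, coef_tmul, ite_and]
    split <;> split <;> simp
  | add x y hx hy =>
    rw [map_add, map_add, map_add, hx, hy]
    split <;> simp

variable {M N : Type*} [AddCommGroup M] [Module R M] [AddCommGroup N] [Module R N]

/-- The coefficient at `γ` of a tensor in `M ⊗ R^(J)`. -/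
def coefRight (γ : J) : M ⊗[R] (J →₀ R) →ₗ[R] M :=
  TensorProduct.rid R M ∘ₗ LinearMap.lTensor M (lapply γ)

@[simp] theorem coefRight_tmul (γ : J) (m : M) (f : J →₀ R) :
    coefRight γ (m ⊗ₜ[R] f) = f γ • m := by simp [coefRight]

theorem coefRight_rTensor (γ : J) (f : M →ₗ[R] N) (t : M ⊗[R] (J →₀ R)) :
    coefRight γ (f.rTensor _ t) = f (coefRight γ t) := by
  induction t using TensorProduct.induction_on with
  | zero => simp
  | tmul m g => simp
  | add s t hs ht => simp only [map_add, hs, ht]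

theorem coefRight_apply (β : J) (γ : J') (t : (J →₀ R) ⊗[R] (J' →₀ R)) :
    coefRight γ t β = coef β γ t := by
  induction t using TensorProduct.induction_on with
  | zero => simp
  | tmul f g => simp [mul_comm]
  | add s t hs ht => simp only [map_add, Finsupp.add_apply, hs, ht]

end Coefficients

/-! ### Iterated reduced coproducts. -/

section Iter

variable {R A : Type u} [CommRing R] [Ring A] [Module R A] [Coalgebra R A]

theorem redComul_apply (a : A) :
    redComul R A a = Coalgebra.comul (R := R) a - (a ⊗ₜ 1 + 1 ⊗ₜ a) := rfl

theorem iterRedComul_succ (n : ℕ) (a : A) : (iterRedComul R A (n + 1)).2 a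
    = LinearMap.rTensor A (iterRedComul R A n).2 (redComul R A a) := rfl

instance flat_iterRedComul [Module.Flat R A] (n : ℕ) :
    Module.Flat R (iterRedComul R A n).1 := by
  induction n with
  | zero => exact inferInstanceAs (Module.Flat R A)
  | succ n ih =>
    exact inferInstanceAs (Module.Flat R ((iterRedComul R A n).1 ⊗[R] A))

theorem comm_redComul [Coalgebra.IsCocomm R A] (a : A) :
    TensorProduct.comm R A A (redComul R A a) = redComul R A a := by
  simp [redComul_apply, add_comm]

/-- The recursion applies `Δ̄⁽ⁿ⁾` to the left factor of `Δ̄ a`; cocommutativity transfers the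
vanishing to the right factor. -/
theorem lTensor_iterRedComul [Coalgebra.IsCocomm R A] (n : ℕ) (a : A)
    (h : (iterRedComul R A (n + 1)).2 a = 0) :
    LinearMap.lTensor A (iterRedComul R A n).2 (redComul R A a) = 0 := by
  rw [iterRedComul_succ, ← comm_redComul a, LinearMap.rTensor, TensorProduct.map_comm] at h
  exact (LinearEquiv.map_eq_zero_iff _).1 h

theorem counit_redComul (h1 : Coalgebra.counit (R := R) (1 : A) = 1) (a : A) :
    TensorProduct.lid R A (LinearMap.rTensor A (Coalgebra.counit (R := R)) (redComul R A a))
      = -(Coalgebra.counit (R := R) a • (1 : A)) := by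
  simp [redComul_apply, h1]

/-- Since `(ε ⊗ id) Δ̄ a = -ε(a) • 1`, the counit can be recovered from each iterate. Hence `Δ̄⁽ⁿ⁾ a
= 0` already forces `ε(a) = 0`, and membership in the filtration is one equation. -/
theorem exists_comp_iterRedComul (h1 : Coalgebra.counit (R := R) (1 : A) = 1) (n : ℕ) :
    ∃ f : (iterRedComul R A n).1 →ₗ[R] R, ∀ a,
      f ((iterRedComul R A n).2 a) = Coalgebra.counit (R := R) a := by
  induction n with
  | zero => exact ⟨Coalgebra.counit (R := R) (A := A), fun a => rfl⟩
  | succ n ih =>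
    obtain ⟨f, hf⟩ := ih
    have hf' : f ∘ₗ (iterRedComul R A n).2 = Coalgebra.counit (R := R) (A := A) :=
      LinearMap.ext hf
    refine ⟨-(Coalgebra.counit (R := R) (A := A) ∘ₗ TensorProduct.lid R A ∘ₗ
      LinearMap.rTensor A f), fun a => ?_⟩
    change -(Coalgebra.counit (R := R) (TensorProduct.lid R A (LinearMap.rTensor A f
      (LinearMap.rTensor A (iterRedComul R A n).2 (redComul R A a))))) = _
    have h2 : LinearMap.rTensor A f (LinearMap.rTensor A (iterRedComul R A n).2 (redComul R A a))
        = LinearMap.rTensor A (Coalgebra.counit (R := R)) (redComul R A a) := by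
      rw [← LinearMap.rTensor_comp_apply, hf']
    rw [h2, counit_redComul h1]
    simp [h1]

theorem mem_primFilt_iff (h1 : Coalgebra.counit (R := R) (1 : A) = 1) {n : ℕ} {a : A} :
    a ∈ primFilt R A n ↔ (iterRedComul R A n).2 a = 0 := by
  refine ⟨fun h => h.2, fun h => ⟨?_, h⟩⟩
  obtain ⟨f, hf⟩ := exists_comp_iterRedComul h1 n
  change Coalgebra.counit (R := R) a = 0
  rw [← hf, h, map_zero]

theorem mem_primFilt_one_iff (h1 : Coalgebra.counit (R := R) (1 : A) = 1) {a : A} :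
    a ∈ primFilt R A 1 ↔ redComul R A a = 0 := by
  rw [mem_primFilt_iff h1, iterRedComul_succ]
  change LinearMap.rTensor A LinearMap.id (redComul R A a) = 0 ↔ _
  rw [LinearMap.rTensor_id, LinearMap.id_apply]

/-- The terms containing `1` match on both sides because `1` is group-like; this holds on all of
`A`, not only on the kernel of `ε`. -/
theorem coassoc_redComul (h1 : Coalgebra.comul (R := R) (1 : A) = 1 ⊗ₜ 1) (a : A) :
    TensorProduct.assoc R A A A (LinearMap.rTensor A (redComul R A) (redComul R A a))
      = LinearMap.lTensor A (redComul R A) (redComul R A a) := by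
  have hr : ∀ t : A ⊗[R] A, TensorProduct.assoc R A A A (LinearMap.rTensor A (redComul R A) t)
      = TensorProduct.assoc R A A A (LinearMap.rTensor A Coalgebra.comul t)
        - LinearMap.lTensor A (TensorProduct.mk R A A 1) t - 1 ⊗ₜ t := by
    intro t
    induction t using TensorProduct.induction_on with
    | zero => simp
    | tmul b c =>
      simp [redComul_apply, TensorProduct.sub_tmul, TensorProduct.add_tmul]; abel
    | add s t hs ht => simp only [map_add, hs, ht, TensorProduct.tmul_add]; abel
  have hl : ∀ t : A ⊗[R] A, LinearMap.lTensor A (redComul R A) t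
      = LinearMap.lTensor A Coalgebra.comul t
        - TensorProduct.assoc R A A A (t ⊗ₜ 1) - LinearMap.lTensor A (TensorProduct.mk R A A 1) t := by
    intro t
    induction t using TensorProduct.induction_on with
    | zero => simp
    | tmul b c =>
      simp [redComul_apply, TensorProduct.tmul_sub, TensorProduct.tmul_add]; abel
    | add s t hs ht => simp only [map_add, hs, ht, TensorProduct.add_tmul]; abel
  rw [hr, hl, redComul_apply]
  simp only [map_sub, map_add, LinearMap.rTensor_tmul, LinearMap.lTensor_tmul,
    Coalgebra.coassoc_apply, h1, TensorProduct.tmul_sub, TensorProduct.tmul_add,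
    TensorProduct.sub_tmul, TensorProduct.add_tmul, TensorProduct.assoc_tmul,
    TensorProduct.mk_apply]
  abel

end Iter

/-! ### Divided families: position in the filtration, independence and generation. -/

section Family

variable {I : Type*} [DecidableEq I]

section

variable (R : Type*) [CommRing R]

variable (I) in
/-- The reduced comultiplication of the coalgebra of divided monomials. -/
def redDiv : ((I →₀ ℕ) →₀ R) →ₗ[R] ((I →₀ ℕ) →₀ R) ⊗[R] ((I →₀ ℕ) →₀ R) :=
  Finsupp.linearCombination R fun α =>
    (∑ p ∈ Finset.HasAntidiagonal.antidiagonal α, single p.1 (1 : R) ⊗ₜ[R] single p.2 (1 : R))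
      - (single α (1 : R) ⊗ₜ single 0 (1 : R) + single 0 (1 : R) ⊗ₜ single α (1 : R))

variable {R}

/-- Away from zero indices the coefficient at `(β, γ)` is `c (β + γ)`: the reduced coproduct reads
off all coefficients of degree at least two. -/
theorem coef_redDiv (c : (I →₀ ℕ) →₀ R) (β γ : I →₀ ℕ) :
    coef β γ (redDiv I R c)
      = c (β + γ) - ((if γ = 0 then c β else 0) + if β = 0 then c γ else 0) := by
  induction c using Finsupp.induction_linear with
  | zero => simp
  | add c d hc hd =>
    rw [map_add, map_add, hc, hd]
    simp only [Finsupp.add_apply]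
    split <;> split <;> ring
  | single α r =>
    have h : ∀ p : (I →₀ ℕ) × (I →₀ ℕ),
        coef β γ (single p.1 (1 : R) ⊗ₜ[R] single p.2 (1 : R)) = if (β, γ) = p then 1 else 0 := by
      rintro ⟨a, b⟩
      simp only [coef_tmul, single_apply, Prod.mk.injEq, eq_comm (a := β), eq_comm (a := γ)]
      split <;> split <;> simp_all
    have h1 := h (α, 0)
    have h2 := h (0, α)
    simp only [redDiv, linearCombination_single, map_smul, map_sub, map_add, map_sum, smul_eq_mul]
    simp only [Prod.mk.injEq] at h1 h2
    rw [h1, h2, Finset.sum_congr rfl fun p _ => h p, Finset.sum_ite_eq]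
    simp only [Finset.HasAntidiagonal.mem_antidiagonal, single_apply, eq_comm (b := α)]
    by_cases hβ : β = 0 <;> by_cases hγ : γ = 0 <;> simp [hβ, hγ]

theorem coef_redDiv_of_ne (c : (I →₀ ℕ) →₀ R) {β γ : I →₀ ℕ} (hβ : β ≠ 0) (hγ : γ ≠ 0) :
    coef β γ (redDiv I R c) = c (β + γ) := by simp [coef_redDiv, hβ, hγ]

end

variable {R A : Type u} [CommRing R] [Ring A] [Module R A] [Coalgebra R A] {b : (I →₀ ℕ) → A}

namespace IsDividedFamily

variable (hb : IsDividedFamily R b)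
include hb

theorem counit_one : Coalgebra.counit (R := R) (1 : A) = 1 := by
  rw [← hb.zero, hb.counit, if_pos rfl]

theorem comul_one : Coalgebra.comul (R := R) (1 : A) = 1 ⊗ₜ 1 := by
  rw [← hb.zero, hb.comul]; simp

theorem redComul_linearCombination (c : (I →₀ ℕ) →₀ R) :
    redComul R A (Finsupp.linearCombination R b c)
      = TensorProduct.map (Finsupp.linearCombination R b) (Finsupp.linearCombination R b)
          (redDiv I R c) := by
  suffices h : redComul R A ∘ₗ Finsupp.linearCombination R b
      = TensorProduct.map (Finsupp.linearCombination R b) (Finsupp.linearCombination R b)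
        ∘ₗ redDiv I R from LinearMap.congr_fun h c
  refine Finsupp.lhom_ext' fun α => LinearMap.ext_ring ?_
  simp [redDiv, redComul_apply, hb.comul, hb.zero]

theorem counit_linearCombination (c : (I →₀ ℕ) →₀ R) :
    Coalgebra.counit (R := R) (Finsupp.linearCombination R b c) = c 0 := by
  suffices h : Coalgebra.counit (R := R) ∘ₗ Finsupp.linearCombination R b = lapply 0 from
    LinearMap.congr_fun h c
  refine Finsupp.lhom_ext' fun α => LinearMap.ext_ring ?_
  simp [hb.counit, single_apply]

/-- Subtracting `b α ⊗ 1 + 1 ⊗ b α` leaves the decompositions of `α` into two nonzero parts, so the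
degree of the left part drops at each iteration. -/
theorem mem_primFilt {α : I →₀ ℕ} (h0 : α ≠ 0) {n : ℕ} (hn : α.degree ≤ n) :
    b α ∈ primFilt R A n := by
  rw [mem_primFilt_iff hb.counit_one]
  induction n generalizing α with
  | zero => exact absurd ((Finsupp.degree_eq_zero_iff α).1 (by omega)) h0
  | succ n ih =>
    rw [iterRedComul_succ, redComul_apply, hb.comul]
    have h2 : ∑ p ∈ Finset.HasAntidiagonal.antidiagonal α, b p.1 ⊗ₜ[R] b p.2
        = ∑ p ∈ ((Finset.HasAntidiagonal.antidiagonal α).erase (α, 0)).erase (0, α),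
          b p.1 ⊗ₜ[R] b p.2 + (b α ⊗ₜ 1 + 1 ⊗ₜ b α) := by
      rw [← Finset.sum_erase_add _ _ (show (α, 0) ∈ Finset.HasAntidiagonal.antidiagonal α by simp),
        ← Finset.sum_erase_add (a := (0, α)) _ _ (by simp [Ne.symm h0]), hb.zero]
      abel
    rw [h2, add_sub_cancel_right, map_sum]
    refine Finset.sum_eq_zero fun p hp => ?_
    simp only [Finset.mem_erase, Finset.HasAntidiagonal.mem_antidiagonal] at hp
    obtain ⟨h3, h4, rfl⟩ := hp
    have h5 : p.1 ≠ 0 := fun h => h3 (Prod.ext h (by simp [h]))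
    have h6 : p.2 ≠ 0 := fun h => h4 (Prod.ext (by simp [h]) h)
    have h7 : p.2.degree ≠ 0 := fun h => h6 ((Finsupp.degree_eq_zero_iff _).1 h)
    rw [LinearMap.rTensor_tmul, ih h5 (by rw [map_add] at hn; omega), TensorProduct.zero_tmul]
    rfl

/-- Converse of `mem_primFilt`. In `Δ̄⁽ⁿ⁺¹⁾` of the combination the last tensor factor is expanded
in the family. Flatness allows taking its coefficient at a single variable `i`, which is `Δ̄⁽ⁿ⁾` of
a combination with coefficient `c (β + i)` at each `β ≠ 0`; induction applies. -/
theorem coeff_eq_zero [Module.Flat R A] (hinj : Function.Injective (Finsupp.linearCombination R b))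
    {n : ℕ} {c : (I →₀ ℕ) →₀ R} (hc : Finsupp.linearCombination R b c ∈ primFilt R A n)
    {α : I →₀ ℕ} (hα : c α ≠ 0) : α ≠ 0 ∧ α.degree ≤ n := by
  refine ⟨?_, ?_⟩
  · rintro rfl
    exact hα ((hb.counit_linearCombination c).symm.trans hc.1)
  rw [mem_primFilt_iff hb.counit_one] at hc
  by_contra! hn
  refine hα ?_
  clear hα
  induction n generalizing c α with
  | zero =>
    have : c = 0 := hinj (by rw [map_zero]; exact hc)
    simp [this]
  | succ n ih =>
    have h0 : α ≠ 0 := by rintro rfl; simp at hn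
    obtain ⟨i, β, rfl⟩ := exists_eq_add_single_of_ne_zero h0
    have hβ : n < β.degree := by simpa using hn
    have hβ0 : β ≠ 0 := by rintro rfl; simp at hβ
    have hi0 : single i 1 ≠ 0 := by simp
    rw [← coef_redDiv_of_ne c hβ0 hi0, ← coefRight_apply]
    refine ih ?_ hβ
    have h2 : LinearMap.rTensor _ ((iterRedComul R A n).2 ∘ₗ Finsupp.linearCombination R b)
        (redDiv I R c) = 0 := by
      -- The target of `Δ̄⁽ⁿ⁾` is a tensor power of the flat module `A`, so the family may be
      -- cancelled in the last factor.
      apply Module.Flat.lTensor_preserves_injective_linearMap (M := (iterRedComul R A n).1) _ hinj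
      have hc' : LinearMap.rTensor A (iterRedComul R A n).2
        (redComul R A (Finsupp.linearCombination R b c)) = 0 := hc
      rw [map_zero, ← hc', hb.redComul_linearCombination]
      simp only [LinearMap.rTensor, LinearMap.lTensor, TensorProduct.map_map]
      rfl
    have h3 := congrArg (coefRight (single i 1)) h2
    rw [coefRight_rTensor, map_zero] at h3
    exact h3

/-- Induction on a bound for the degrees. The reduced coproduct of a relation in degree at most `m +
1` involves only pairs of indices of degree at most `m`, where the family is independent by
induction. So it vanishes already in the model, leaving a relation among the degree-one members. -/
theorem linearCombination_injective [Module.Flat R A]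
    (hlin : LinearIndependent R fun i => b (single i 1)) :
    Function.Injective (Finsupp.linearCombination R b) := by
  rw [injective_iff_map_eq_zero]
  suffices H : ∀ (m : ℕ) (c : (I →₀ ℕ) →₀ R), (∀ α, c α ≠ 0 → α.degree ≤ m) →
      Finsupp.linearCombination R b c = 0 → c = 0 from fun c hc =>
    H (c.support.sup Finsupp.degree) c (fun α hα => Finset.le_sup (by simpa using hα)) hc
  intro m
  induction m with
  | zero =>
    intro c hm hc
    have h0 := hb.counit_linearCombination c
    rw [hc, map_zero] at h0
    ext α
    by_contra hα
    have := (Finsupp.degree_eq_zero_iff α).1 (Nat.le_zero.1 (hm α hα))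
    subst this
    exact hα h0.symm
  | succ m ih =>
    intro c hm hc
    have h0 := hb.counit_linearCombination c
    rw [hc, map_zero] at h0
    let s : Set (I →₀ ℕ) := {α | α.degree ≤ m}
    let g := Finsupp.linearCombination R b
    let ι := Finsupp.lmapDomain R R (Subtype.val : s → I →₀ ℕ)
    let π : ((I →₀ ℕ) →₀ R) →ₗ[R] (s →₀ R) :=
      Finsupp.lcomapDomain Subtype.val Subtype.val_injective
    have hι : ∀ (x : s →₀ R) (α : s), ι x α.1 = x α := fun x α =>
      Finsupp.mapDomain_apply Subtype.val_injective x α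
    have hg : Function.Injective (g ∘ₗ ι) := by
      rw [injective_iff_map_eq_zero]
      intro x hx
      have h1 : ι x = 0 := ih (ι x) (fun α hα => by
        by_contra hn
        refine hα (Finsupp.mapDomain_of_notMem_range _ _ ?_)
        rintro ⟨y, rfl⟩
        exact hn y.2) hx
      ext α
      rw [← hι, h1]; rfl
    -- Truncation to degree at most `m` in both factors loses nothing: a pair of nonzero indices has
    -- total degree at most `m + 1`, and pairs with exactly one zero index have coefficient `0`
    -- because `c 0 = 0`.
    have hred : TensorProduct.map ι ι (TensorProduct.map π π (redDiv I R c)) = redDiv I R c := by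
      have hιπ : ∀ (x : (I →₀ ℕ) →₀ R) (α : I →₀ ℕ),
          (ι ∘ₗ π) x α = if α.degree ≤ m then x α else 0 := by
        intro x α
        split
        · exact hι (π x) ⟨α, ‹_›⟩
        · refine Finsupp.mapDomain_of_notMem_range _ _ ?_
          rintro ⟨y, rfl⟩
          exact ‹¬ _› y.2
      refine coef_ext fun β γ => ?_
      rw [TensorProduct.map_map, coef_map_truncate hιπ, ite_eq_left_iff]
      intro hn
      rw [coef_redDiv]
      by_cases hβ : β = 0
      · subst hβ
        by_cases hγ : γ = 0
        · subst hγ; simp at hn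
        · simp [hγ]
      · by_cases hγ : γ = 0
        · subst hγ; simp [hβ]
        · have h1 : β.degree ≠ 0 := fun h => hβ ((Finsupp.degree_eq_zero_iff _).1 h)
          have h2 : γ.degree ≠ 0 := fun h => hγ ((Finsupp.degree_eq_zero_iff _).1 h)
          simp only [hβ, hγ, if_false, add_zero, sub_zero]
          by_contra h3
          have h4 := hm _ (Ne.symm h3)
          rw [map_add] at h4
          omega
    have hzero : redDiv I R c = 0 := by
      rw [← hred]
      have h1 : TensorProduct.map (g ∘ₗ ι) (g ∘ₗ ι) (TensorProduct.map π π (redDiv I R c)) = 0 := by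
        rw [TensorProduct.map_comp, LinearMap.comp_apply, hred, ← hb.redComul_linearCombination, hc,
          map_zero]
      have h2 := TensorProduct.map_injective_of_flat_flat _ _ hg hg (h1.trans (map_zero _).symm)
      rw [h2, map_zero]
    -- An index of degree at least two splits into two nonzero parts, so its coefficient is one of
    -- those of `redDiv I R c = 0`.
    have hsupp : ∀ α, c α ≠ 0 → α ∈ Set.range fun i : I => single i 1 := by
      intro α hα
      have hα0 : α ≠ 0 := by rintro rfl; exact hα h0.symm
      obtain ⟨i, β, rfl⟩ := exists_eq_add_single_of_ne_zero hα0
      by_cases hβ : β = 0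
      · exact ⟨i, by simp [hβ]⟩
      · refine absurd ?_ hα
        rw [← coef_redDiv_of_ne c hβ (by simp), hzero, map_zero]
    have hinj : Function.Injective fun i : I => single i 1 :=
      Finsupp.single_left_injective one_ne_zero
    have h1 : mapDomain (fun i : I => single i 1) (comapDomain (fun i : I => single i 1) c
        hinj.injOn) = c :=
      Finsupp.mapDomain_comapDomain _ hinj c fun α hα => hsupp α (by simpa using hα)
    rw [← h1, Finsupp.linearCombination_mapDomain] at hc
    rw [← h1, (linearIndependent_iff.1 hlin) _ hc]
    simp

/-- A symmetric cocycle is a coboundary. Flatness transports cocommutativity and coassociativity of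
`Δ̄ a` to `τ`; together they make the coefficient of `τ` at nonzero `(β, γ)` depend on `β + γ`
alone, and that function is `d`. -/
theorem exists_redDiv_eq [Module.Flat R A] [Coalgebra.IsCocomm R A]
    (hinj : Function.Injective (Finsupp.linearCombination R b)) {a : A}
    (ha : Coalgebra.counit (R := R) a = 0) {τ : ((I →₀ ℕ) →₀ R) ⊗[R] ((I →₀ ℕ) →₀ R)}
    (hτ : TensorProduct.map (Finsupp.linearCombination R b) (Finsupp.linearCombination R b) τ
      = redComul R A a) :
    ∃ d : (I →₀ ℕ) →₀ R, d 0 = 0 ∧ redDiv I R d = τ := by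
  set g := Finsupp.linearCombination R b with hg
  have hg2 : Function.Injective (TensorProduct.map g g) :=
    TensorProduct.map_injective_of_flat_flat _ _ hinj hinj
  have hg3 : Function.Injective (TensorProduct.map g (TensorProduct.map g g)) :=
    TensorProduct.map_injective_of_flat_flat _ _ hinj hg2
  have hred : redComul R A ∘ₗ g = TensorProduct.map g g ∘ₗ redDiv I R :=
    LinearMap.ext hb.redComul_linearCombination
  have hcomm : ∀ β γ, coef β γ τ = coef γ β τ := by
    have h : TensorProduct.comm R _ _ τ = τ := by
      apply hg2
      rw [TensorProduct.map_comm, hτ, comm_redComul]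
    intro β γ
    rw [← coef_comm, h]
  have hassoc : ∀ β γ δ, β ≠ 0 → γ ≠ 0 → δ ≠ 0 → coef (β + γ) δ τ = coef β (γ + δ) τ := by
    have h : TensorProduct.assoc R _ _ _ (LinearMap.rTensor _ (redDiv I R) τ)
        = LinearMap.lTensor _ (redDiv I R) τ := by
      apply hg3
      have h1 : TensorProduct.map g (TensorProduct.map g g)
            (LinearMap.lTensor _ (redDiv I R) τ)
          = LinearMap.lTensor A (redComul R A) (TensorProduct.map g g τ) := by
        simp only [LinearMap.lTensor, ← LinearMap.comp_apply, ← TensorProduct.map_comp, ← hred]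
        rfl
      have h2 : TensorProduct.map g (TensorProduct.map g g)
            (TensorProduct.assoc R _ _ _ (LinearMap.rTensor _ (redDiv I R) τ))
          = TensorProduct.assoc R _ _ _ (LinearMap.rTensor A (redComul R A)
            (TensorProduct.map g g τ)) := by
        rw [TensorProduct.map_map_assoc]
        simp only [LinearMap.rTensor, ← LinearMap.comp_apply, ← TensorProduct.map_comp, ← hred]
        rfl
      rw [h1, h2, hτ, coassoc_redComul hb.comul_one]
    intro β γ δ hβ hγ hδ
    -- The coefficient of a triple tensor at `(β, γ, δ)`.
    let F := (TensorProduct.lid R R).toLinearMap ∘ₗ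
      TensorProduct.map (lapply β : ((I →₀ ℕ) →₀ R) →ₗ[R] R) (coef (R := R) γ δ)
    have h1 : ∀ t, F (LinearMap.lTensor _ (redDiv I R) t) = coef β (γ + δ) t := by
      intro t
      induction t using TensorProduct.induction_on with
      | zero => simp
      | tmul x y => simp [F, coef_redDiv_of_ne y hγ hδ]
      | add x y hx hy => simp only [map_add, hx, hy]
    have h2 : ∀ t, F (TensorProduct.assoc R _ _ _ (LinearMap.rTensor _ (redDiv I R) t))
        = coef (β + γ) δ t := by
      intro t
      induction t using TensorProduct.induction_on with
      | zero => simp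
      | tmul x y =>
        rw [LinearMap.rTensor_tmul, coef_tmul, ← coef_redDiv_of_ne x hβ hγ]
        generalize redDiv I R x = z
        induction z using TensorProduct.induction_on with
        | zero => simp
        | tmul p q => simp [F, mul_assoc]
        | add p q hp hq => simp only [TensorProduct.add_tmul, map_add, hp, hq, add_mul]
      | add x y hx hy => simp only [map_add, hx, hy]
    rw [← h2, h, h1]
  -- `ε` reads off the coefficient at index `0`, and it kills the left factor of `Δ̄ a` because
  -- `ε(a) = 0`.
  have hzero : ∀ γ, coef 0 γ τ = 0 := by
    have h1 : TensorProduct.lid R A (LinearMap.rTensor A (Coalgebra.counit (R := R))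
        (TensorProduct.map g g τ)) = 0 := by
      rw [hτ, counit_redComul hb.counit_one, ha]; simp
    have h2 : ∀ t : ((I →₀ ℕ) →₀ R) ⊗[R] ((I →₀ ℕ) →₀ R),
        TensorProduct.lid R A (LinearMap.rTensor A (Coalgebra.counit (R := R))
          (TensorProduct.map g g t)) = g (coefRight 0 (TensorProduct.comm R _ _ t)) := by
      intro t
      induction t using TensorProduct.induction_on with
      | zero => simp
      | tmul x y => simp [hg, hb.counit_linearCombination]
      | add x y hx hy => simp only [map_add, hx, hy]
    rw [h2] at h1
    have h3 := hinj (h1.trans (map_zero _).symm)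
    intro γ
    rw [← coef_comm, ← coefRight_apply, h3]; rfl
  -- Coassociativity moves everything except one occurrence of `i` from the left index to the right
  -- one.
  have hmove : ∀ β γ i, γ ≠ 0 → β i ≠ 0 →
      coef β γ τ = coef (single i 1) (β + γ - single i 1) τ := by
    intro β γ i hγ hi
    obtain ⟨β, rfl⟩ := exists_eq_add_single hi
    rw [add_comm β, add_assoc, add_tsub_cancel_left]
    by_cases hβ : β = 0
    · simp [hβ]
    · exact hassoc _ _ _ (by simp) hβ hγ
  classical
  -- In degree at least two, any way of splitting off one variable gives the right value. Degree one
  -- is unconstrained, since `redDiv` kills it, and is set to `0`.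
  let pick : (I →₀ ℕ) → R := fun α =>
    if h : 2 ≤ α.degree ∧ ∃ i, α i ≠ 0 then
      coef (single h.2.choose 1) (α - single h.2.choose 1) τ else 0
  let d : (I →₀ ℕ) →₀ R := Finsupp.onFinset
    ((finsuppTensorFinsupp' R _ _ τ).support.image fun p => p.1 + p.2) pick (by
      intro α hα
      by_cases h : 2 ≤ α.degree ∧ ∃ i, α i ≠ 0
      · simp only [pick, dif_pos h] at hα
        refine Finset.mem_image.2 ⟨(single h.2.choose 1, α - single h.2.choose 1), ?_, ?_⟩
        · rw [Finsupp.mem_support_iff, finsuppTensorFinsupp'_eq_coef]; exact hα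
        · refine add_tsub_cancel_of_le ?_
          rw [Finsupp.single_le_iff]; exact Nat.one_le_iff_ne_zero.2 h.2.choose_spec
      · simp only [pick, dif_neg h] at hα
        exact absurd rfl hα)
  have hd0 : d 0 = 0 := by simp [d, pick]
  refine ⟨d, hd0, coef_ext fun β γ => ?_⟩
  rw [coef_redDiv]
  by_cases hβ : β = 0
  · subst hβ
    rw [hzero]
    by_cases hγ : γ = 0 <;> simp [hγ, hd0]
  by_cases hγ : γ = 0
  · subst hγ
    rw [hcomm, hzero]
    simp [hβ]
  simp only [hβ, hγ, if_false, add_zero, sub_zero]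
  have h1 : β.degree ≠ 0 := fun h => hβ ((Finsupp.degree_eq_zero_iff _).1 h)
  have h2 : γ.degree ≠ 0 := fun h => hγ ((Finsupp.degree_eq_zero_iff _).1 h)
  have h : 2 ≤ (β + γ).degree ∧ ∃ i, (β + γ) i ≠ 0 := by
    refine ⟨by rw [map_add]; omega, ?_⟩
    by_contra! hc
    have : β + γ = 0 := Finsupp.ext hc
    exact hβ (add_eq_zero.1 this).1
  change pick (β + γ) = _
  simp only [pick, dif_pos h]
  have hi := h.2.choose_spec
  generalize h.2.choose = i at hi
  -- The chosen variable occurs in `β` or in `γ`; in the latter case exchange the two by symmetry.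
  by_cases hi' : β i = 0
  · have : γ i ≠ 0 := by simpa [hi'] using hi
    rw [hcomm β γ, hmove γ β i hβ this, add_comm]
  · rw [hmove β γ i hγ hi']

/-- Induction on `n`. For `a` in `Āₙ₊₁` both factors of `Δ̄ a` can be placed in `Āₙ`, which lies in
the span by induction. Then `Δ̄ a` is the reduced coproduct of an element of the span, and the
difference is primitive. -/
theorem primFilt_le_range [Module.Flat R A] [Coalgebra.IsCocomm R A]
    (hinj : Function.Injective (Finsupp.linearCombination R b))
    (hprim : primFilt R A 1 ≤ LinearMap.range (Finsupp.linearCombination R b)) (n : ℕ) :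
    primFilt R A n ≤ LinearMap.range (Finsupp.linearCombination R b) := by
  induction n with
  | zero =>
    intro a ha
    have : a = 0 := ha.2
    rw [this]; exact zero_mem _
  | succ n ih =>
    intro a ha
    set g := Finsupp.linearCombination R b with hg
    let f := (iterRedComul R A n).2
    let h : LinearMap.ker f →ₗ[R] ((I →₀ ℕ) →₀ R) :=
      (LinearEquiv.ofInjective g hinj).symm.toLinearMap ∘ₗ Submodule.inclusion
        (fun x hx => ih ((mem_primFilt_iff hb.counit_one).2 hx))
    have hgh : g ∘ₗ h = (LinearMap.ker f).subtype := LinearMap.ext fun x =>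
      congrArg Subtype.val ((LinearEquiv.ofInjective g hinj).apply_symm_apply _)
    -- Flatness: an element killed by `Δ̄⁽ⁿ⁾ ⊗ id` comes from `ker Δ̄⁽ⁿ⁾ ⊗ A`, and this kernel is
    -- `Āₙ`.
    obtain ⟨t, ht⟩ := (Module.Flat.rTensor_exact A f.exact_subtype_ker_map _).1 ha.2
    have ht' : LinearMap.rTensor A g (LinearMap.rTensor A h t) = redComul R A a := by
      rw [← LinearMap.rTensor_comp_apply, hgh, ht]
    -- Cocommutativity gives the vanishing on the right factor in `A ⊗ A`. Flatness lifts it to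
    -- coordinates on the left, so the right factor can be moved into `Āₙ` as well.
    have hz : LinearMap.lTensor _ f (LinearMap.rTensor A h t) = 0 := by
      apply Module.Flat.rTensor_preserves_injective_linearMap (M := (iterRedComul R A n).1) g hinj
      rw [map_zero, ← lTensor_iterRedComul n a ha.2, ← ht']
      exact (LinearMap.congr_fun (LinearMap.rTensor_comp_lTensor ..) _).trans
        (LinearMap.congr_fun (LinearMap.lTensor_comp_rTensor ..) _).symm
    obtain ⟨t', ht''⟩ := (Module.Flat.lTensor_exact _ f.exact_subtype_ker_map _).1 hz
    have hτ : TensorProduct.map g g (LinearMap.lTensor _ h t') = redComul R A a := by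
      rw [← ht', ← ht'', ← hgh]
      clear_value h
      rw [LinearMap.lTensor_comp_apply]
      exact (LinearMap.congr_fun (LinearMap.rTensor_comp_lTensor ..) _).symm
    obtain ⟨d, hd0, hd⟩ := hb.exists_redDiv_eq hinj ha.1 hτ
    have hmem : a - g d ∈ primFilt R A 1 := by
      rw [mem_primFilt_one_iff hb.counit_one, map_sub, hg, hb.redComul_linearCombination, hd, ← hτ,
        sub_self]
    have := add_mem (hprim hmem) (LinearMap.mem_range_self g d)
    rwa [sub_add_cancel] at this

end IsDividedFamily

end Family

end RBialgebra

/-! ### Flatness of filtered modules -/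

/-- A projective quotient splits off, so `M` is a retract of `N × (M ⧸ N)`. -/
theorem Module.Projective.of_quotient {R M : Type*} [CommRing R] [AddCommGroup M] [Module R M]
    (N : Submodule R M) [Module.Projective R N] [Module.Projective R (M ⧸ N)] :
    Module.Projective R M := by
  obtain ⟨s, hs⟩ := Module.projective_lifting_property N.mkQ LinearMap.id N.mkQ_surjective
  have hs' : ∀ q, N.mkQ (s q) = q := LinearMap.congr_fun hs
  let p : M →ₗ[R] M := LinearMap.id - s ∘ₗ N.mkQ
  have hp : ∀ m, p m ∈ N := fun m => by
    refine (Submodule.Quotient.mk_eq_zero N).1 ?_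
    change N.mkQ (m - s (N.mkQ m)) = 0
    rw [map_sub, hs', sub_self]
  let i : M →ₗ[R] N × (M ⧸ N) := (p.codRestrict N hp).prod N.mkQ
  refine Module.Projective.of_split i (N.subtype.coprod s) (LinearMap.ext fun m => ?_)
  simp [i, p]

/-- The equational criterion concerns one finite relation at a time: lift it along the injection,
trivialise it in the flat module and map back. -/
theorem Module.Flat.of_forall_exists_injective {R M : Type u} [CommRing R] [AddCommGroup M]
    [Module R M]
    (h : ∀ (l : ℕ) (x : Fin l → M), ∃ (N : Type u) (_ : AddCommGroup N) (_ : Module R N)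
      (_ : Module.Flat R N) (j : N →ₗ[R] M), Function.Injective j ∧ ∀ i, x i ∈ LinearMap.range j) :
    Module.Flat R M := by
  refine Module.Flat.of_forall_isTrivialRelation fun {l f x} hx => ?_
  obtain ⟨N, _, _, _, j, hj, hr⟩ := h l x
  choose y hy using hr
  have h0 : ∑ i, f i • y i = 0 := hj (by simp [hy, hx])
  obtain ⟨k, a, z, h1, h2⟩ := Module.Flat.isTrivialRelation_of_sum_smul_eq_zero h0
  exact ⟨k, a, fun i => j (z i), fun i => by rw [← hy, h1]; simp, h2⟩

namespace RBialgebra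

open MultiIndex Finsupp

/-! ### Flatness of a bialgebra with free graded pieces. -/

section Filtration

variable {R A : Type u} [CommRing R] [Ring A] [Module R A] [Coalgebra R A]

/-- Each iterate factors through the preceding one, so the kernels increase. -/
theorem exists_iterRedComul_succ (n : ℕ) :
    ∃ φ : (iterRedComul R A n).1 →ₗ[R] (iterRedComul R A (n + 1)).1,
      ∀ a, (iterRedComul R A (n + 1)).2 a = φ ((iterRedComul R A n).2 a) := by
  induction n with
  | zero => exact ⟨(iterRedComul R A 1).2, fun a => rfl⟩
  | succ n ih =>
    obtain ⟨φ, hφ⟩ := ih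
    have h : (iterRedComul R A (n + 1)).2 = φ ∘ₗ (iterRedComul R A n).2 := LinearMap.ext hφ
    refine ⟨LinearMap.rTensor A φ, fun a => ?_⟩
    change LinearMap.rTensor A (iterRedComul R A (n + 1)).2 (redComul R A a)
      = LinearMap.rTensor A φ (LinearMap.rTensor A (iterRedComul R A n).2 (redComul R A a))
    rw [← LinearMap.rTensor_comp_apply, ← h]

theorem primFilt_mono : Monotone (primFilt R A) := by
  refine monotone_nat_of_le_succ fun n a ha => ⟨ha.1, ?_⟩
  obtain ⟨φ, hφ⟩ := exists_iterRedComul_succ (R := R) (A := A) n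
  have h : (iterRedComul R A n).2 a = 0 := ha.2
  exact (hφ a).trans (by rw [h, map_zero])

theorem primFilt_zero : primFilt R A 0 = ⊥ := eq_bot_iff.2 fun _ ha => ha.2

theorem projective_primFilt
    (hfree : ∀ n, Module.Free R (primFilt R A (n + 1) ⧸
      (primFilt R A n).submoduleOf (primFilt R A (n + 1)))) (n : ℕ) :
    Module.Projective R (primFilt R A n) := by
  induction n with
  | zero =>
    rw [primFilt_zero]
    infer_instance
  | succ n ih =>
    have := hfree n
    have : Module.Projective R ((primFilt R A n).submoduleOf (primFilt R A (n + 1))) :=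
      Module.Projective.of_equiv
        (Submodule.submoduleOfEquivOfLe (primFilt_mono (Nat.le_succ n))).symm
    exact Module.Projective.of_quotient
      ((primFilt R A n).submoduleOf (primFilt R A (n + 1)))

/-- By cocompleteness finitely many elements lie in a common `R ⊕ Āₙ`. This is projective, since
`Āₙ` is a finite iterated extension of free modules. -/
theorem flat_of_free_gr (h1 : Coalgebra.counit (R := R) (1 : A) = 1)
    (hfree : ∀ n, Module.Free R (primFilt R A (n + 1) ⧸
      (primFilt R A n).submoduleOf (primFilt R A (n + 1))))
    (hcoc : ∀ a : A, ∃ n, a ∈ Submodule.span R {(1 : A)} ⊔ primFilt R A n) :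
    Module.Flat R A := by
  refine Module.Flat.of_forall_exists_injective fun l x => ?_
  choose n hn using fun i => hcoc (x i)
  let N := Finset.univ.sup n
  have := projective_primFilt hfree N
  refine ⟨R × primFilt R A N, inferInstance, inferInstance, inferInstance,
    (LinearMap.toSpanSingleton R A 1).coprod (primFilt R A N).subtype, ?_, fun i => ?_⟩
  -- The sum `R • 1 + Āₙ` is direct because `ε` kills `Āₙ` and `ε(1) = 1`.
  · rw [injective_iff_map_eq_zero]
    rintro ⟨r, a⟩ h
    have h' : r • (1 : A) + a.1 = 0 := h
    have ha : Coalgebra.counit (R := R) a.1 = 0 := a.2.1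
    have hr : r = 0 := by
      have := congrArg (Coalgebra.counit (R := R)) h'
      simpa [h1, ha] using this
    rw [hr, zero_smul, zero_add] at h'
    exact Prod.ext hr (Subtype.ext h')
  · obtain ⟨y, hy, z, hz, e⟩ := Submodule.mem_sup.1 (hn i)
    obtain ⟨r, rfl⟩ := Submodule.mem_span_singleton.1 hy
    exact ⟨(r, ⟨z, primFilt_mono (Finset.le_sup (Finset.mem_univ i)) hz⟩), e⟩

end Filtration

/-! ### Graded pieces of a coalgebra with a basis of divided monomials. -/

section Family

variable {I : Type*} [DecidableEq I] {R A : Type u} [CommRing R] [Ring A] [Module R A]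
  [Coalgebra R A] {b : (I →₀ ℕ) → A} (hb : IsDividedFamily R b)

namespace IsDividedFamily

include hb

theorem mem_span_sup_primFilt
    (hsurj : Function.Surjective (Finsupp.linearCombination R b)) (a : A) :
    ∃ n, a ∈ Submodule.span R {(1 : A)} ⊔ primFilt R A n := by
  obtain ⟨c, rfl⟩ := hsurj a
  refine ⟨c.support.sup Finsupp.degree, ?_⟩
  rw [Finsupp.linearCombination_apply]
  refine Submodule.sum_mem _ fun α hα => Submodule.smul_mem _ _ ?_
  by_cases h : α = 0
  · rw [h, hb.zero]
    exact Submodule.mem_sup_left (Submodule.mem_span_singleton_self _)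
  · exact Submodule.mem_sup_right (hb.mem_primFilt h (Finset.le_sup hα))

theorem eq_zero_of_mem [Module.Flat R A]
    (hinj : Function.Injective (Finsupp.linearCombination R b)) {n : ℕ}
    {c : (I →₀ ℕ) →₀ R} (hc : Finsupp.linearCombination R b c ∈ primFilt R A n)
    (hd : ∀ α, c α ≠ 0 → n < α.degree) : c = 0 := by
  ext α
  by_contra h
  exact absurd (hb.coeff_eq_zero hinj hc h).2 (not_le.2 (hd α h))

/-- The class of `b α` in the graded piece of degree `|α| = n + 1`. -/
def grClass (n : ℕ) (α : {α : I →₀ ℕ // α.degree = n + 1}) :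
    primFilt R A (n + 1) ⧸ (primFilt R A n).submoduleOf (primFilt R A (n + 1)) :=
  Submodule.Quotient.mk ⟨b α.1, hb.mem_primFilt (by
    rintro h
    have := α.2
    rw [h, map_zero] at this
    omega) α.2.le⟩

/-- A relation modulo `Āₙ` is a combination of members of degree `n + 1` lying in `Āₙ`, whose
elements only involve degrees up to `n`. -/
theorem linearIndependent_grClass [Module.Flat R A]
    (hinj : Function.Injective (Finsupp.linearCombination R b)) (n : ℕ) :
    LinearIndependent R (hb.grClass n) := by
  rw [linearIndependent_iff]
  intro c hc
  have h1 : Finsupp.linearCombination R b (c.mapDomain Subtype.val) ∈ primFilt R A n := by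
    rw [Finsupp.linearCombination_mapDomain]
    let x : primFilt R A (n + 1) := Finsupp.linearCombination R
      (fun α : {α : I →₀ ℕ // α.degree = n + 1} => (⟨b α.1, hb.mem_primFilt (by
        rintro h
        have := α.2
        rw [h, map_zero] at this
        omega) α.2.le⟩ : primFilt R A (n + 1))) c
    have hx : Submodule.mkQ ((primFilt R A n).submoduleOf (primFilt R A (n + 1))) x = 0 := by
      rw [← hc, Finsupp.apply_linearCombination]
      rfl
    have hx' : (x : A) ∈ primFilt R A n := by
      rw [← LinearMap.mem_ker, Submodule.ker_mkQ] at hx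
      exact hx
    have : (x : A) = Finsupp.linearCombination R (b ∘ Subtype.val) c :=
      Finsupp.apply_linearCombination R (primFilt R A (n + 1)).subtype _ c
    rwa [← this]
  have h2 := hb.eq_zero_of_mem hinj h1 fun α hα => by
    by_cases h : α ∈ Set.range (Subtype.val : {α : I →₀ ℕ // α.degree = n + 1} → _)
    · obtain ⟨α, rfl⟩ := h
      have := α.2
      omega
    · exact absurd (Finsupp.mapDomain_of_notMem_range _ _ h) hα
  exact Finsupp.mapDomain_injective Subtype.val_injective (h2.trans Finsupp.mapDomain_zero.symm)

/-- Elements of `Āₙ₊₁` expand in degrees `1` to `n + 1`, and the terms of degree at most `n` vanish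
in the quotient. -/
theorem span_grClass [Module.Flat R A]
    (hbij : Function.Bijective (Finsupp.linearCombination R b)) (n : ℕ) :
    Submodule.span R (Set.range (hb.grClass n)) = ⊤ := by
  rw [eq_top_iff]
  rintro q -
  obtain ⟨x, rfl⟩ := Submodule.Quotient.mk_surjective _ q
  obtain ⟨c, hc⟩ := hbij.2 x.1
  have hcx : Finsupp.linearCombination R b c ∈ primFilt R A (n + 1) := hc ▸ x.2
  have hmem : ∀ α, α ≠ 0 ∧ α.degree ≤ n + 1 → b α ∈ primFilt R A (n + 1) :=
    fun α h => hb.mem_primFilt h.1 h.2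
  have hx : x = ∑ α ∈ c.support.attach, c α.1 • (⟨b α.1, hmem α.1
      (hb.coeff_eq_zero hbij.1 hcx (Finsupp.mem_support_iff.1 α.2))⟩ : primFilt R A (n + 1)) := by
    apply Subtype.ext
    rw [AddSubmonoidClass.coe_finsetSum, ← hc, Finsupp.linearCombination_apply, Finsupp.sum,
      ← Finset.sum_attach]
    rfl
  change Submodule.mkQ _ x ∈ _
  rw [hx, map_sum]
  refine Submodule.sum_mem _ fun α _ => ?_
  rw [map_smul]
  refine Submodule.smul_mem _ _ ?_
  obtain ⟨h0, h1⟩ := hb.coeff_eq_zero hbij.1 hcx (Finsupp.mem_support_iff.1 α.2)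
  rcases h1.eq_or_lt with h2 | h2
  · exact Submodule.subset_span ⟨⟨α.1, h2⟩, rfl⟩
  · convert Submodule.zero_mem _
    rw [← LinearMap.mem_ker, Submodule.ker_mkQ]
    exact hb.mem_primFilt h0 (Nat.le_of_lt_succ h2)

theorem mem_span_of_mem_primFilt_one [Module.Flat R A]
    (hbij : Function.Bijective (Finsupp.linearCombination R b)) {a : A}
    (ha : a ∈ primFilt R A 1) : a ∈ Submodule.span R (Set.range fun i => b (single i 1)) := by
  obtain ⟨c, rfl⟩ := hbij.2 a
  rw [Finsupp.linearCombination_apply]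
  refine Submodule.sum_mem _ fun α hα => Submodule.smul_mem _ _ (Submodule.subset_span ?_)
  obtain ⟨h0, h1⟩ := hb.coeff_eq_zero hbij.1 ha (Finsupp.mem_support_iff.1 hα)
  obtain ⟨i, β, rfl⟩ := exists_eq_add_single_of_ne_zero h0
  have h2 : β = 0 := (Finsupp.degree_eq_zero_iff β).1 (by simpa using h1)
  exact ⟨i, by simp [h2]⟩

end IsDividedFamily

end Family

end RBialgebra

/-! ### The enveloping algebra of a free Lie-Rinehart algebra -/

namespace UEnv

open MultiIndex Finsupp RBialgebra

section

variable {K R L : Type u} [Field K] [CommRing R] [Algebra K R] [LieRing L] [Module R L]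
  [LieRingModule L R] [LieRinehartRing R L] [LieAlgebra K L] [LieRinehartAlgebra K R L]

theorem ofLie_mem_primFilt (x : L) : ofLie K R L x ∈ primFilt R (UEnv K R L) 1 := by
  refine mem_primFilt_one.2 ⟨?_, ?_⟩
  · have h := counit_ofLie_mul (K := K) (R := R) x 1
    rw [mul_one, counit_one] at h
    rw [counit_eq, h]
    simpa using LieRinehartRing.leibniz_mul_right x (1 : R) 1
  · have h := comul_ofLie_mul (K := K) (R := R) x 1
    rwa [mul_one, comul_one, op2_tmul, mul_one] at h

variable [CharZero K] {I : Type*} [LinearOrder I] [Fintype I] (e : Module.Basis I R L)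

variable (K) in
/-- The divided monomials in a basis of `L`. -/
abbrev pbwDiv : (I →₀ ℕ) → UEnv K R L := divMon K fun i => ofLie K R L (e i)

theorem isDividedFamily_pbwDiv : IsDividedFamily R (pbwDiv K e) :=
  isDividedFamily_divMon K fun i => ofLie_mem_primFilt (e i)

/-- The factorials are invertible in characteristic zero, so this is the basis of ordered monomials
rescaled by units. -/
theorem pbwDiv_bijective : Function.Bijective (Finsupp.linearCombination R (pbwDiv K e)) := by
  let B : Module.Basis (I →₀ ℕ) R (UEnv K R L) :=
    Module.Basis.ofRepr (LinearEquiv.ofBijective _ (pbwSum_bijective (K := K) e)).symm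
  let w : (I →₀ ℕ) → Rˣ := fun α => Units.map (algebraMap K R : K →* R)
    (Units.mk0 ((multiFactorial α : K)⁻¹)
      (inv_ne_zero (Nat.cast_ne_zero.2 (multiFactorial_ne_zero α))))
  have h : ⇑(B.unitsSMul w) = pbwDiv K e := by
    funext α
    rw [Module.Basis.unitsSMul_apply, Units.smul_def]
    change algebraMap K R _ • pbwSum K e (single α 1) = _
    rw [pbwSum_single, algebraMap_smul]
    rfl
  rw [← h]
  have h2 : Finsupp.linearCombination R (B.unitsSMul w) = (B.unitsSMul w).repr.symm := by
    ext α; simp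
  rw [h2]
  exact (B.unitsSMul w).repr.symm.bijective

include e in
theorem flat_of_basis : Module.Flat R (UEnv K R L) := by
  have : Module.Free R (UEnv K R L) :=
    Module.Free.of_equiv (LinearEquiv.ofBijective _ (pbwSum_bijective (K := K) e))
  infer_instance

/-- The canonical map from `L` to the primitive elements of `𝒰(R, L)`. -/
def toPrim : LieRinehartAlgebra.Hom (AlgHom.id K R) L (Prim R (UEnv K R L)) where
  toFun x := ⟨ofLie K R L x, ofLie_mem_primFilt x⟩
  map_add' x y := Prim.ext ((ofLie K R L).map_add x y)
  map_smul' k x := Prim.ext (by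
    change ofLie K R L (k • x) = k • ofLie K R L x
    rw [← algebraMap_smul R k x, ofLie_smul, AlgHom.commutes, Algebra.smul_def])
  map_lie' {x y} := Prim.ext (ofLie_lie K x y)
  map_smul_apply' f x := Prim.ext (ofLie_smul K f x)
  apply_lie' f x := by
    have h := counit_ofLie_mul (K := K) x (f • (1 : UEnv K R L))
    rw [map_smul, counit_one, smul_eq_mul, mul_one] at h
    exact h.symm

theorem linearIndependent_ofLie : LinearIndependent R fun i => ofLie K R L (e i) := by
  have h : LinearIndependent R (pbwDiv K e) := (pbwDiv_bijective (K := K) e).1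
  have h2 := h.comp (fun i : I => single i 1) (Finsupp.single_left_injective one_ne_zero)
  convert h2 using 1
  funext i
  exact (divMon_single K (fun i => ofLie K R L (e i)) i).symm

/-- Primitive elements expand in divided monomials of degree one, which are the basis vectors
themselves. -/
theorem span_ofLie {a : UEnv K R L} (ha : a ∈ primFilt R (UEnv K R L) 1) :
    a ∈ Submodule.span R (Set.range fun i => ofLie K R L (e i)) := by
  have := flat_of_basis (K := K) e
  have h := (isDividedFamily_pbwDiv (K := K) e).mem_span_of_mem_primFilt_one (pbwDiv_bijective e) ha
  simpa only [pbwDiv, divMon_single] using h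

theorem linearIndependent_toPrim :
    LinearIndependent R fun i => toPrim (K := K) (R := R) (e i) :=
  LinearIndependent.of_comp Prim.val (linearIndependent_ofLie e)

theorem span_toPrim :
    Submodule.span R (Set.range fun i => toPrim (K := K) (R := R) (e i)) = ⊤ := by
  rw [eq_top_iff]
  rintro p -
  have h := span_ofLie e p.val_mem
  have h2 : (Set.range fun i => ofLie K R L (e i))
      = Prim.val (R := R) '' (Set.range fun i => toPrim (K := K) (R := R) (e i)) := by
    rw [← Set.range_comp]; rfl
  rw [h2, ← Submodule.map_span] at h
  obtain ⟨q, hq, hqp⟩ := h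
  rwa [← Prim.val_injective hqp]

include e in
theorem toPrim_bijective : Function.Bijective (toPrim (K := K) (R := R) (L := L)) := by
  let B : Module.Basis I R (Prim R (UEnv K R L)) :=
    Module.Basis.mk (linearIndependent_toPrim e) (span_toPrim e).ge
  have h : ∀ x : L, toPrim (K := K) (R := R) x = e.equiv B (Equiv.refl I) x := by
    intro x
    let f : L →ₗ[R] Prim R (UEnv K R L) :=
      { toFun := toPrim (K := K) (R := R)
        map_add' := fun x y => map_add (toPrim (K := K) (R := R)).toLieHom x y
        map_smul' := fun f x => (toPrim (K := K) (R := R)).map_smul_apply f x }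
    refine LinearMap.congr_fun (f := f) (g := (e.equiv B (Equiv.refl I)).toLinearMap)
      (e.ext fun i => ?_) x
    change toPrim (K := K) (R := R) (e i) = _
    simp [B]
  rw [funext h]
  exact (e.equiv B (Equiv.refl I)).bijective

end

/-! ### The enveloping algebra of the primitive elements of a bialgebra. -/

section OfPrim

variable {K R A : Type u} [Field K] [CommRing R] [Algebra K R] [Ring A] [Module R A]
  [IsScalarTower R A A] [Coalgebra R A] [IsBialgebra R A] [Algebra K A] [IsScalarTower K R A]

variable (K R A) in
/-- The homomorphism `f ↦ f • 1` from `R` to `A`. -/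
def unitHom : R →ₐ[K] A where
  toFun f := f • (1 : A)
  map_one' := one_smul _ _
  map_mul' f g := by rw [smul_mul_assoc, one_mul, smul_smul]
  map_zero' := zero_smul _ _
  map_add' f g := add_smul _ _ _
  commutes' k := by rw [algebraMap_smul, Algebra.algebraMap_eq_smul_one]

theorem unitHom_apply (f : R) : unitHom K R A f = f • (1 : A) := rfl

variable (K R A) in
/-- The canonical homomorphism from the enveloping algebra of the primitive elements of `A`. -/
def ofPrimAlg : UEnv K R (Prim R A) →ₐ[K] A :=
  lift K (unitHom K R A) (Prim.val (R := R) (A := A)).toAddMonoidHom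
    (fun f x => by
      simp only [LinearMap.toAddMonoidHom_coe, unitHom_apply, map_smul, smul_mul_assoc, one_mul])
    (fun x y => by simp only [LinearMap.toAddMonoidHom_coe, Prim.val_lie])
    (fun x f => by
      simp only [LinearMap.toAddMonoidHom_coe, unitHom_apply, Prim.val_mul_smul_one,
        smul_mul_assoc, one_mul])

theorem ofPrimAlg_ofLie (x : Prim R A) : ofPrimAlg K R A (ofLie K R _ x) = Prim.val x := by
  exact lift_ofLie _ _ _ _ _ x

theorem ofPrimAlg_smul (f : R) (u : UEnv K R (Prim R A)) :
    ofPrimAlg K R A (f • u) = f • ofPrimAlg K R A u := by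
  refine (lift_smul _ _ _ _ _ f u).trans ?_
  rw [unitHom_apply, smul_mul_assoc, one_mul]
  rfl

variable (K R A) in
/-- `ofPrimAlg` as a homomorphism of coalgebras. -/
def ofPrim : UEnv K R (Prim R A) →ₗc[R] A where
  toFun := ofPrimAlg K R A
  map_add' := map_add _
  map_smul' := ofPrimAlg_smul
  counit_comp := LinearMap.ext fun u => by
    change Coalgebra.counit (R := R) (ofPrimAlg K R A u) = counit u
    induction u using UEnv.induction with
    | h1 => rw [map_one, IsBialgebra.counit_one, counit_one]
    | hadd u v hu hv => simp only [map_add, hu, hv]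
    | hfun f u hu => rw [ofPrimAlg_smul, map_smul, hu, map_smul]
    | hlie x u hu =>
      rw [map_mul, ofPrimAlg_ofLie, IsBialgebra.counit_mul, hu, counit_ofLie_mul]
      rfl
  map_comp_comul := LinearMap.ext fun u => by
    let F : UEnv K R (Prim R A) →ₗ[R] A :=
      { toFun := ofPrimAlg K R A, map_add' := map_add _, map_smul' := ofPrimAlg_smul }
    change TensorProduct.map F F (comul u) = Coalgebra.comul (R := R) (ofPrimAlg K R A u)
    -- Since `x` is primitive in `A`, multiplication by `Δ(x)` is the action of `x ⊗ 1 + 1 ⊗ x`, the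
    -- operator that defines the coproduct on the enveloping algebra.
    have h : ∀ (x : Prim R A) (t : UEnv K R (Prim R A) ⊗[R] UEnv K R (Prim R A)),
        TensorProduct.map F F (op2 x t)
          = takeuchiMul R ⟨Coalgebra.comul (Prim.val x), IsBialgebra.comul_mem _⟩
            (TensorProduct.map F F t) := by
      intro x t
      induction t using TensorProduct.induction_on with
      | zero => simp
      | tmul a b =>
        rw [TensorProduct.map_tmul, takeuchiMul_primitive x.val_mem]
        simp [F, ofPrimAlg_ofLie]
      | add s t hs ht => simp only [map_add, hs, ht]
    induction u using UEnv.induction with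
    | h1 => simp [comul_one, F, IsBialgebra.comul_one]
    | hadd u v hu hv => simp only [map_add, hu, hv]
    | hfun f u hu => rw [ofPrimAlg_smul, map_smul, map_smul, hu, map_smul]
    | hlie x u hu =>
      rw [comul_ofLie_mul, h, hu, map_mul, ofPrimAlg_ofLie, IsBialgebra.comul_mul]

/-- A cocomplete bialgebra that is flat and has free primitive elements is the enveloping algebra
of its primitive elements. -/
theorem ofPrim_bijective [CharZero K] [Coalgebra.IsCocomm R A] [Module.Flat R A]
    {I : Type*} [LinearOrder I] [Fintype I] (e : Module.Basis I R (Prim R A))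
    (hcoc : ∀ a : A, ∃ n, a ∈ Submodule.span R {(1 : A)} ⊔ primFilt R A n) :
    Function.Bijective (ofPrim K R A) := by
  let b : (I →₀ ℕ) → A := divMon K fun i => Prim.val (e i)
  have hb : IsDividedFamily R b := isDividedFamily_divMon K fun i => (e i).val_mem
  have hsingle : ∀ i, b (single i 1) = Prim.val (e i) := divMon_single K _
  have hinj : Function.Injective (Finsupp.linearCombination R b) := by
    refine hb.linearCombination_injective ?_
    simp only [hsingle]
    exact e.linearIndependent.map' _ (LinearMap.ker_eq_bot.2 Prim.val_injective)
  -- Base of the induction that generates `A`: primitive elements are combinations of the degree-one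
  -- members.
  have hprim : primFilt R A 1 ≤ LinearMap.range (Finsupp.linearCombination R b) := by
    intro a ha
    have h := e.sum_repr ⟨a, ha⟩
    have h2 : a = ∑ i, e.repr ⟨a, ha⟩ i • b (single i 1) := by
      have := congrArg Prim.val h
      rw [map_sum] at this
      simp only [map_smul] at this
      simp only [hsingle]
      exact this.symm
    rw [h2]
    refine Submodule.sum_mem _ fun i _ => Submodule.smul_mem _ _ ⟨single (single i 1) 1, by simp⟩
  have hsurj : Function.Surjective (Finsupp.linearCombination R b) := by
    intro a
    obtain ⟨n, hn⟩ := hcoc a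
    refine (sup_le ?_ (hb.primFilt_le_range hinj hprim n) : _ ≤ LinearMap.range _) hn
    rw [Submodule.span_singleton_le_iff_mem]
    exact ⟨single 0 1, by simp [hb.zero]⟩
  -- An algebra homomorphism takes divided monomials to divided monomials, so the map identifies the
  -- bases of the two sides.
  have hcomp : ∀ c, ofPrim K R A (Finsupp.linearCombination R (pbwDiv K e) c)
      = Finsupp.linearCombination R b c := by
    intro c
    have := Finsupp.apply_linearCombination R (ofPrim K R A : _ →ₗ[R] A) (pbwDiv K e) c
    refine this.trans ?_
    congr 2
    funext α
    refine (map_divMon K (ofPrimAlg K R A) _ α).trans ?_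
    simp only [ofPrimAlg_ofLie, b]
  constructor
  · intro u v huv
    obtain ⟨c, rfl⟩ := (pbwDiv_bijective (K := K) e).2 u
    obtain ⟨d, rfl⟩ := (pbwDiv_bijective (K := K) e).2 v
    rw [hcomp, hcomp] at huv
    rw [hinj huv]
  · intro a
    obtain ⟨c, rfl⟩ := hsurj a
    exact ⟨_, hcomp c⟩

end OfPrim

end UEnv

open TopologicalSpace Opposite TopCat Topology

/-! ### Isomorphisms of sheaves -/

/-- Near a point compare `s` with a section `t` having the same value there: the images agree nearby
as sections, and injectivity gives `s = t` nearby. This is what makes a stalkwise inverse a morphism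
of sheaves. -/
theorem IsEtale.pred_of_injective {X : TopCat.{u}} {T T' : X → Type u} {P : LocalPredicate T}
    {P' : LocalPredicate T'} (hP : IsEtale P) (hP' : IsEtale P') (φ : ∀ x, T x → T' x)
    (hφ : ∀ {U : Opens X} (s : ∀ y : U, T y), P.pred s → P'.pred fun y : U => φ y (s y))
    (hinj : ∀ x, Function.Injective (φ x)) {U : Opens X} (s : ∀ y : U, T y)
    (hs : P'.pred fun y : U => φ y (s y)) : P.pred s := by
  refine P.locality s fun x => ?_
  obtain ⟨V, hV, t, ht, e⟩ := hP.exists_sec x.1 (s x)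
  have h := hP'.eq_nhds x.1 (U ⊓ V) ⟨x.2, hV⟩ _ _ (P'.res (Opens.infLELeft U V) _ hs)
    (P'.res (Opens.infLERight U V) _ (hφ t ht)) (congrArg (φ x.1) e.symm)
  obtain ⟨W, hW, hWo, hxW⟩ := _root_.eventually_nhds_iff.1 h
  refine ⟨⟨W, hWo⟩ ⊓ (U ⊓ V), ⟨hxW, x.2, hV⟩, homOfLE fun y hy => hy.2.1, ?_⟩
  have e2 : (fun y : (⟨W, hWo⟩ ⊓ (U ⊓ V) : Opens X) => s ⟨y.1, y.2.2.1⟩)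
      = fun y : (⟨W, hWo⟩ ⊓ (U ⊓ V) : Opens X) => t ⟨y.1, y.2.2.2⟩ :=
    funext fun y => hinj y.1 (hW y.1 y.2.1 y.2.2)
  have h2 := P.res (homOfLE fun y hy => hy.2.2 : ⟨W, hWo⟩ ⊓ (U ⊓ V) ⟶ V) t ht
  exact (congrArg P.pred e2).mpr h2

theorem LieAlgebroid.isIso_of_bijective {K : Type u} [Field K] {S : KSpace K}
    {L L' : LieAlgebroid S} (φ : L ⟶ L')
    (h : ∀ x, Function.Bijective (LieAlgebroid.Hom.toFun φ x)) : IsIso φ := by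
  let φ' : LieAlgebroid.Hom L L' := φ
  let e : ∀ x, L.stalk x ≃ L'.stalk x := fun x => Equiv.ofBijective _ (h x)
  have hr : ∀ x (b : L'.stalk x), φ'.toFun x ((e x).symm b) = b :=
    fun x b => (e x).apply_symm_apply b
  have hl : ∀ x (a : L.stalk x), (e x).symm (φ'.toFun x a) = a :=
    fun x a => (e x).symm_apply_apply a
  let ψ : LieAlgebroid.Hom L' L :=
    { toFun := fun x =>
        { toFun := (e x).symm
          map_add' := fun a b => (h x).1 (by
            change φ'.toFun x _ = φ'.toFun x _
            rw [map_add (φ'.toFun x).toLieHom, hr, hr, hr])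
          map_smul' := fun k a => (h x).1 (by
            change φ'.toFun x _ = φ'.toFun x (k • _)
            rw [map_smul (φ'.toFun x).toLieHom, hr, hr])
          map_lie' := fun {a b} => (h x).1 (by
            change φ'.toFun x ((e x).symm ⁅a, b⁆) = φ'.toFun x _
            rw [LieHom.map_lie, hr, hr, hr])
          map_smul_apply' := fun f a => (h x).1 (by
            change φ'.toFun x ((e x).symm (f • a)) = φ'.toFun x (f • (e x).symm a)
            rw [LieRinehartAlgebra.Hom.map_smul_apply, hr, hr]; rfl)
          apply_lie' := fun f a => by
            have := (φ'.toFun x).apply_lie f ((e x).symm a)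
            rw [hr] at this
            exact this.symm }
      map_sec := fun s hs =>
        L.isModuleSheaf.pred_of_injective L'.isModuleSheaf.toIsEtale (fun x => φ'.toFun x)
          φ'.map_sec (fun x => (h x).1) _ (by
            change L'.sec.pred fun y => φ'.toFun y ((e y).symm (s y))
            simpa only [hr] using hs) }
  exact ⟨ψ, LieAlgebroid.Hom.ext' hl, LieAlgebroid.Hom.ext' hr⟩

theorem BialgebraSheaf.isIso_of_bijective {K : Type u} [Field K] {S : KSpace K}
    {A B : BialgebraSheaf S} (φ : A ⟶ B)
    (h : ∀ x, Function.Bijective (BialgebraSheaf.Hom.toFun φ x)) : IsIso φ := by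
  let φ' : BialgebraSheaf.Hom A B := φ
  let e : ∀ x, A.stalk x ≃ₗc[S.stalk x] B.stalk x := fun x =>
    CoalgEquiv.ofBijective (h x)
  have hr : ∀ x (b : B.stalk x), φ'.toFun x ((e x).symm b) = b :=
    fun x b => (e x).apply_symm_apply b
  have hl : ∀ x (a : A.stalk x), (e x).symm (φ'.toFun x a) = a :=
    fun x a => (e x).symm_apply_apply a
  let ψ : BialgebraSheaf.Hom B A :=
    { toFun := fun x => ((e x).symm : B.stalk x →ₗc[S.stalk x] A.stalk x)
      map_one := fun x => (h x).1 (by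
        change φ'.toFun x ((e x).symm 1) = φ'.toFun x 1
        rw [hr, φ'.map_one])
      map_mul := fun x a b => (h x).1 (by
        change φ'.toFun x ((e x).symm (a * b)) = φ'.toFun x ((e x).symm a * (e x).symm b)
        rw [φ'.map_mul, hr, hr, hr])
      map_sec := fun s hs =>
        A.isModuleSheaf.pred_of_injective B.isModuleSheaf.toIsEtale (fun x => φ'.toFun x)
          φ'.map_sec (fun x => (h x).1) _ (by
            change B.sec.pred fun y => φ'.toFun y ((e y).symm (s y))
            simpa only [hr] using hs) }
  exact ⟨ψ, BialgebraSheaf.Hom.ext' hl, BialgebraSheaf.Hom.ext' hr⟩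

/-! ### The unit and the counit -/

theorem UEnv.ofPrimAlg_mapAlg {K R A B : Type u} [Field K] [CommRing R] [Algebra K R]
    [Ring A] [Module R A] [IsScalarTower R A A] [Coalgebra R A] [RBialgebra.IsBialgebra R A]
    [Algebra K A] [IsScalarTower K R A]
    [Ring B] [Module R B] [IsScalarTower R B B] [Coalgebra R B] [RBialgebra.IsBialgebra R B]
    [Algebra K B] [IsScalarTower K R B] (φ : A →ₗc[R] B) (h1 : φ 1 = 1)
    (hmul : ∀ a b, φ (a * b) = φ a * φ b)
    (ψ : LieRinehartAlgebra.Hom (AlgHom.id K R) (RBialgebra.Prim R A) (RBialgebra.Prim R B))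
    (hψ : ∀ a, RBialgebra.Prim.val (ψ a) = φ (RBialgebra.Prim.val a))
    (u : UEnv K R (RBialgebra.Prim R A)) :
    ofPrimAlg K R B (mapAlg ψ u) = φ (ofPrimAlg K R A u) := by
  induction u using UEnv.induction with
  | h1 => rw [map_one, map_one, map_one, h1]
  | hadd u v hu hv => simp only [map_add, hu, hv]
  | hfun f u hu => rw [mapAlg_smul, ofPrimAlg_smul, ofPrimAlg_smul, hu, map_smul]
  | hlie a u hu =>
    rw [map_mul, map_mul, map_mul, hmul, hu, mapAlg_ofLie, ofPrimAlg_ofLie, ofPrimAlg_ofLie, hψ]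

section Adjunction

variable {K : Type u} [Field K] {S : KSpace K}

/-- The canonical morphism `L → 𝒫(𝒰(L))`. -/
def LieAlgebroid.toPrimEnv (L : LieAlgebroid S) : LieAlgebroid.Hom L L.env.prim where
  toFun _ := UEnv.toPrim
  map_sec s hs := L.envSec_ofLie s hs

/-- The canonical morphism `𝒰(𝒫(A)) → A`. -/
def BialgebraSheaf.ofEnvPrim (A : BialgebraSheaf S) : BialgebraSheaf.Hom A.prim.env A where
  toFun x := UEnv.ofPrim K (S.stalk x) (A.stalk x)
  map_one x := map_one (UEnv.ofPrimAlg K (S.stalk x) (A.stalk x))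
  map_mul x := map_mul (UEnv.ofPrimAlg K (S.stalk x) (A.stalk x))
  map_sec t ht := by
    refine A.prim.envSec_induction (p := fun {U} t =>
      A.sec.pred fun y : U => UEnv.ofPrimAlg K (S.stalk y) (A.stalk y) (t y)) ?_ ?_ ?_ ?_ ?_ t ht
    · intro U t h
      exact A.sec.locality _ h
    · intro U f hf
      have h : ∀ y : U, UEnv.ofPrimAlg K (S.stalk y) (A.stalk y) (UEnv.ofFun K _ _ (f y))
          = f y • (1 : A.stalk y) := fun y => by
        rw [UEnv.ofFun_eq, UEnv.ofPrimAlg_smul, map_one]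
      exact (funext h) ▸ A.isModuleSheaf.smul f _ hf (A.sec_one U)
    · intro U s hs
      exact (funext fun y => UEnv.ofPrimAlg_ofLie (K := K) (s y)) ▸ hs
    · intro U s t hs ht
      exact (funext fun y : U => map_add (UEnv.ofPrimAlg K (S.stalk y) (A.stalk y)) (s y) (t y)) ▸
        A.isModuleSheaf.add _ _ hs ht
    · intro U s t _ _ hs ht
      exact (funext fun y : U => map_mul (UEnv.ofPrimAlg K (S.stalk y) (A.stalk y)) (s y) (t y)) ▸
        A.sec_mul _ _ hs ht

variable (S) in
/-- The natural transformation `L → 𝒫(𝒰(L))`. -/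
def unitTrans : 𝟭 (LieAlgebroid S) ⟶ envFunctor S ⋙ primFunctor S where
  app L := L.toPrimEnv
  naturality _ _ φ := LieAlgebroid.Hom.ext' fun x a =>
    RBialgebra.Prim.ext (UEnv.mapAlg_ofLie (LieAlgebroid.Hom.toFun φ x) a).symm

variable (S) in
/-- The natural transformation `𝒰(𝒫(A)) → A`. -/
def counitTrans : primFunctor S ⋙ envFunctor S ⟶ 𝟭 (BialgebraSheaf S) where
  app A := A.ofEnvPrim
  naturality _ _ φ := BialgebraSheaf.Hom.ext' fun x u =>
    UEnv.ofPrimAlg_mapAlg (BialgebraSheaf.Hom.toFun φ x) (BialgebraSheaf.Hom.map_one φ x)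
      (BialgebraSheaf.Hom.map_mul φ x) ((BialgebraSheaf.Hom.prim φ).toFun x) (fun _ => rfl) u

end Adjunction

/-! ### The enveloping algebroid of a locally free Lie algebroid -/

namespace LieAlgebroid

open RBialgebra MultiIndex

variable {K : Type u} [Field K] [CharZero K] {S : KSpace K} {L : LieAlgebroid S}

/-- Provides the local sections that induce bases of the graded pieces. -/
theorem envSec_divMon {I : Type*} [LinearOrder I] [Fintype I] {U : Opens S.X}
    (e : I → ∀ y : U, L.stalk y) (he : ∀ i, L.sec.pred (e i)) (α : I →₀ ℕ) :
    L.envSec.pred fun y : U =>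
      divMon K (fun i => UEnv.ofLie K (S.stalk y) (L.stalk y) (e i y)) α := by
  have h : L.envSec.pred fun y : U =>
      mon (fun i => UEnv.ofLie K (S.stalk y) (L.stalk y) (e i y)) α := by
    induction α using below_induction with
    | h0 => simpa only [mon_zero, map_one] using L.envSec_const U 1
    | hs j β hβ ih =>
      simp only [mon_add_single _ hβ]
      exact L.envSec_mul _ _ (L.envSec_ofLie _ (he j)) ih
  simp only [divMon, Algebra.smul_def]
  exact L.envSec_mul _ _ (L.envSec_const U _) h

theorem exists_basis (hL : locallyFreeOfFiniteRank S L) (x : S.X) :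
    ∃ n : ℕ, Nonempty (Module.Basis (Fin n) (S.stalk x) (L.stalk x)) := by
  obtain ⟨U, hx, n, e, -, h⟩ := hL x
  obtain ⟨h1, h2⟩ := h ⟨x, hx⟩
  exact ⟨n, ⟨Module.Basis.mk h1 h2.ge⟩⟩

theorem env_isCocomplete (hL : locallyFreeOfFiniteRank S L) : L.env.IsCocomplete := by
  intro x a
  obtain ⟨n, ⟨b⟩⟩ := exists_basis hL x
  exact (UEnv.isDividedFamily_pbwDiv (K := K) b).mem_span_sup_primFilt
    (UEnv.pbwDiv_bijective b).2 a

/-- Over an open set with a basis of sections of `L`, the classes of the divided monomials of degree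
`n + 1` are a basis at every point and are induced by sections. -/
theorem env_isLocallyGradedFree (hL : locallyFreeOfFiniteRank S L) :
    L.env.IsLocallyGradedFree := by
  intro n x
  obtain ⟨U, hx, k, e, he, h⟩ := hL x
  let b : ∀ y : U, Module.Basis (Fin k) (S.stalk y) (L.stalk y) := fun y =>
    Module.Basis.mk (h y).1 (h y).2.ge
  have hb : ∀ y i, b y i = e i y := fun y i => Module.Basis.mk_apply _ _ i
  let I := {α : Fin k →₀ ℕ // α.degree = n + 1}
  let hd : ∀ y : U, IsDividedFamily (S.stalk y) (UEnv.pbwDiv K (b y)) := fun y =>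
    UEnv.isDividedFamily_pbwDiv (b y)
  -- The index set of a local basis must live in universe `u`.
  refine ⟨U, hx, ULift.{u} I, fun i y => (hd y).grClass n i.down, fun i x => ?_, fun y => ?_⟩
  · refine ⟨U, x.2, 𝟙 U, fun y => ⟨UEnv.pbwDiv K (b y) i.down.1, (hd y).mem_primFilt (by
      rintro h
      have := i.down.2
      rw [h, map_zero] at this
      omega) i.down.2.le⟩, ?_, fun y => rfl⟩
    have := envSec_divMon (K := K) e he i.down.1
    simp only [← hb] at this
    exact this
  · have := UEnv.flat_of_basis (K := K) (b y)
    refine ⟨((hd y).linearIndependent_grClass (UEnv.pbwDiv_bijective (b y)).1 n).comp ULift.down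
      ULift.down_injective, ?_⟩
    have h2 := (hd y).span_grClass (UEnv.pbwDiv_bijective (b y)) n
    rw [← ULift.down_surjective.range_comp ((hd y).grClass n)] at h2
    exact h2

/-- A local basis of `L` is mapped to a local basis of the primitive elements. -/
theorem env_isOfFiniteType (hL : locallyFreeOfFiniteRank S L) : L.env.IsOfFiniteType := by
  intro x
  obtain ⟨U, hx, k, e, he, h⟩ := hL x
  let b : ∀ y : U, Module.Basis (Fin k) (S.stalk y) (L.stalk y) := fun y =>
    Module.Basis.mk (h y).1 (h y).2.ge
  have hb : ∀ y, ⇑(b y) = fun i => e i y := fun y => funext fun i => Module.Basis.mk_apply _ _ i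
  refine ⟨U, hx, k, fun i y => L.toPrimEnv.toFun y (e i y), fun i => L.toPrimEnv.map_sec _ (he i),
    fun y => ?_⟩
  have h1 := UEnv.linearIndependent_toPrim (K := K) (b y)
  have h2 := UEnv.span_toPrim (K := K) (b y)
  rw [hb] at h1 h2
  exact ⟨h1, h2⟩

theorem isIso_toPrimEnv (hL : locallyFreeOfFiniteRank S L) : IsIso ((unitTrans S).app L) :=
  isIso_of_bijective _ fun x => by
    obtain ⟨n, ⟨b⟩⟩ := exists_basis hL x
    exact UEnv.toPrim_bijective b

end LieAlgebroid

/-! ### Bialgebras of finite type -/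

namespace BialgebraSheaf

variable {K : Type u} [Field K] [CharZero K] {S : KSpace K} {A : BialgebraSheaf S}

/-- The only use of local graded freeness in recovering `A` from its primitive elements. -/
theorem flat_stalk (hc : A.IsCocomplete) (hg : A.IsLocallyGradedFree) (x : S.X) :
    Module.Flat (S.stalk x) (A.stalk x) := by
  refine RBialgebra.flat_of_free_gr RBialgebra.IsBialgebra.counit_one (fun n => ?_) (hc x)
  obtain ⟨U, hx, ι, e, -, h⟩ := hg n x
  obtain ⟨h1, h2⟩ := h ⟨x, hx⟩
  exact Module.Free.of_basis (Module.Basis.mk h1 h2.ge)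

theorem isIso_ofEnvPrim (hA : cocompleteLocallyGradedFreeOfFiniteType S A) :
    IsIso ((counitTrans S).app A) := by
  obtain ⟨hc, hg, hf⟩ := hA
  refine isIso_of_bijective _ fun x => ?_
  have := flat_stalk hc hg x
  obtain ⟨n, ⟨b⟩⟩ := LieAlgebroid.exists_basis (L := A.prim) hf x
  exact UEnv.ofPrim_bijective (A := A.stalk x) b (hc x)

end BialgebraSheaf

end

theorem mainTheorem3 {K : Type u} [Field K] [CharZero K] (S : KSpace K) :
    ∃ (hU : ∀ L : LieAlgebroid S, LieAlgebroid.locallyFreeOfFiniteRank S L →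
          BialgebraSheaf.cocompleteLocallyGradedFreeOfFiniteType S ((envFunctor S).obj L))
      (hP : ∀ A : BialgebraSheaf S, BialgebraSheaf.cocompleteLocallyGradedFreeOfFiniteType S A →
          LieAlgebroid.locallyFreeOfFiniteRank S ((primFunctor S).obj A))
      (e : (LieAlgebroid.locallyFreeOfFiniteRank S).FullSubcategory ≌
          (BialgebraSheaf.cocompleteLocallyGradedFreeOfFiniteType S).FullSubcategory),
      e.functor = ObjectProperty.lift _
          ((LieAlgebroid.locallyFreeOfFiniteRank S).ι ⋙ envFunctor S)
          (fun L => hU L.obj L.property) ∧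
      e.inverse = ObjectProperty.lift _
          ((BialgebraSheaf.cocompleteLocallyGradedFreeOfFiniteType S).ι ⋙ primFunctor S)
          (fun A => hP A.obj A.property) := by
  have hU : ∀ L : LieAlgebroid S, LieAlgebroid.locallyFreeOfFiniteRank S L →
      BialgebraSheaf.cocompleteLocallyGradedFreeOfFiniteType S ((envFunctor S).obj L) :=
    fun _ hL => ⟨LieAlgebroid.env_isCocomplete hL, LieAlgebroid.env_isLocallyGradedFree hL,
      LieAlgebroid.env_isOfFiniteType hL⟩
  -- This is the finite type condition itself.
  have hP : ∀ A : BialgebraSheaf S, BialgebraSheaf.cocompleteLocallyGradedFreeOfFiniteType S A →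
      LieAlgebroid.locallyFreeOfFiniteRank S ((primFunctor S).obj A) := fun _ hA => hA.2.2
  let F := ObjectProperty.lift (BialgebraSheaf.cocompleteLocallyGradedFreeOfFiniteType S)
    ((LieAlgebroid.locallyFreeOfFiniteRank S).ι ⋙ envFunctor S) fun L => hU L.obj L.property
  let G := ObjectProperty.lift (LieAlgebroid.locallyFreeOfFiniteRank S)
    ((BialgebraSheaf.cocompleteLocallyGradedFreeOfFiniteType S).ι ⋙ primFunctor S)
    fun A => hP A.obj A.property
  let η : 𝟭 _ ≅ F ⋙ G := NatIso.ofComponents (fun L =>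
      have := LieAlgebroid.isIso_toPrimEnv L.property
      ObjectProperty.isoMk (X := L) (Y := G.obj (F.obj L)) _ (asIso ((unitTrans S).app L.obj)))
    fun φ => InducedCategory.hom_ext ((unitTrans S).naturality φ.hom)
  let ε : G ⋙ F ≅ 𝟭 _ := NatIso.ofComponents (fun A =>
      have := BialgebraSheaf.isIso_ofEnvPrim A.property
      ObjectProperty.isoMk (X := F.obj (G.obj A)) (Y := A) _ (asIso ((counitTrans S).app A.obj)))
    fun φ => InducedCategory.hom_ext ((counitTrans S).naturality φ.hom)
  -- `Equivalence.mk` adjusts the unit so that the triangle identities hold, and leaves both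
  -- functors unchanged.
  exact ⟨hU, hP, CategoryTheory.Equivalence.mk F G η ε, rfl, rfl⟩
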